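/- All matroids are finite. For a matroid $M$ of rank $r$ with ground set $E$, $|E|=n$, let $P(M)\subset\mathbb R^E$ be the convex hull of the characteristic vectors of its bases, and let $\Delta(r,n)\subset\mathbb R^E$ be the convex hull of all $0,1$-vectors with exactly $r$ ones. For a flat $F$ put $H(F)=\{x\in\mathbb R^E:\sum_{i\in F}x_i=r(F)\}$. A *split* of a polytope $P$ is a collection $\mathcal C$ of polytopes such that: $\emptyset\in\mathcal C$; for every $Q\in\mathcal C$ all vertices of $Q$ are vertices of $P$ and all faces of $Q$ are in $\mathcal C$; the intersection of two distinct members of $\mathcal C$ is a face of both; the union of $\mathcal C$ is $P$; and $\mathcal C$ has exactly two inclusion-maximal members. The affine span of the intersection of these two maximal members is called a *split hyperplane* of $P$. A flat $F$ of $M$ is a *flacet* if $H(F)\cap P(M)$ is a facet of $P(M)$ and no flat $G\subsetneq F$ has $H(G)\cap P(M)=H(F)\cap P(M)$. It is a *split flacet* if, in addition, the affine span of $H(F)\cap\Delta(r,n)$ is a split hyperplane of $\Delta(r,n)$. Let $A$ be the affine span of $P(M)$. The matroid $M$ is a *split matroid* if, for any two distinct split flacets $F_1,F_2$ of $M$,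 no point of $H(F_1)\cap H(F_2)$ is in the relative interior of $A\cap[0,1]^E$. An *excluded minor* for the class of split matroids is a matroid that is not split but all of whose proper minors are split. Let $M(\mathcal W_2)$ be the cycle matroid of the graph obtained from a triangle by adding one edge parallel to one of its edges. Let $S_0=M(\mathcal W_2)\oplus M(\mathcal W_2)$, and let $S_1,S_2,S_3,S_4$ be the following rank-$3$ matroids on $\{a,b,c,d,x,y\}$; in each case the bases are exactly the $3$-element subsets of $\{a,b,c,d,x,y\}$ satisfying the stated conditions: - $S_1$: not containing $\{a,b\}$ and not containing $\{x,y\}$; - $S_2$: not containing $\{c,d\}$, not contained in $\{a,b,c,d\}$ and not contained in $\{c,d,x,y\}$; - $S_3$: not containing $\{x,y\}$, not contained in $\{a,b,x,y\}$ and not equal to $\{a,c,d\}$; - $S_4$: not containing $\{x,y\}$ and not contained in $\{a,b,x,y\}$. **Theorem.** A matroid is an excluded minor for the class of split matroids if and only if it is isomorphic to one of $S_0,S_1,S_2,S_3,S_4$. -/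

import Mathlib

open Set

namespace SplitMatroids

/-! ### Polytopes, faces and splits

The faces of a polytope `P` are its exposed subsets `IsExposed ℝ P F` in the sense of Mathlib:
`F` is empty, or it is the set of points of `P` at which some linear functional attains its maximum
over `P`. This includes `∅` and `P` itself (zero functional), and every other face is the non-empty
intersection of `P` with a hyperplane of its affine span which has `P` on one of its sides. -/

section Polytopes

variable {V : Type*} [AddCommGroup V] [Module ℝ V] [TopologicalSpace V]

/-- A polytope is the convex hull of a finite, possibly empty, set of points. -/
def IsPolytope (P : Set V) : Prop :=
  ∃ X : Set V, X.Finite ∧ P = convexHull ℝ X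

/-- A facet of `P` is a face such that `P` is the only face properly containing it. -/
def IsFacet (P F : Set V) : Prop :=
  IsExposed ℝ P F ∧ F ⊂ P ∧ ∀ G : Set V, IsExposed ℝ P G → F ⊂ G → G = P

/-- The relative interior of a polytope `P`: the points of `P` in no face other than `P`. -/
def relInterior (P : Set V) : Set V :=
  {x | x ∈ P ∧ ∀ F : Set V, IsExposed ℝ P F → x ∈ F → F = P}

/-- `C` is (the set of cells of) a split of the polytope `P`. The vertices of a polytope are its
extreme points. -/
structure IsSplit (P : Set V) (C : Set (Set V)) : Prop where
  isPolytope : ∀ Q ∈ C, IsPolytope Q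
  empty_mem : ∅ ∈ C
  vertices_subset : ∀ Q ∈ C, Q.extremePoints ℝ ⊆ P.extremePoints ℝ
  face_mem : ∀ Q ∈ C, ∀ F : Set V, IsExposed ℝ Q F → F ∈ C
  inter_isFace : ∀ Q₁ ∈ C, ∀ Q₂ ∈ C, Q₁ ≠ Q₂ →
    IsExposed ℝ Q₁ (Q₁ ∩ Q₂) ∧ IsExposed ℝ Q₂ (Q₁ ∩ Q₂)
  sUnion_eq : ⋃₀ C = P
  two_maximal : {Q | Maximal (· ∈ C) Q}.ncard = 2

/-- A split hyperplane of `P` is the affine span of the intersection of the two maximal cells of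
a split of `P`. -/
def IsSplitHyperplane (P : Set V) (H : AffineSubspace ℝ V) : Prop :=
  ∃ C : Set (Set V), IsSplit P C ∧ ∃ Q₁ Q₂ : Set V,
    Maximal (· ∈ C) Q₁ ∧ Maximal (· ∈ C) Q₂ ∧ Q₁ ≠ Q₂ ∧ H = affineSpan ℝ (Q₁ ∩ Q₂)

end Polytopes

/-! ### Split matroids

All polytopes of a matroid `M` on a type `α` live in `α → ℝ`; the coordinates outside the ground
set `M.E` vanish on all of them, so they are polytopes in `ℝ^E`. -/

section Split

variable {α : Type*}

/-- The matroid (base) polytope: the convex hull of the characteristic vectors of the bases. -/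
def basePolytope (M : Matroid α) : Set (α → ℝ) :=
  convexHull ℝ ((fun B : Set α ↦ B.indicator (1 : α → ℝ)) '' {B | M.IsBase B})

/-- The hypersimplex: the convex hull of the 0,1-vectors supported in `E` with exactly `r` ones. -/
def hypersimplex (E : Set α) (r : ℕ) : Set (α → ℝ) :=
  convexHull ℝ ((fun B : Set α ↦ B.indicator (1 : α → ℝ)) '' {B | B ⊆ E ∧ B.ncard = r})

/-- The hypersimplex `Δ(r(M), |E(M)|)` on the ground set of a matroid. -/
noncomputable def matroidHypersimplex (M : Matroid α) : Set (α → ℝ) :=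
  hypersimplex M.E M.eRank.toNat

/-- `H(F)`: the set of points whose coordinates in `F` add up to the rank of `F`. -/
noncomputable def rankHyperplane (M : Matroid α) (F : Set α) : Set (α → ℝ) :=
  {x | ∑ᶠ i ∈ F, x i = ((M.eRk F).toNat : ℝ)}

/-- A flacet is a flat `F` such that `H(F)` meets the base polytope in a facet, and such that `F` is
minimal among the flats that define this facet. -/
def IsFlacet (M : Matroid α) (F : Set α) : Prop :=
  M.IsFlat F ∧ IsFacet (basePolytope M) (rankHyperplane M F ∩ basePolytope M) ∧
    ∀ G : Set α, M.IsFlat G →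
      rankHyperplane M G ∩ basePolytope M = rankHyperplane M F ∩ basePolytope M → G ⊆ F → G = F

/-- A split flacet is a flacet `F` such that `H(F) ∩ Δ(r, n)` spans a split hyperplane of the
hypersimplex `Δ(r, n)`. -/
def IsSplitFlacet (M : Matroid α) (F : Set α) : Prop :=
  IsFlacet M F ∧ IsSplitHyperplane (matroidHypersimplex M)
    (affineSpan ℝ (rankHyperplane M F ∩ matroidHypersimplex M))

/-- A (finite) matroid is split if, for any two distinct split flacets, no common point of the
corresponding hyperplanes is in the relative interior of `A ∩ [0,1]^n`, where `A` is the affine span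
of the base polytope. -/
def IsSplitMatroid (M : Matroid α) : Prop :=
  ∀ F₁ F₂ : Set α, IsSplitFlacet M F₁ → IsSplitFlacet M F₂ → F₁ ≠ F₂ →
    ∀ x ∈ rankHyperplane M F₁ ∩ rankHyperplane M F₂,
      x ∉ relInterior ((affineSpan ℝ (basePolytope M) : Set (α → ℝ)) ∩ Icc 0 1)

/-- `M` is an excluded minor for a class of matroids if it is not in the class, but all its proper
minors are. -/
def IsExcludedMinor (𝓜 : Matroid α → Prop) (M : Matroid α) : Prop :=
  ¬ 𝓜 M ∧ ∀ N : Matroid α, N.IsStrictMinor M → 𝓜 N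

/-- Isomorphism of matroids: some bijection between the ground sets carries `M` to `N`. -/
def IsIsomorphic {β : Type*} (M : Matroid α) (N : Matroid β) : Prop :=
  ∃ e : M.E ≃ N.E, M.mapSetEquiv e = N

end Split

/-! ### The excluded minors -/

/-- The matroid with ground set `{0, …, n - 1}` and the given family of bases. -/
def ofBases {n : ℕ} (𝓑 : Finset (Finset (Fin n))) (hne : 𝓑.Nonempty)
    (hex : ∀ A ∈ 𝓑, ∀ B ∈ 𝓑, ∀ a ∈ A \ B, ∃ b ∈ B \ A, insert b (A.erase a) ∈ 𝓑) :
    Matroid (Fin n) :=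
  Matroid.ofIsBaseOfFinite (E := univ) finite_univ (fun B ↦ ∃ A ∈ 𝓑, (A : Set (Fin n)) = B)
    (by obtain ⟨A, hA⟩ := hne; exact ⟨A, A, hA, rfl⟩)
    (by
      rintro _ _ ⟨A, hA, rfl⟩ ⟨B, hB, rfl⟩ a ha
      obtain ⟨b, hb, h⟩ := hex A hA B hB a (by simpa using ha)
      exact ⟨b, by simpa using hb, _, h, by simp⟩)
    (fun _ _ ↦ subset_univ _)

/-- `M(W₂)`, the cycle matroid of a triangle with a parallel edge added: its bases are the pairs of
edges other than the parallel pair `{2, 3}`. -/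
def MW₂ : Matroid (Fin 4) :=
  ofBases ((Finset.powersetCard 2 Finset.univ).filter fun B ↦ ¬ {2, 3} ⊆ B)
    (by decide) (by decide)

/-- `S₀` is the direct sum of two copies of `M(W₂)`. -/
def S₀ : Matroid (Fin 4 ⊕ Fin 4) :=
  MW₂.sum MW₂

/-- `S₁`: rank 3, parallel pairs `{0, 1}` and `{4, 5}`, and otherwise generic (four points of the
plane in general position, two of which are doubled). -/
def S₁ : Matroid (Fin 6) :=
  ofBases ((Finset.powersetCard 3 Finset.univ).filter fun B ↦ ¬ {0, 1} ⊆ B ∧ ¬ {4, 5} ⊆ B)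
    (by decide) (by decide +kernel)

/-- `S₂`: rank 3, a parallel pair `{2, 3}` at the intersection of the two lines `{2, 3, 0, 1}` and
`{2, 3, 4, 5}`, and otherwise generic. -/
def S₂ : Matroid (Fin 6) :=
  ofBases ((Finset.powersetCard 3 Finset.univ).filter fun B ↦
    ¬ {2, 3} ⊆ B ∧ ¬ B ⊆ {2, 3, 0, 1} ∧ ¬ B ⊆ {2, 3, 4, 5})
    (by decide) (by decide +kernel)

/-- `S₃`: rank 3, a line `{0, 1, 4, 5}` containing a parallel pair `{4, 5}`, a line `{0, 2, 3}`
meeting it in a point outside that pair, and otherwise generic. -/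
def S₃ : Matroid (Fin 6) :=
  ofBases ((Finset.powersetCard 3 Finset.univ).filter fun B ↦
    ¬ {4, 5} ⊆ B ∧ ¬ B ⊆ {0, 1, 4, 5} ∧ ¬ B ⊆ {0, 2, 3})
    (by decide) (by decide +kernel)

/-- `S₄`: rank 3, a line `{0, 1, 4, 5}` containing a parallel pair `{4, 5}`, and otherwise
generic. -/
def S₄ : Matroid (Fin 6) :=
  ofBases ((Finset.powersetCard 3 Finset.univ).filter fun B ↦
    ¬ {4, 5} ⊆ B ∧ ¬ B ⊆ {0, 1, 4, 5})
    (by decide) (by decide +kernel)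

end SplitMatroids

/-!
# The excluded minors for split matroids

The proof translates the polyhedral definitions into statements about fundamental graphs: for a
base `B` this is the bipartite graph on `B` and its complement in which `x ∈ B` and `y ∉ B` are
adjacent if `B - x + y` is a base (`Exch`).

*Structure of flacets.* A flacet `F` is spanned by a set `G` inside one connected component `K` of
`M`, such that `M | G` and `(M | K) / G` are connected (`IsFlacet.exists_isConnectedFlat`): the
facet inequality for `F` is not a sum of other rank inequalities. A point `x` that witnesses that
`M` is not split has all its coordinates in `K` strictly between `0` and `1`, the coordinates in
`K` add up to `r(K)`, and those in `G` to `r(G)`.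

*A non-split matroid has one of the minors.* If the two flacets live in different components, then
neither component is uniform, so both have a fundamental graph with an induced path on four
vertices. Such a path is a minor `M(W₂)`, and both paths together are a minor `S₀`
(`exists_isMinor_of_two_components`). If they live in the same component, with sets `G₁ ≠ G₂`,
then a count with submodularity and the coordinate sums shows that `M | G₁`, `M | G₂` and `(M | K)
/ G₁` are not all uniform (`IsConnectedFlat.not_uniformOn`). Suppose that `(M | K) / G` is not
uniform. A base that contains bases of `G` and of `K` can be chosen such that the fundamental
graph outside `G` is connected but not complete bipartite, so that every element outside the base
lies on an induced path with four vertices. An edge `e - b` leaves `G`, and `e` has another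
neighbour `f` inside `G`, which has no neighbours outside `G`. The six elements `e`, `f` and an
induced path through `b` span a minor with a nearly prescribed fundamental graph, and base
exchange determines that minor to be `S₁`, `S₃` or `S₄` (`six_element_classification`). If `M | G`
is not uniform, the same argument in the dual matroid gives the dual of one of these, which is
`S₂`, `S₃` or `S₄`.

*The matroids are excluded minors.* Each `Sᵢ` is a disjoint union of two bases, so that the centre
of the cube is in the relative interior, and it has two flacets `F` with `|F| = 2 r(F)`, whose
hyperplanes pass through the centre. That they are flacets is a finite check
(`isFlacet_of_exchanges`); that they are split flacets follows because a slab `{x ∈ Δ(r, n) | a ≤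
x(F) ≤ b}` is an integral polytope (`isSplitHyperplane_slab`). Finally, no `Sᵢ` is a proper minor
of another `Sⱼ`: the sizes of the ground sets leave only six-element minors of `S₀`, and these are
disconnected.
-/

namespace SplitMatroids

/-! ### Faces of polytopes -/

section Faces

variable {V : Type*} [AddCommGroup V] [Module ℝ V]

/-- A linear functional bounded by `c` on `X` attains `c` on the convex hull of `X` exactly at the
convex combinations of the points of `X` at which it is `c`. -/
lemma convexHull_inter_level (X : Set V) (l : V →ₗ[ℝ] ℝ) (c : ℝ) (h : ∀ x ∈ X, l x ≤ c) :
    {y | y ∈ convexHull ℝ X ∧ l y = c} = convexHull ℝ {x | x ∈ X ∧ l x = c} := by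
  have hconv : Convex ℝ {y | l y < c ∨ (y ∈ convexHull ℝ {x | x ∈ X ∧ l x = c} ∧ l y = c)} := by
    rw [convex_iff_forall_pos]
    rintro x hx y hy a b ha hb hab
    simp only [mem_ofPred_eq, map_add, map_smul, smul_eq_mul]
    have hc : c = a * c + b * c := by rw [← add_mul, hab, one_mul]
    rcases hx with hx | ⟨hx, hx'⟩ <;> rcases hy with hy | ⟨hy, hy'⟩
    · left; nlinarith
    · left; nlinarith
    · left; nlinarith
    · right
      exact ⟨convex_convexHull ℝ _ hx hy ha.le hb.le hab, by rw [hx', hy', ← hc]⟩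
  have hsub : convexHull ℝ X ⊆
      {y | l y < c ∨ (y ∈ convexHull ℝ {x | x ∈ X ∧ l x = c} ∧ l y = c)} := by
    refine convexHull_min (fun x hx ↦ ?_) hconv
    rcases (h x hx).lt_or_eq with h' | h'
    · exact Or.inl h'
    · exact Or.inr ⟨subset_convexHull ℝ _ ⟨hx, h'⟩, h'⟩
  ext y
  constructor
  · rintro ⟨hy, hyc⟩
    rcases hsub hy with h' | h'
    · exact absurd hyc h'.ne
    · exact h'.1
  · intro hy
    refine ⟨convexHull_mono (fun x hx ↦ hx.1) hy, ?_⟩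
    have : convexHull ℝ {x | x ∈ X ∧ l x = c} ⊆ {y | l y = c} :=
      convexHull_min (fun x hx ↦ hx.2) (convex_hyperplane l.isLinear c)
    exact this hy

lemma le_of_mem_convexHull {X : Set V} (l : V →ₗ[ℝ] ℝ) {c : ℝ} (h : ∀ x ∈ X, l x ≤ c) {y : V}
    (hy : y ∈ convexHull ℝ X) : l y ≤ c :=
  convexHull_min h (convex_halfSpace_le l.isLinear c) hy

variable [TopologicalSpace V]

/-- The non-empty faces of the convex hull of `X` are the convex hulls of the points of `X` at which
a functional attains its maximum over `X`. -/
lemma isExposed_convexHull_iff (X F : Set V) :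
    IsExposed ℝ (convexHull ℝ X) F ↔ F = ∅ ∨ ∃ (l : V →L[ℝ] ℝ) (c : ℝ),
      (∀ x ∈ X, l x ≤ c) ∧ F = convexHull ℝ {x | x ∈ X ∧ l x = c} := by
  constructor
  · intro h
    rcases F.eq_empty_or_nonempty with rfl | hne
    · exact Or.inl rfl
    obtain ⟨l, rfl⟩ := h hne
    obtain ⟨z, hz, hz'⟩ := hne
    refine Or.inr ⟨l, l z, fun x hx ↦ hz' x (subset_convexHull ℝ _ hx), ?_⟩
    have e : {y | y ∈ convexHull ℝ X ∧ l y = l z} = convexHull ℝ {x | x ∈ X ∧ l x = l z} :=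
      convexHull_inter_level X l.toLinearMap (l z) (fun x hx ↦ hz' x (subset_convexHull ℝ _ hx))
    rw [← e]
    ext y
    constructor
    · rintro ⟨hy, hy'⟩
      exact ⟨hy, le_antisymm (hz' y hy) (hy' z hz)⟩
    · rintro ⟨hy, hy'⟩
      refine ⟨hy, fun w hw ↦ ?_⟩
      rw [hy']
      exact hz' w hw
  · rintro (rfl | ⟨l, c, hl, rfl⟩)
    · exact isExposed_empty
    rintro ⟨z, hz⟩
    refine ⟨l, ?_⟩
    have e : {y | y ∈ convexHull ℝ X ∧ l y = c} = convexHull ℝ {x | x ∈ X ∧ l x = c} :=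
      convexHull_inter_level X l.toLinearMap c hl
    rw [← e] at hz ⊢
    ext y
    constructor
    · rintro ⟨hy, hy'⟩
      refine ⟨hy, fun w hw ↦ ?_⟩
      rw [hy']
      exact le_of_mem_convexHull l.toLinearMap hl hw
    · rintro ⟨hy, hy'⟩
      refine ⟨hy, le_antisymm (le_of_mem_convexHull l.toLinearMap hl hy) ?_⟩
      have := hy' z hz.1
      rwa [show l z = c from hz.2] at this

lemma IsPolytope.of_isExposed {P F : Set V} (hP : IsPolytope P) (hF : IsExposed ℝ P F) :
    IsPolytope F := by
  obtain ⟨X, hX, rfl⟩ := hP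
  rcases (isExposed_convexHull_iff X F).1 hF with rfl | ⟨l, c, -, rfl⟩
  · exact ⟨∅, finite_empty, by simp⟩
  · exact ⟨_, hX.subset fun x hx ↦ hx.1, rfl⟩

/-- A face of a face of a polytope is a face: perturb a functional that defines the larger face by a
small multiple of one that defines the smaller. -/
lemma IsPolytope.isExposed_trans {P F G : Set V} (hP : IsPolytope P) (hF : IsExposed ℝ P F)
    (hG : IsExposed ℝ F G) : IsExposed ℝ P G := by
  obtain ⟨X, hX, rfl⟩ := hP
  rcases (isExposed_convexHull_iff X F).1 hF with rfl | ⟨l, L, hl, rfl⟩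
  · rw [subset_empty_iff.1 hG.subset]; exact isExposed_empty
  rcases (isExposed_convexHull_iff _ G).1 hG with rfl | ⟨m, μ, hm, rfl⟩
  · exact isExposed_empty
  have hN : ∀ᶠ N : ℝ in Filter.atTop, ∀ x ∈ X, l x < L → m x - μ < N * (L - l x) := by
    rw [hX.eventually_all]
    intro x _
    by_cases hx : l x < L
    · filter_upwards [Filter.eventually_gt_atTop ((m x - μ) / (L - l x))] with N hN _
      rwa [div_lt_iff₀ (by linarith)] at hN
    · simp [hx]
  obtain ⟨N, hN⟩ := hN.exists
  refine (isExposed_convexHull_iff X _).2 (Or.inr ⟨N • l + m, N * L + μ, ?_, ?_⟩)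
  · intro x hx
    simp only [add_apply, smul_apply, smul_eq_mul]
    rcases (hl x hx).lt_or_eq with h | h
    · linarith [hN x hx h]
    · rw [h]; linarith [hm x ⟨hx, h⟩]
  · congr 1
    ext x
    simp only [mem_ofPred_eq, add_apply, smul_apply,
      smul_eq_mul]
    constructor
    · rintro ⟨⟨hx, h⟩, h'⟩
      exact ⟨hx, by rw [h, h']⟩
    · rintro ⟨hx, h⟩
      have hlx : l x = L := by
        by_contra hne
        linarith [hN x hx (lt_of_le_of_ne (hl x hx) hne)]
      refine ⟨⟨hx, hlx⟩, ?_⟩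
      rw [hlx] at h; linarith

end Faces

/-! ### Splits of the hypersimplex -/

section Hypersimplex

variable {α : Type*}

/-- The part of the hypersimplex `Δ(r, E)` in which the coordinates in `F` add up to a number
between `a` and `b`, described by inequalities. -/
def slab (E F : Finset α) (r a b : ℕ) : Set (α → ℝ) :=
  {x | (∀ i, 0 ≤ x i ∧ x i ≤ 1) ∧ (∀ i ∉ E, x i = 0) ∧ ∑ i ∈ E, x i = r ∧
    (a : ℝ) ≤ ∑ i ∈ F, x i ∧ ∑ i ∈ F, x i ≤ b}

/-- The 0,1-points of a slab. -/
def slabVertices (E F : Finset α) (r a b : ℕ) : Set (α → ℝ) :=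
  (fun B : Set α ↦ B.indicator (1 : α → ℝ)) ''
    {B | B ⊆ E ∧ B.ncard = r ∧ a ≤ (B ∩ F).ncard ∧ (B ∩ F).ncard ≤ b}

/-- The linear functional that adds up the coordinates in `F`. -/
noncomputable def coordSum (F : Finset α) : (α → ℝ) →L[ℝ] ℝ :=
  ∑ i ∈ F, ContinuousLinearMap.proj i

@[simp] lemma coordSum_apply (F : Finset α) (x : α → ℝ) : coordSum F x = ∑ i ∈ F, x i := by
  simp [coordSum]

lemma sum_indicator_one (F : Finset α) (B : Set α) :
    ∑ i ∈ F, B.indicator (1 : α → ℝ) i = ((B ∩ F).ncard : ℝ) := by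
  classical
  have : B ∩ F = ((F.filter (· ∈ B) : Finset α) : Set α) := by
    ext; simp [and_comm]
  rw [this, ncard_coe_finset, Finset.card_filter]
  push_cast
  refine Finset.sum_congr rfl fun i _ ↦ ?_
  by_cases h : i ∈ B <;> simp [h]

lemma slabVertices_finite (E F : Finset α) (r a b : ℕ) : (slabVertices E F r a b).Finite :=
  (E.finite_toSet.finite_subsets.subset fun _ h ↦ h.1).image _

lemma slabVertices_subset_slab (E F : Finset α) (r a b : ℕ) :
    slabVertices E F r a b ⊆ slab E F r a b := by
  rintro _ ⟨B, ⟨hBE, hr, ha, hb⟩, rfl⟩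
  refine ⟨fun i ↦ ?_, fun i hi ↦ ?_, ?_, ?_, ?_⟩
  · by_cases h : i ∈ B <;> simp [h]
  · exact indicator_of_notMem (fun h ↦ hi (hBE h)) _
  · rw [sum_indicator_one, inter_eq_left.2 hBE, hr]
  · rw [sum_indicator_one]; exact_mod_cast ha
  · rw [sum_indicator_one]; exact_mod_cast hb

lemma convex_slab (E F : Finset α) (r a b : ℕ) : Convex ℝ (slab E F r a b) := by
  rintro x ⟨h1, h2, h3, h4, h5⟩ y ⟨g1, g2, g3, g4, g5⟩ s t hs ht hst
  have key : ∀ c : ℝ, c = s * c + t * c := fun c ↦ by rw [← add_mul, hst, one_mul]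
  refine ⟨fun i ↦ ⟨?_, ?_⟩, fun i hi ↦ ?_, ?_, ?_, ?_⟩ <;>
    simp only [Pi.add_apply, Pi.smul_apply, smul_eq_mul, Finset.sum_add_distrib, ← Finset.mul_sum]
  · have := (h1 i).1; have := (g1 i).1; positivity
  · rw [key 1]; gcongr; exacts [(h1 i).2, (g1 i).2]
  · rw [h2 i hi, g2 i hi]; simp
  · rw [h3, g3, ← key]
  · rw [key a]; gcongr
  · rw [key b]; gcongr

lemma isCompact_slab (E F : Finset α) (r a b : ℕ) : IsCompact (slab E F r a b) := by
  have hc : ∀ s : Finset α, Continuous fun x : α → ℝ ↦ ∑ i ∈ s, x i := fun s ↦ by fun_prop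
  refine (isCompact_univ_pi (X := fun _ : α ↦ ℝ) (s := fun _ ↦ Icc (0 : ℝ) 1)
    fun _ ↦ isCompact_Icc).of_isClosed_subset ?_ ?_
  · have : slab E F r a b = (⋂ i, ({x : α → ℝ | 0 ≤ x i} ∩ {x | x i ≤ 1})) ∩
        ((⋂ i ∈ {i | i ∉ E}, {x | x i = 0}) ∩
        ({x | ∑ i ∈ E, x i = (r : ℝ)} ∩
          ({x | (a : ℝ) ≤ ∑ i ∈ F, x i} ∩ {x | ∑ i ∈ F, x i ≤ (b : ℝ)}))) := by
      ext x
      simp [slab]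
    rw [this]
    refine IsClosed.inter (isClosed_iInter fun i ↦ ?_)
      (IsClosed.inter (isClosed_biInter fun i _ ↦ ?_) (IsClosed.inter ?_ (IsClosed.inter ?_ ?_)))
    · exact (isClosed_le continuous_const (continuous_apply i)).inter
        (isClosed_le (continuous_apply i) continuous_const)
    · exact isClosed_eq (continuous_apply i) continuous_const
    · exact isClosed_eq (hc E) continuous_const
    · exact isClosed_le continuous_const (hc F)
    · exact isClosed_le (hc F) continuous_const
  · intro x hx i _
    exact hx.1 i

/-- If the coordinates of `x` in `s` add up to an integer, then a fractional one is not alone. -/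
lemma exists_ne_fractional {s : Finset α} {x : α → ℝ} {k : ℕ} (hs : ∑ i ∈ s, x i = k) {i : α}
    (hi : i ∈ s) (h0 : 0 < x i) (h1 : x i < 1) : ∃ j ∈ s, j ≠ i ∧ x j ≠ 0 ∧ x j ≠ 1 := by
  classical
  by_contra! hcon
  have h : ∀ j ∈ s.erase i, x j = ((if x j = 0 then 0 else 1 : ℤ) : ℝ) := by
    intro j hj
    have := hcon j (Finset.mem_of_mem_erase hj) (Finset.ne_of_mem_erase hj)
    by_cases hx : x j = 0
    · simp [hx]
    · simp [this hx]
  rw [← Finset.add_sum_erase s x hi, Finset.sum_congr rfl h, ← Int.cast_sum] at hs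
  set n := ∑ j ∈ s.erase i, (if x j = 0 then 0 else 1 : ℤ)
  have hxi : x i = ((k - n : ℤ) : ℝ) := by push_cast; linarith
  rw [hxi] at h0 h1
  have h0' : (0 : ℤ) < k - n := by exact_mod_cast h0
  have h1' : (k - n : ℤ) < 1 := by exact_mod_cast h1
  omega

/-- A slab is an integral polytope: at a point with fractional coordinates there are two coordinates
that can be moved by opposite amounts in both directions. -/
lemma extremePoints_slab_subset {E F : Finset α} (hFE : F ⊆ E) (r a b : ℕ) :
    (slab E F r a b).extremePoints ℝ ⊆ slabVertices E F r a b := by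
  classical
  intro x hx
  obtain ⟨⟨h1, h2, h3, h4, h5⟩, hext⟩ := hx
  -- two fractional coordinates whose opposite perturbation stays in the slab
  have move : ∀ i ∈ E, ∀ j ∈ E, i ≠ j → x i ≠ 0 → x i ≠ 1 → x j ≠ 0 → x j ≠ 1 →
      ((i ∈ F ↔ j ∈ F) ∨ ((a : ℝ) < ∑ i ∈ F, x i ∧ ∑ i ∈ F, x i < b)) → False := by
    intro i hi j hj hij hi0 hi1 hj0 hj1 hF
    have hi0 := lt_of_le_of_ne (h1 i).1 hi0.symm
    have hi1 := lt_of_le_of_ne (h1 i).2 hi1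
    have hj0 := lt_of_le_of_ne (h1 j).1 hj0.symm
    have hj1 := lt_of_le_of_ne (h1 j).2 hj1
    have hε : ∃ ε > 0, ε ≤ x i ∧ ε ≤ 1 - x i ∧ ε ≤ x j ∧ ε ≤ 1 - x j ∧
        ((i ∈ F ↔ j ∈ F) ∨ ((a : ℝ) + ε ≤ ∑ i ∈ F, x i ∧ ∑ i ∈ F, x i + ε ≤ b)) := by
      rcases hF with hF | ⟨hFa, hFb⟩
      · have h : 0 < min (min (x i) (1 - x i)) (min (x j) (1 - x j)) := by simp [*]
        refine ⟨_, h, ?_⟩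
        simp [hF]
      · have h : 0 < min (min (min (x i) (1 - x i)) (min (x j) (1 - x j)))
          (min (∑ i ∈ F, x i - a) (b - ∑ i ∈ F, x i)) := by simp [*]
        refine ⟨_, h, by simp, by simp, by simp, by simp, Or.inr ⟨?_, ?_⟩⟩
        · rw [← le_sub_iff_add_le']; simp
        · rw [← le_sub_iff_add_le']; simp
    obtain ⟨ε, hε, e1, e2, e3, e4, e5⟩ := hε
    let d : α → ℝ := Pi.single i 1 - Pi.single j 1
    have hdsum : ∀ s : Finset α,
        ∑ k ∈ s, d k = (if i ∈ s then 1 else 0) - (if j ∈ s then 1 else 0) := by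
      intro s
      simp [d, Finset.sum_sub_distrib]
    have hmem : ∀ t : ℝ, |t| ≤ ε → x + t • d ∈ slab E F r a b := by
      intro t ht
      rw [abs_le] at ht
      refine ⟨fun k ↦ ?_, fun k hk ↦ ?_, ?_, ?_⟩
      · simp only [d, Pi.add_apply, Pi.smul_apply, Pi.sub_apply, smul_eq_mul]
        by_cases hki : k = i
        · subst hki; simp [hij]; constructor <;> linarith
        · by_cases hkj : k = j
          · subst hkj; simp [hki]; constructor <;> linarith
          · simp [hki, hkj]; exact h1 k
      · have hki : k ≠ i := fun h ↦ hk (h ▸ hi)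
        have hkj : k ≠ j := fun h ↦ hk (h ▸ hj)
        simp [d, hki, hkj, h2 k hk]
      · simp only [Pi.add_apply, Pi.smul_apply, smul_eq_mul, Finset.sum_add_distrib,
          ← Finset.mul_sum, hdsum, hi, hj, h3]
        simp
      · simp only [Pi.add_apply, Pi.smul_apply, smul_eq_mul, Finset.sum_add_distrib,
          ← Finset.mul_sum, hdsum]
        rcases e5 with e5 | ⟨e5, e6⟩
        · by_cases hiF : i ∈ F
          · simp [hiF, e5.1 hiF, h4, h5]
          · have hjF : j ∉ F := fun h ↦ hiF (e5.2 h)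
            simp [hiF, hjF, h4, h5]
        · split_ifs <;> constructor <;> linarith
    have hseg : x ∈ openSegment ℝ (x + ε • d) (x + (-ε) • d) := by
      refine ⟨1 / 2, 1 / 2, by norm_num, by norm_num, by norm_num, ?_⟩
      ext k; simp; ring
    have := hext (hmem ε (abs_of_pos hε).le) (hmem (-ε) (by rw [abs_neg]; exact (abs_of_pos hε).le))
      hseg
    have h := congrFun this i
    simp [d, hij] at h
    exact hε.ne' h
  have h01 : ∀ i, x i = 0 ∨ x i = 1 := by
    by_contra! hcon
    obtain ⟨i, hi0, hi1⟩ := hcon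
    have hiE : i ∈ E := by_contra fun h ↦ hi0 (h2 i h)
    have h0 := lt_of_le_of_ne (h1 i).1 hi0.symm
    have h1' := lt_of_le_of_ne (h1 i).2 hi1
    obtain ⟨j, hjE, hji, hj0, hj1⟩ := exists_ne_fractional h3 hiE h0 h1'
    refine move i hiE j hjE hji.symm hi0 hi1 hj0 hj1 ?_
    by_contra! hF
    obtain ⟨hF, hF'⟩ := hF
    -- the sum over `F` has one fractional term, so it is not one of the bounds
    have hint : ∃ k : ℕ, ∑ i ∈ F, x i = k := by
      rcases h4.lt_or_eq with h | h
      · exact ⟨b, le_antisymm h5 (hF' h)⟩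
      · exact ⟨a, h.symm⟩
    obtain ⟨k, hk⟩ := hint
    have : ∃ m ∈ F, ∃ m' ∈ F, m' ≠ m ∧ x m ≠ 0 ∧ x m ≠ 1 ∧ x m' ≠ 0 ∧ x m' ≠ 1 := by
      rcases hF with ⟨hiF, -⟩ | ⟨-, hjF⟩
      · obtain ⟨m, hm, hmi, hm0, hm1⟩ := exists_ne_fractional hk hiF h0 h1'
        exact ⟨i, hiF, m, hm, hmi, hi0, hi1, hm0, hm1⟩
      · obtain ⟨m, hm, hmi, hm0, hm1⟩ := exists_ne_fractional hk hjF
          (lt_of_le_of_ne (h1 j).1 hj0.symm) (lt_of_le_of_ne (h1 j).2 hj1)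
        exact ⟨j, hjF, m, hm, hmi, hj0, hj1, hm0, hm1⟩
    obtain ⟨m, hm, m', hm', hne, p, q, p', q'⟩ := this
    exact move m (hFE hm) m' (hFE hm') hne.symm p q p' q' (Or.inl (by simp [hm, hm']))
  refine ⟨{i | x i = 1}, ?_, ?_⟩
  · have hind : ({i | x i = 1} : Set α).indicator (1 : α → ℝ) = x := by
      ext i
      rcases h01 i with h | h <;> simp [h]
    have hsub : {i | x i = 1} ⊆ (E : Set α) := fun i hi ↦ by
      by_contra h
      simp [h2 i h] at hi
    refine ⟨hsub, ?_, ?_, ?_⟩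
    · have := sum_indicator_one E {i | x i = 1}
      rw [hind, h3, inter_eq_left.2 hsub] at this
      exact_mod_cast this.symm
    · have := sum_indicator_one F {i | x i = 1}
      rw [hind] at this
      rw [this] at h4; exact_mod_cast h4
    · have := sum_indicator_one F {i | x i = 1}
      rw [hind] at this
      rw [this] at h5; exact_mod_cast h5
  · ext i
    rcases h01 i with h | h <;> simp [h]

lemma slab_eq_convexHull {E F : Finset α} (hFE : F ⊆ E) (r a b : ℕ) :
    slab E F r a b = convexHull ℝ (slabVertices E F r a b) := by
  refine Subset.antisymm ?_ (convexHull_min (slabVertices_subset_slab ..) (convex_slab ..))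
  rw [← closure_convexHull_extremePoints (isCompact_slab E F r a b) (convex_slab E F r a b)]
  have hcl : IsClosed (convexHull ℝ (slabVertices E F r a b)) :=
    (slabVertices_finite E F r a b).isClosed_convexHull ℝ
  exact closure_minimal (convexHull_mono (extremePoints_slab_subset hFE r a b)) hcl

lemma hypersimplex_eq_slab {E F : Finset α} (hFE : F ⊆ E) (r : ℕ) :
    hypersimplex (E : Set α) r = slab E F r 0 r := by
  rw [slab_eq_convexHull hFE, hypersimplex, slabVertices]
  congr 2
  ext B
  simp only [mem_ofPred_eq, zero_le, true_and]
  refine ⟨fun h ↦ ⟨h.1, h.2, ?_⟩, fun h ↦ ⟨h.1, h.2.1⟩⟩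
  rw [← h.2]
  exact ncard_le_ncard inter_subset_left (E.finite_toSet.subset h.1)

lemma slab_nonempty {E F : Finset α} (hFE : F ⊆ E) {r a : ℕ} (har : a ≤ r) (haF : a ≤ F.card)
    (hr : r + F.card ≤ a + E.card) : (slab E F r a a).Nonempty := by
  classical
  obtain ⟨A, hA, hAc⟩ := Finset.exists_subset_card_eq haF
  have hc := Finset.card_sdiff_of_subset hFE
  obtain ⟨A', hA', hAc'⟩ := Finset.exists_subset_card_eq (s := E \ F) (n := r - a) (by omega)
  have hdisj : Disjoint A A' := Finset.disjoint_left.2 fun i hi hi' ↦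
    (Finset.mem_sdiff.1 (hA' hi')).2 (hA hi)
  refine ⟨_, slabVertices_subset_slab E F r a a ⟨((A ∪ A' : Finset α) : Set α), ⟨?_, ?_, ?_⟩, rfl⟩⟩
  · rw [Finset.coe_subset]
    exact Finset.union_subset (hA.trans hFE) (hA'.trans Finset.sdiff_subset)
  · rw [ncard_coe_finset, Finset.card_union_of_disjoint hdisj]; omega
  · have : ((A ∪ A' : Finset α) : Set α) ∩ F = (A : Set α) := by
      rw [← Finset.coe_inter]
      congr 1
      ext i
      simp only [Finset.mem_inter, Finset.mem_union]
      constructor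
      · rintro ⟨h | h, h'⟩
        · exact h
        · exact absurd h' (Finset.mem_sdiff.1 (hA' h)).2
      · exact fun h ↦ ⟨Or.inl h, hA h⟩
    rw [this, ncard_coe_finset, hAc]
    exact ⟨le_rfl, le_rfl⟩

/-- The 0,1-points of the hypersimplex are its extreme points: they are extreme in the cube. -/
lemma slabVertices_subset_extremePoints (E F : Finset α) (r a b : ℕ) :
    slabVertices E F r a b ⊆ (slab E F r a b).extremePoints ℝ := by
  intro x hx
  refine ⟨slabVertices_subset_slab _ _ _ _ _ hx, fun y hy z hz hseg ↦ ?_⟩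
  obtain ⟨B, -, rfl⟩ := hx
  obtain ⟨s, t, hs, ht, hst, h⟩ := hseg
  ext i
  have hi := congrFun h i
  simp only [Pi.add_apply, Pi.smul_apply, smul_eq_mul] at hi
  have := hy.1 i
  have := hz.1 i
  by_cases hB : i ∈ B
  · simp only [hB, indicator_of_mem, Pi.one_apply] at hi ⊢
    nlinarith
  · simp only [hB, not_false_eq_true, indicator_of_notMem] at hi ⊢
    nlinarith

/-- A hyperplane on which the coordinates in `F` add up to `k` is a split hyperplane of the
hypersimplex as soon as there are vertices strictly on either side of it. The two slabs into which
it cuts the hypersimplex, together with all their faces, are the cells of the split. -/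
lemma isSplitHyperplane_slab {E F : Finset α} (hFE : F ⊆ E) {r k : ℕ} (hk : 0 < k)
    (hkF : k < F.card) (hkr : k < r) (hr : r + F.card < k + E.card) :
    IsSplitHyperplane (hypersimplex (E : Set α) r) (affineSpan ℝ (slab E F r k k)) := by
  rw [hypersimplex_eq_slab hFE]
  set Q₁ := slab E F r 0 k with hQ₁
  set Q₂ := slab E F r k r with hQ₂
  set D := slab E F r k k with hD
  have hpoly : ∀ a b, IsPolytope (slab E F r a b) := fun a b ↦
    ⟨_, slabVertices_finite E F r a b, slab_eq_convexHull hFE r a b⟩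
  have hinter : Q₁ ∩ Q₂ = D := by
    ext x
    constructor
    · rintro ⟨h, h'⟩
      exact ⟨h.1, h.2.1, h.2.2.1, h'.2.2.2.1, h.2.2.2.2⟩
    · rintro ⟨h1, h2, h3, h4, h5⟩
      refine ⟨⟨h1, h2, h3, ?_, h5⟩, ⟨h1, h2, h3, h4, h5.trans (by exact_mod_cast hkr.le)⟩⟩
      exact le_trans (by simp) h4
  have hunion : Q₁ ∪ Q₂ = slab E F r 0 r := by
    ext x
    constructor
    · rintro (⟨h1, h2, h3, h4, h5⟩ | ⟨h1, h2, h3, h4, h5⟩)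
      · exact ⟨h1, h2, h3, h4, h5.trans (by exact_mod_cast hkr.le)⟩
      · exact ⟨h1, h2, h3, le_trans (by simp) h4, h5⟩
    · rintro ⟨h1, h2, h3, h4, h5⟩
      rcases le_total (∑ i ∈ F, x i) k with h | h
      · exact Or.inl ⟨h1, h2, h3, h4, h⟩
      · exact Or.inr ⟨h1, h2, h3, h, h5⟩
  have hD₁ : IsExposed ℝ Q₁ D := by
    rintro ⟨z, hz⟩
    refine ⟨coordSum F, ?_⟩
    ext x
    simp only [coordSum_apply, mem_ofPred_eq]
    constructor
    · intro hx
      refine ⟨(hinter.symm.subset hx).1, fun y hy ↦ hy.2.2.2.2.trans hx.2.2.2.1⟩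
    · rintro ⟨⟨h1, h2, h3, -, h5⟩, h⟩
      exact ⟨h1, h2, h3, hz.2.2.2.1.trans (h z (hinter.symm.subset hz).1), h5⟩
  have hD₂ : IsExposed ℝ Q₂ D := by
    rintro ⟨z, hz⟩
    refine ⟨-coordSum F, ?_⟩
    ext x
    simp only [neg_apply, coordSum_apply, mem_ofPred_eq, neg_le_neg_iff]
    constructor
    · intro hx
      refine ⟨(hinter.symm.subset hx).2, fun y hy ↦ hx.2.2.2.2.trans hy.2.2.2.1⟩
    · rintro ⟨⟨h1, h2, h3, h4, -⟩, h⟩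
      exact ⟨h1, h2, h3, h4, (h z (hinter.symm.subset hz).2).trans hz.2.2.2.2⟩
  have hQ₁₂ : ¬ Q₁ ⊆ Q₂ := by
    obtain ⟨x, h1, h2, h3, h4, h5⟩ := slab_nonempty hFE (r := r) (a := k - 1) (by omega) (by omega)
      (by omega)
    intro h
    have hcast : ((k - 1 : ℕ) : ℝ) < k := by exact_mod_cast (by omega : k - 1 < k)
    have := (h (a := x) ⟨h1, h2, h3, le_trans (by simp) h4, by linarith⟩).2.2.2.1
    linarith
  have hQ₂₁ : ¬ Q₂ ⊆ Q₁ := by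
    obtain ⟨x, h1, h2, h3, h4, h5⟩ := slab_nonempty hFE (r := r) (a := k + 1) (by omega) (by omega)
      (by omega)
    intro h
    have hcast : ((k + 1 : ℕ) : ℝ) ≤ r := by exact_mod_cast hkr
    have hcast' : ((k + 1 : ℕ) : ℝ) = k + 1 := by push_cast; ring
    have := (h (a := x) ⟨h1, h2, h3, by linarith, by linarith⟩).2.2.2.2
    linarith
  let C : Set (Set (α → ℝ)) := {Q | IsExposed ℝ Q₁ Q ∨ IsExposed ℝ Q₂ Q}
  have hmax : {Q | Maximal (· ∈ C) Q} = {Q₁, Q₂} := by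
    have h₁ : Maximal (· ∈ C) Q₁ := by
      refine ⟨Or.inl (IsExposed.refl _), ?_⟩
      rintro Q (hQ | hQ) h
      · exact hQ.subset
      · exact absurd (h.trans hQ.subset) hQ₁₂
    have h₂ : Maximal (· ∈ C) Q₂ := by
      refine ⟨Or.inr (IsExposed.refl _), ?_⟩
      rintro Q (hQ | hQ) h
      · exact absurd (h.trans hQ.subset) hQ₂₁
      · exact hQ.subset
    ext Q
    simp only [mem_ofPred_eq, mem_insert_iff, mem_singleton_iff]
    constructor
    · rintro ⟨hQ | hQ, h⟩
      · exact Or.inl (hQ.subset.antisymm (h h₁.prop hQ.subset))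
      · exact Or.inr (hQ.subset.antisymm (h h₂.prop hQ.subset))
    · rintro (rfl | rfl)
      exacts [h₁, h₂]
  have hne : Q₁ ≠ Q₂ := fun h ↦ hQ₁₂ h.subset
  -- faces of different slabs meet in a face of the common facet `D`
  have hmix : ∀ {A B : Set (α → ℝ)}, IsExposed ℝ Q₁ A → IsExposed ℝ Q₂ B →
      IsExposed ℝ Q₁ (A ∩ B) ∧ IsExposed ℝ Q₂ (A ∩ B) := by
    intro A B hA hB
    have e : A ∩ B = (A ∩ D) ∩ (B ∩ D) := by
      ext x
      constructor
      · rintro ⟨ha, hb⟩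
        have : x ∈ D := hinter.subset ⟨hA.subset ha, hB.subset hb⟩
        exact ⟨⟨ha, this⟩, ⟨hb, this⟩⟩
      · rintro ⟨⟨ha, -⟩, ⟨hb, -⟩⟩
        exact ⟨ha, hb⟩
    have hA' : IsExposed ℝ D (A ∩ D) := (hA.inter hD₁).mono hD₁.subset inter_subset_right
    have hB' : IsExposed ℝ D (B ∩ D) := (hB.inter hD₂).mono hD₂.subset inter_subset_right
    rw [e]
    exact ⟨(hpoly _ _).isExposed_trans hD₁ (hA'.inter hB'),
      (hpoly _ _).isExposed_trans hD₂ (hA'.inter hB')⟩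
  have hinterC : ∀ A ∈ C, ∀ B ∈ C, IsExposed ℝ A (A ∩ B) := by
    rintro A (hA | hA) B (hB | hB)
    · exact (hA.inter hB).mono hA.subset inter_subset_left
    · exact (hmix hA hB).1.mono hA.subset inter_subset_left
    · rw [inter_comm]
      exact (hmix hB hA).2.mono hA.subset inter_subset_right
    · exact (hA.inter hB).mono hA.subset inter_subset_left
  have hsplit : IsSplit (slab E F r 0 r) C := by
    refine ⟨?_, Or.inl isExposed_empty, ?_, ?_, ?_, ?_, ?_⟩
    · rintro Q (hQ | hQ)
      · exact (hpoly _ _).of_isExposed hQ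
      · exact (hpoly _ _).of_isExposed hQ
    · have hv : ∀ a b, b ≤ r →
          (slab E F r a b).extremePoints ℝ ⊆ (slab E F r 0 r).extremePoints ℝ := by
        intro a b hb x hx
        obtain ⟨B, ⟨h1, h2, h3, h4⟩, rfl⟩ := extremePoints_slab_subset hFE _ _ _ hx
        exact slabVertices_subset_extremePoints _ _ _ _ _
          ⟨B, ⟨h1, h2, Nat.zero_le _, h4.trans hb⟩, rfl⟩
      rintro Q (hQ | hQ)
      · exact hQ.isExtreme.extremePoints_subset_extremePoints.trans (hv _ _ hkr.le)
      · exact hQ.isExtreme.extremePoints_subset_extremePoints.trans (hv _ _ le_rfl)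
    · rintro Q (hQ | hQ) F hF
      · exact Or.inl ((hpoly _ _).isExposed_trans hQ hF)
      · exact Or.inr ((hpoly _ _).isExposed_trans hQ hF)
    · intro A hA B hB _
      exact ⟨hinterC A hA B hB, by rw [inter_comm]; exact hinterC B hB A hA⟩
    · rw [← hunion]
      refine Subset.antisymm (sUnion_subset ?_) (union_subset ?_ ?_)
      · rintro Q (hQ | hQ)
        exacts [hQ.subset.trans subset_union_left, hQ.subset.trans subset_union_right]
      · exact subset_sUnion_of_mem (Or.inl (IsExposed.refl _))
      · exact subset_sUnion_of_mem (Or.inr (IsExposed.refl _))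
    · rw [hmax, ncard_pair hne]
  have hmem : ∀ Q, Q = Q₁ ∨ Q = Q₂ → Maximal (· ∈ C) Q := fun Q hQ ↦ by
    have : Q ∈ {Q | Maximal (· ∈ C) Q} := by rw [hmax]; exact hQ
    exact this
  exact ⟨C, hsplit, Q₁, Q₂, hmem _ (Or.inl rfl), hmem _ (Or.inr rfl), hne, by rw [hinter]⟩

end Hypersimplex

/-! ### Rank, exchanges and connectivity in finite matroids -/

section Rank

variable {α : Type*} {M : Matroid α} {A B X Y Z S : Set α} {x y : α}

/-- The rank of a set, as a natural number. -/
noncomputable def rk (M : Matroid α) (A : Set α) : ℕ := (M.eRk A).toNat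

variable [M.Finite]

lemma cast_rk (A : Set α) : (rk M A : ℕ∞) = M.eRk A :=
  ENat.natCast_toNat (M.isRkFinite_set A).eRk_lt_top.ne

lemma rk_mono (h : A ⊆ B) : rk M A ≤ rk M B := by
  have := M.eRk_mono h
  rw [← cast_rk, ← cast_rk] at this
  exact_mod_cast this

lemma rk_submod (A B : Set α) : rk M (A ∩ B) + rk M (A ∪ B) ≤ rk M A + rk M B := by
  have := M.eRk_inter_add_eRk_union_le A B
  simp only [← cast_rk] at this
  exact_mod_cast this

lemma rk_union_le (A B : Set α) : rk M (A ∪ B) ≤ rk M A + rk M B :=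
  (Nat.le_add_left _ _).trans (rk_submod A B)

omit [M.Finite] in
@[simp] lemma rk_empty : rk M ∅ = 0 := by simp [rk]

omit [M.Finite] in
lemma rk_closure (A : Set α) : rk M (M.closure A) = rk M A := by simp [rk]

lemma rk_le_ncard (hA : A.Finite) : rk M A ≤ A.ncard := by
  have := M.eRk_le_encard A
  rw [← cast_rk, ← hA.cast_ncard_eq] at this
  exact_mod_cast this

lemma indep_ncard_le_rk {I : Set α} (hI : M.Indep I) (h : I ⊆ A) : I.ncard ≤ rk M A := by
  have := hI.encard_le_eRk_of_subset h
  rw [← cast_rk, ← hI.finite.cast_ncard_eq] at this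
  exact_mod_cast this

lemma base_inter_ncard_le (hB : M.IsBase B) (A : Set α) : (B ∩ A).ncard ≤ rk M A :=
  indep_ncard_le_rk (hB.indep.subset inter_subset_left) inter_subset_right

omit [M.Finite] in
lemma base_ncard (hB : M.IsBase B) : B.ncard = rk M M.E := by
  rw [rk, M.eRk_ground, ← hB.encard_eq_eRank]
  rfl

omit [M.Finite] in
lemma base_inter_ncard_ground (hB : M.IsBase B) : (B ∩ M.E).ncard = rk M M.E := by
  rw [inter_eq_left.2 hB.subset_ground, base_ncard hB]

/-- For a chain of sets there is a base that contains bases of all of them. -/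
lemma exists_base_rk_rk_rk (hXY : X ⊆ Y) (hYZ : Y ⊆ Z) :
    ∃ B, M.IsBase B ∧ (B ∩ X).ncard = rk M X ∧ (B ∩ Y).ncard = rk M Y ∧
      (B ∩ Z).ncard = rk M Z := by
  obtain ⟨I, hI⟩ := M.exists_isBasis' X
  obtain ⟨J, hJ, hIJ⟩ := hI.indep.subset_isBasis'_of_subset (hI.subset.trans hXY)
  obtain ⟨L, hL, hJL⟩ := hJ.indep.subset_isBasis'_of_subset (hJ.subset.trans hYZ)
  obtain ⟨B, hB, hLB⟩ := hL.indep.exists_isBase_superset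
  have key : ∀ {I A : Set α}, M.IsBasis' I A → I ⊆ B → (B ∩ A).ncard = rk M A := by
    intro I A hI hIB
    refine le_antisymm (base_inter_ncard_le hB A) ?_
    have : rk M A = I.ncard := by
      rw [rk, hI.eRk_eq_encard]; rfl
    rw [this]
    exact ncard_le_ncard (subset_inter hIB hI.subset) (hB.finite.inter_of_left A)
  exact ⟨B, hB, key hI (hIJ.trans (hJL.trans hLB)), key hJ (hJL.trans hLB), key hL hLB⟩

lemma exists_base_rk_rk (h : A ⊆ X) :
    ∃ B, M.IsBase B ∧ (B ∩ A).ncard = rk M A ∧ (B ∩ X).ncard = rk M X := by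
  obtain ⟨B, hB, h1, h2, -⟩ := exists_base_rk_rk_rk (M := M) h Subset.rfl
  exact ⟨B, hB, h1, h2⟩

lemma exists_base_rk (M : Matroid α) [M.Finite] (A : Set α) :
    ∃ B, M.IsBase B ∧ (B ∩ A).ncard = rk M A := by
  obtain ⟨B, hB, h, -⟩ := exists_base_rk_rk (M := M) (A := A) Subset.rfl
  exact ⟨B, hB, h⟩

lemma subset_closure_of_rk (hB : M.IsBase B) (hA : A ⊆ M.E) (h : (B ∩ A).ncard = rk M A) :
    A ⊆ M.closure (B ∩ A) := by
  refine ((hB.indep.subset inter_subset_left).isBasis_of_eRk_ge (hB.finite.inter_of_left A)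
    inter_subset_right ?_).subset_closure
  rw [← cast_rk, ← h, (hB.indep.subset inter_subset_left).eRk_eq_encard,
    (hB.finite.inter_of_left A).cast_ncard_eq]

lemma rk_eq_of_subset_closure (hB : M.IsBase B) (h : A ⊆ M.closure (B ∩ A)) :
    (B ∩ A).ncard = rk M A := by
  refine le_antisymm (base_inter_ncard_le hB A) ?_
  have := rk_mono (M := M) h
  rw [rk_closure] at this
  exact this.trans (rk_le_ncard (hB.finite.inter_of_left A))

end Rank

section Exchange

variable {α : Type*} {M : Matroid α} {A B X Y Z S : Set α} {x y : α}

/-- `x` can be exchanged for `y` in the base `B`. For a fixed base these pairs are the edges of the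
fundamental graph, a bipartite graph with sides `B` and its complement. -/
def Exch (M : Matroid α) (B : Set α) (x y : α) : Prop :=
  x ∈ B ∧ y ∉ B ∧ M.IsBase (insert y (B \ {x}))

lemma Exch.mem_ground (h : Exch M B x y) : y ∈ M.E :=
  h.2.2.subset_ground (mem_insert _ _)

lemma mem_closure_of_exch (hB : M.IsBase B) (hy : y ∈ M.E) (hyB : y ∉ B)
    (h : ∀ x, Exch M B x y → x ∈ A) : y ∈ M.closure A := by
  have hC := hB.fundCircuit_isCircuit hy hyB
  refine M.closure_subset_closure ?_ (hC.mem_closure_sdiff_singleton_of_mem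
    (M.mem_fundCircuit y B))
  rintro x ⟨hx, hxy : x ≠ y⟩
  have hxB : x ∈ B := (M.fundCircuit_subset_insert y B hx).resolve_left hxy
  rw [hB.indep.mem_fundCircuit_iff (by rwa [hB.closure_eq]) hyB,
    ← insert_sdiff_singleton_comm hxy.symm] at hx
  exact h x ⟨hxB, hyB, hB.exchange_isBase_of_indep hyB hx⟩

lemma Exch.mem_of_mem_closure (h : Exch M B x y) (hAB : A ⊆ B) (hy : y ∈ M.closure A) : x ∈ A := by
  by_contra hx
  have hsub : A ⊆ insert y (B \ {x}) \ {y} := by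
    intro z hz
    have hzx : z ≠ x := fun e ↦ hx (e ▸ hz)
    have hzy : z ≠ y := fun e ↦ h.2.1 (e ▸ hAB hz)
    exact ⟨Or.inr ⟨hAB hz, hzx⟩, hzy⟩
  exact h.2.2.indep.notMem_closure_sdiff_of_mem (mem_insert _ _)
    (M.closure_subset_closure hsub hy)

variable [M.Finite]

lemma Exch.ncard_inter (hB : M.IsBase B) (h : Exch M B x y) (A : Set α) (hA : x ∈ A ↔ y ∈ A) :
    (insert y (B \ {x}) ∩ A).ncard = (B ∩ A).ncard := by
  by_cases hy : y ∈ A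
  · have hx := hA.2 hy
    rw [insert_inter_of_mem hy, ← inter_sdiff_right_comm,
      ncard_insert_of_notMem (fun h' ↦ h.2.1 h'.1.1) (hB.finite.inter_of_left A).sdiff,
      ncard_sdiff_singleton_add_one (show x ∈ B ∩ A from ⟨h.1, hx⟩)
        (hB.finite.inter_of_left A)]
  · have hx : x ∉ A := fun h' ↦ hy (hA.1 h')
    rw [insert_inter_of_notMem hy, ← inter_sdiff_right_comm, sdiff_singleton_eq_self]
    exact fun h' ↦ hx h'.2

/-- A set that is not crossed by an edge of the fundamental graph of `B` (within the minor obtained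
by contracting `Z` and restricting to `S`) is a separator of that minor. -/
lemma rk_add_rk_of_forall_exch (hB : M.IsBase B) (hZ : Z ⊆ M.E) (hS : S ⊆ M.E)
    (hBZ : (B ∩ Z).ncard = rk M Z) (hBS : (B ∩ (Z ∪ S)).ncard = rk M (Z ∪ S))
    (hA : A ⊆ S) (h : ∀ x ∈ S, ∀ y ∈ S, Exch M B x y → (x ∈ A ↔ y ∈ A)) :
    rk M (Z ∪ A) + rk M (Z ∪ (S \ A)) = rk M (Z ∪ S) + rk M Z := by
  have hcl : ∀ A ⊆ S, (∀ x ∈ S, ∀ y ∈ S, Exch M B x y → (x ∈ A ↔ y ∈ A)) →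
      (B ∩ (Z ∪ A)).ncard = rk M (Z ∪ A) := by
    intro A hA h
    apply rk_eq_of_subset_closure hB
    intro y hy
    have hyE : y ∈ M.E := union_subset hZ (hA.trans hS) hy
    by_cases hyB : y ∈ B
    · exact M.mem_closure_of_mem' ⟨hyB, hy⟩ hyE
    rcases hy with hy | hy
    · exact M.closure_subset_closure (inter_subset_inter_right B subset_union_left)
        (subset_closure_of_rk hB hZ hBZ hy)
    refine mem_closure_of_exch hB hyE hyB fun x hx ↦ ?_
    rcases (hx.mem_of_mem_closure inter_subset_left
      (subset_closure_of_rk hB (union_subset hZ hS) hBS (Or.inr (hA hy)))).2 with hxZ | hxS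
    · exact ⟨hx.1, Or.inl hxZ⟩
    · exact ⟨hx.1, Or.inr ((h x hxS y (hA hy) hx).2 hy)⟩
  rw [← hcl A hA h, ← hcl (S \ A) sdiff_subset, ← hBZ, ← hBS]
  · have e1 : B ∩ (Z ∪ A) ∪ B ∩ (Z ∪ S \ A) = B ∩ (Z ∪ S) := by
      rw [← inter_union_distrib_left, ← union_union_distrib_left, union_sdiff_cancel hA]
    have e2 : (B ∩ (Z ∪ A)) ∩ (B ∩ (Z ∪ S \ A)) = B ∩ Z := by
      rw [← inter_inter_distrib_left, ← union_inter_distrib_left, inter_sdiff_self, union_empty]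
    rw [← ncard_union_add_ncard_inter _ _ (hB.finite.inter_of_left _) (hB.finite.inter_of_left _),
      e1, e2]
  · intro x hxS y hyS hxy
    simp [hxS, hyS, h x hxS y hyS hxy]

/-- The minor obtained by contracting `Z` and restricting to `S` is connected: it has no separator
besides `∅` and `S`. -/
def ConnectedOn (M : Matroid α) (Z S : Set α) : Prop :=
  ∀ A ⊆ S, A.Nonempty → A ≠ S → rk M (Z ∪ A) + rk M (Z ∪ (S \ A)) ≠ rk M (Z ∪ S) + rk M Z

/-- The fundamental graph of a connected minor is connected. -/
lemma ConnectedOn.exists_exch (hc : ConnectedOn M Z S) (hB : M.IsBase B) (hZ : Z ⊆ M.E)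
    (hS : S ⊆ M.E) (hBZ : (B ∩ Z).ncard = rk M Z)
    (hBS : (B ∩ (Z ∪ S)).ncard = rk M (Z ∪ S)) (hA : A ⊆ S) (hne : A.Nonempty) (hAS : A ≠ S) :
    ∃ x ∈ S, ∃ y ∈ S, Exch M B x y ∧ ¬ (x ∈ A ↔ y ∈ A) := by
  by_contra! hcon
  refine hc A hA hne hAS (rk_add_rk_of_forall_exch hB hZ hS hBZ hBS hA ?_)
  exact fun x hx y hy h ↦ hcon x hx y hy h

/-! ### Separators -/

omit [M.Finite] in
/-- A separator, described as a set that no basis exchange crosses. -/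
def IsSeparator (M : Matroid α) (A : Set α) : Prop :=
  ∀ ⦃B⦄, M.IsBase B → ∀ x y, Exch M B x y → (x ∈ A ↔ y ∈ A)

omit [M.Finite] in
lemma IsSeparator.compl (h : IsSeparator M A) : IsSeparator M (M.E \ A) := fun B hB x y hxy ↦ by
  simp [hB.subset_ground hxy.1, hxy.mem_ground, h hB x y hxy]

lemma IsSeparator.ncard_inter (h : IsSeparator M A) (hA : A ⊆ M.E) (hB : M.IsBase B) :
    (B ∩ A).ncard = rk M A := by
  have h1 := rk_add_rk_of_forall_exch (A := A) hB (empty_subset _) Subset.rfl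
    (by simp) (by rw [empty_union]; exact base_inter_ncard_ground hB) hA
    (fun x _ y _ hxy ↦ h hB x y hxy)
  simp only [empty_union, rk_empty, add_zero] at h1
  have h2 := base_inter_ncard_le hB A
  have h3 := base_inter_ncard_le hB (M.E \ A)
  have h4 : (B ∩ A).ncard + (B ∩ (M.E \ A)).ncard = rk M M.E := by
    rw [← base_ncard hB, ← inter_sdiff_assoc, inter_eq_left.2 hB.subset_ground,
      ncard_inter_add_ncard_sdiff_eq_ncard B A hB.finite]
  omega

lemma isSeparator_of_ncard {n : ℕ} (h : ∀ B, M.IsBase B → (B ∩ A).ncard = n) :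
    IsSeparator M A := by
  intro B hB x y hxy
  by_contra hne
  have h1 := h B hB
  have h2 := h _ hxy.2.2
  have hfin := hB.finite.inter_of_left A
  by_cases hy : y ∈ A
  · have hx : x ∉ A := fun hx ↦ hne (by simp [hx, hy])
    rw [insert_inter_of_mem hy, ← inter_sdiff_right_comm, ncard_insert_of_notMem
      (fun h' ↦ hxy.2.1 h'.1.1) hfin.sdiff, sdiff_singleton_eq_self (fun h' ↦ hx h'.2)] at h2
    omega
  · have hx : x ∈ A := by_contra fun hx ↦ hne (by simp [hx, hy])
    rw [insert_inter_of_notMem hy, ← inter_sdiff_right_comm] at h2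
    have := ncard_sdiff_singleton_add_one (show x ∈ B ∩ A from ⟨hxy.1, hx⟩) hfin
    omega

lemma isSeparator_of_rk (h : rk M A + rk M (M.E \ A) ≤ rk M M.E) :
    IsSeparator M A := by
  refine isSeparator_of_ncard (n := rk M A) fun B hB ↦ ?_
  have h2 := base_inter_ncard_le hB A
  have h3 := base_inter_ncard_le hB (M.E \ A)
  have h4 : (B ∩ A).ncard + (B ∩ (M.E \ A)).ncard = rk M M.E := by
    rw [← base_ncard hB, ← inter_sdiff_assoc, inter_eq_left.2 hB.subset_ground,
      ncard_inter_add_ncard_sdiff_eq_ncard B A hB.finite]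
  omega

/-- Bases can be combined along a separator. -/
lemma IsSeparator.isBase_mix (h : IsSeparator M A) (hA : A ⊆ M.E) (hX : M.IsBase X)
    (hY : M.IsBase Y) : M.IsBase ((X ∩ A) ∪ (Y \ A)) := by
  have h1 := subset_closure_of_rk hX hA (h.ncard_inter hA hX)
  have hY' : Y ∩ (M.E \ A) = Y \ A := by
    rw [← inter_sdiff_assoc, inter_eq_left.2 hY.subset_ground]
  have h2 := subset_closure_of_rk hY (sdiff_subset (t := A)) (h.compl.ncard_inter sdiff_subset hY)
  rw [hY'] at h2
  have hsp : M.Spanning ((X ∩ A) ∪ (Y \ A)) := by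
    rw [Matroid.spanning_iff_ground_subset_closure
      (union_subset (inter_subset_right.trans hA) (sdiff_subset.trans hY.subset_ground))]
    rw [← union_sdiff_cancel hA]
    exact union_subset (h1.trans (M.closure_subset_closure subset_union_left))
      (h2.trans (M.closure_subset_closure subset_union_right))
  obtain ⟨B, hB, hBs⟩ := hsp.exists_isBase_subset
  have hfin : ((X ∩ A) ∪ (Y \ A)).Finite := (hX.finite.inter_of_left A).union hY.finite.sdiff
  have hcard : ((X ∩ A) ∪ (Y \ A)).ncard ≤ B.ncard := by
    rw [ncard_union_eq (disjoint_sdiff_right.mono_left inter_subset_right)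
      (hX.finite.inter_of_left A) hY.finite.sdiff, h.ncard_inter hA hX, ← h.ncard_inter hA hY,
      ncard_inter_add_ncard_sdiff_eq_ncard Y A hY.finite, base_ncard hB, base_ncard hY]
  rwa [← eq_of_subset_of_ncard_le hBs hcard hfin]

lemma IsSeparator.rk_eq_add (h : IsSeparator M A) (hA : A ⊆ M.E) (X : Set α) :
    rk M X = rk M (X ∩ A) + rk M (X \ A) := by
  refine le_antisymm ?_ ?_
  · conv_lhs => rw [← inter_union_sdiff X A]
    exact rk_union_le _ _
  · obtain ⟨B₁, hB₁, h₁⟩ := exists_base_rk M (X ∩ A)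
    obtain ⟨B₂, hB₂, h₂⟩ := exists_base_rk M (X \ A)
    rw [← h₁, ← h₂, ← ncard_union_eq _ (hB₁.finite.inter_of_left _) (hB₂.finite.inter_of_left _)]
    · refine le_trans (ncard_le_ncard ?_ ((h.isBase_mix hA hB₁ hB₂).finite.inter_of_left X))
        (base_inter_ncard_le (h.isBase_mix hA hB₁ hB₂) X)
      rintro z (⟨hz, hzX, hzA⟩ | ⟨hz, hzX, hzA⟩)
      · exact ⟨Or.inl ⟨hz, hzA⟩, hzX⟩
      · exact ⟨Or.inr ⟨hz, hzA⟩, hzX⟩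
    · rw [disjoint_left]
      rintro z ⟨-, -, hz⟩ ⟨-, -, hz'⟩
      exact hz' hz

end Exchange

/-! ### Faces of the base polytope -/

section BasePolytope

variable {α : Type*} {M : Matroid α} {A B F G K X Y Z S : Set α} {x y : α → ℝ}

/-- The bases on the face of the base polytope that is cut out by `H(F)`. -/
def tightBases (M : Matroid α) (F : Set α) : Set (Set α) :=
  {B | M.IsBase B ∧ (B ∩ F).ncard = rk M F}

lemma mem_rankHyperplane (hF : F.Finite) :
    x ∈ rankHyperplane M F ↔ ∑ i ∈ hF.toFinset, x i = rk M F := by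
  rw [rankHyperplane, mem_ofPred_eq, finsum_mem_eq_finite_toFinset_sum _ hF]
  rfl

lemma indicator_mem_rankHyperplane (hF : F.Finite) (B : Set α) :
    B.indicator (1 : α → ℝ) ∈ rankHyperplane M F ↔ (B ∩ F).ncard = rk M F := by
  rw [mem_rankHyperplane hF, sum_indicator_one, hF.coe_toFinset]
  exact Nat.cast_inj

lemma indicator_mem_basePolytope (hB : M.IsBase B) : B.indicator (1 : α → ℝ) ∈ basePolytope M :=
  subset_convexHull ℝ _ ⟨B, hB, rfl⟩

/-- The sum of the coordinates in `F` is at most `r(F)` on the base polytope, and the face on which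
there is equality is the convex hull of its vertices. -/
lemma rankHyperplane_inter_basePolytope [M.Finite] (hF : F.Finite) :
    (∀ v ∈ (fun B : Set α ↦ B.indicator (1 : α → ℝ)) '' {B | M.IsBase B},
      coordSum hF.toFinset v ≤ rk M F) ∧
    rankHyperplane M F ∩ basePolytope M =
      convexHull ℝ {v | v ∈ (fun B : Set α ↦ B.indicator (1 : α → ℝ)) '' {B | M.IsBase B} ∧
        coordSum hF.toFinset v = rk M F} := by
  have h : ∀ v ∈ (fun B : Set α ↦ B.indicator (1 : α → ℝ)) '' {B | M.IsBase B},
      coordSum hF.toFinset v ≤ rk M F := by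
    rintro _ ⟨B, hB, rfl⟩
    rw [coordSum_apply, sum_indicator_one, hF.coe_toFinset]
    exact_mod_cast base_inter_ncard_le hB F
  refine ⟨h, ?_⟩
  have e := convexHull_inter_level _ (coordSum hF.toFinset).toLinearMap (rk M F) h
  refine Eq.trans ?_ e
  ext x
  rw [mem_inter_iff, mem_rankHyperplane hF, and_comm]
  simp [basePolytope]

lemma isExposed_rankHyperplane_inter [M.Finite] (hF : F.Finite) :
    IsExposed ℝ (basePolytope M) (rankHyperplane M F ∩ basePolytope M) := by
  obtain ⟨h, e⟩ := rankHyperplane_inter_basePolytope (M := M) hF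
  exact (isExposed_convexHull_iff _ _).2 (Or.inr ⟨_, _, h, e⟩)

lemma face_subset_of_tightBases_subset [M.Finite] (hF : F.Finite) (hG : G.Finite)
    (h : tightBases M F ⊆ tightBases M G) :
    rankHyperplane M F ∩ basePolytope M ⊆ rankHyperplane M G ∩ basePolytope M := by
  rw [(rankHyperplane_inter_basePolytope hF).2, (rankHyperplane_inter_basePolytope hG).2]
  refine convexHull_mono ?_
  rintro _ ⟨⟨B, hB, rfl⟩, hBF⟩
  refine ⟨⟨B, hB, rfl⟩, ?_⟩
  rw [coordSum_apply, ← mem_rankHyperplane, indicator_mem_rankHyperplane ‹_›] at hBF ⊢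
  exact (h ⟨hB, hBF⟩).2

lemma tightBases_subset_of_face_subset (hF : F.Finite) (hG : G.Finite)
    (h : rankHyperplane M F ∩ basePolytope M ⊆ rankHyperplane M G) :
    tightBases M F ⊆ tightBases M G := fun B hB ↦
  ⟨hB.1, (indicator_mem_rankHyperplane hG B).1 (h ⟨(indicator_mem_rankHyperplane hF B).2 hB.2,
    indicator_mem_basePolytope hB.1⟩)⟩

/-- The definition of a flacet in terms of the bases on the faces `H(G) ∩ P(M)`: `F` defines a
proper face, a proper face of this form that contains it is equal to it, and `F` is a minimal flat
defining it. -/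
lemma IsFlacet.combinatorial [M.Finite] (h : IsFlacet M F) :
    (∃ B, M.IsBase B ∧ (B ∩ F).ncard ≠ rk M F) ∧
    (∀ G ⊆ M.E, tightBases M F ⊆ tightBases M G → (∃ B, M.IsBase B ∧ (B ∩ G).ncard ≠ rk M G) →
      tightBases M G = tightBases M F) ∧
    ∀ G, M.IsFlat G → tightBases M G = tightBases M F → G ⊆ F → G = F := by
  obtain ⟨hflat, ⟨-, hlt, hmax⟩, hmin⟩ := h
  have hF := M.set_finite F hflat.subset_ground
  refine ⟨?_, ?_, ?_⟩
  · by_contra! hcon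
    refine hlt.2 (subset_inter ?_ Subset.rfl)
    have : basePolytope M = rankHyperplane M (∅ : Set α) ∩ basePolytope M := by
      rw [eq_comm, inter_eq_right]
      intro x _
      rw [mem_rankHyperplane finite_empty]
      simp
    rw [this]
    exact (face_subset_of_tightBases_subset finite_empty hF
      fun B hB ↦ ⟨hB.1, hcon B hB.1⟩).trans inter_subset_left
  · rintro G hGE hsub ⟨B, hB, hBG⟩
    have hG := M.set_finite G hGE
    refine Subset.antisymm ?_ hsub
    by_contra hnot
    have hne : rankHyperplane M F ∩ basePolytope M ⊂ rankHyperplane M G ∩ basePolytope M :=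
      ⟨face_subset_of_tightBases_subset hF hG hsub, fun h' ↦ hnot
        (tightBases_subset_of_face_subset hG hF (h'.trans inter_subset_left))⟩
    have := hmax _ (isExposed_rankHyperplane_inter hG) hne
    have hB' := indicator_mem_basePolytope hB
    rw [← this] at hB'
    exact hBG ((indicator_mem_rankHyperplane hG B).1 hB'.1)
  · intro G hGf hGF hsub
    have hG := M.set_finite G hGf.subset_ground
    exact hmin G hGf (Subset.antisymm (face_subset_of_tightBases_subset hG hF hGF.subset)
      (face_subset_of_tightBases_subset hF hG hGF.symm.subset)) hsub

/-! ### The relative interior of the affine span in the cube -/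

lemma eq_of_mem_affineSpan (l : (α → ℝ) →L[ℝ] ℝ) {c : ℝ}
    (h : ∀ B, M.IsBase B → l (B.indicator 1) = c)
    (hx : x ∈ (affineSpan ℝ (basePolytope M) : Set (α → ℝ))) : l x = c := by
  rw [basePolytope, affineSpan_convexHull] at hx
  refine affineSpan_induction hx ?_ ?_
  · rintro _ ⟨B, hB, rfl⟩
    exact h B hB
  · intro t u v w hu hv hw
    simp [hu, hv, hw]

lemma indicator_mem_cube (hB : M.IsBase B) : B.indicator (1 : α → ℝ) ∈
    (affineSpan ℝ (basePolytope M) : Set (α → ℝ)) ∩ Icc 0 1 := by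
  refine ⟨subset_affineSpan ℝ _ (indicator_mem_basePolytope hB), fun i ↦ ?_, fun i ↦ ?_⟩ <;>
    by_cases h : i ∈ B <;> simp [h]

lemma pos_of_mem_relInterior
    (hx : x ∈ relInterior ((affineSpan ℝ (basePolytope M) : Set (α → ℝ)) ∩ Icc 0 1)) {i : α}
    (hB : M.IsBase B) (hi : i ∈ B) : 0 < x i := by
  obtain ⟨hxm, hx⟩ := hx
  refine lt_of_le_of_ne (hxm.2.1 i) fun h0 ↦ ?_
  have hexp : IsExposed ℝ ((affineSpan ℝ (basePolytope M) : Set (α → ℝ)) ∩ Icc 0 1)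
      {y | y ∈ (affineSpan ℝ (basePolytope M) : Set (α → ℝ)) ∩ Icc 0 1 ∧ y i = 0} := by
    intro _
    refine ⟨-ContinuousLinearMap.proj i, ?_⟩
    ext y
    simp only [neg_apply, ContinuousLinearMap.proj_apply, neg_le_neg_iff]
    constructor
    · rintro ⟨hy, hyi⟩
      exact ⟨hy, fun z hz ↦ hyi.le.trans (hz.2.1 i)⟩
    · rintro ⟨hy, hyi⟩
      exact ⟨hy, le_antisymm ((hyi x hxm).trans h0.symm.le) (hy.2.1 i)⟩
  have := indicator_mem_cube hB
  rw [← hx _ hexp ⟨hxm, h0.symm⟩] at this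
  have := this.2
  simp [hi] at this

lemma lt_one_of_mem_relInterior
    (hx : x ∈ relInterior ((affineSpan ℝ (basePolytope M) : Set (α → ℝ)) ∩ Icc 0 1)) {i : α}
    (hB : M.IsBase B) (hi : i ∉ B) : x i < 1 := by
  obtain ⟨hxm, hx⟩ := hx
  refine lt_of_le_of_ne (hxm.2.2 i) fun h1 ↦ ?_
  have hexp : IsExposed ℝ ((affineSpan ℝ (basePolytope M) : Set (α → ℝ)) ∩ Icc 0 1)
      {y | y ∈ (affineSpan ℝ (basePolytope M) : Set (α → ℝ)) ∩ Icc 0 1 ∧ y i = 1} := by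
    intro _
    refine ⟨ContinuousLinearMap.proj i, ?_⟩
    ext y
    simp only [ContinuousLinearMap.proj_apply]
    constructor
    · rintro ⟨hy, hyi⟩
      exact ⟨hy, fun z hz ↦ (hz.2.2 i).trans hyi.symm.le⟩
    · rintro ⟨hy, hyi⟩
      exact ⟨hy, le_antisymm (hy.2.2 i) (h1.symm.le.trans (hyi x hxm))⟩
  have := indicator_mem_cube hB
  rw [← hx _ hexp ⟨hxm, h1⟩] at this
  have := this.2
  simp [hi] at this

/-- If the ground set is a union of two disjoint bases, then the centre of the cube is in the
relative interior: the cube and the affine span are both symmetric about it. -/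
lemma center_mem_relInterior (hB : M.IsBase B) (hB' : M.IsBase (M.E \ B)) :
    M.E.indicator (fun _ ↦ (1 / 2 : ℝ)) ∈
      relInterior ((affineSpan ℝ (basePolytope M) : Set (α → ℝ)) ∩ Icc 0 1) := by
  set h : α → ℝ := M.E.indicator (fun _ ↦ (1 / 2 : ℝ)) with hh
  set A := affineSpan ℝ (basePolytope M) with hA
  have hmid : h = AffineMap.lineMap (B.indicator 1) ((M.E \ B).indicator 1) (1 / 2 : ℝ) := by
    ext i
    rw [AffineMap.lineMap_apply_module]
    by_cases hi : i ∈ B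
    · simp [hh, hi, hB.subset_ground hi]; norm_num
    · by_cases hiE : i ∈ M.E <;> simp [hh, hi, hiE]
  have hhA : h ∈ (A : Set (α → ℝ)) := by
    rw [hmid]
    exact AffineMap.lineMap_mem _ (indicator_mem_cube hB).1 (indicator_mem_cube hB').1
  have hoff : ∀ y ∈ (A : Set (α → ℝ)), ∀ i ∉ M.E, y i = 0 := fun y hy i hi ↦
    eq_of_mem_affineSpan (ContinuousLinearMap.proj i) (fun B hB ↦ by
      have hiB : i ∉ B := fun h ↦ hi (hB.subset_ground h)
      simp [hiB]) hy
  have hcube : h ∈ Icc (0 : α → ℝ) 1 := by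
    constructor <;> intro i <;> by_cases hi : i ∈ M.E <;> simp [hh, hi]
    norm_num
  refine ⟨⟨hhA, hcube⟩, fun G hG hhG ↦ Subset.antisymm hG.subset ?_⟩
  obtain ⟨l, hl⟩ := hG ⟨h, hhG⟩
  rintro y ⟨hyA, hy⟩
  have hrefl : AffineMap.lineMap y h (2 : ℝ) ∈ (A : Set (α → ℝ)) ∩ Icc 0 1 := by
    refine ⟨AffineMap.lineMap_mem _ hyA hhA, ?_⟩
    have : ∀ i, 0 ≤ AffineMap.lineMap y h (2 : ℝ) i ∧ AffineMap.lineMap y h (2 : ℝ) i ≤ 1 := by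
      intro i
      rw [AffineMap.lineMap_apply_module]
      by_cases hi : i ∈ M.E
      · have h0 := hy.1 i
        have h1 := hy.2 i
        simp only [Pi.zero_apply, Pi.one_apply] at h0 h1
        simp only [hh, Pi.add_apply, Pi.smul_apply, hi, indicator_of_mem, smul_eq_mul]
        constructor <;> linarith
      · simp [hh, hi, hoff y hyA i hi]
    exact ⟨fun i ↦ (this i).1, fun i ↦ (this i).2⟩
  rw [hl] at hhG ⊢
  have h1 := hhG.2 _ hrefl
  rw [AffineMap.lineMap_apply_module, map_add, map_smul, map_smul] at h1
  simp only [smul_eq_mul] at h1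
  exact ⟨⟨hyA, hy⟩, fun z hz ↦ (hhG.2 z hz).trans (by linarith)⟩

/-! ### A criterion for split flacets -/

lemma map_indicator_eq (l l' : (α → ℝ) →L[ℝ] ℝ) [DecidableEq α] {B : Set α} (hB : B.Finite)
    (h : ∀ i ∈ B, l (Pi.single i 1) = l' (Pi.single i 1)) :
    l (B.indicator 1) = l' (B.indicator 1) := by
  have e : B.indicator (1 : α → ℝ) = ∑ i ∈ hB.toFinset, Pi.single i (1 : ℝ) := by
    ext j
    rw [Finset.sum_apply, Finset.sum_pi_single]
    by_cases hj : j ∈ B <;> simp [hj]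
  rw [e, map_sum, map_sum]
  exact Finset.sum_congr rfl fun i hi ↦ h i (by simpa using hi)

/-- A flat `F` is a flacet if sufficiently many basis exchanges stay on its face. Here `K` is a
separator that contains `F`. The exchanges within `F`, within `K \ F` and within `E \ K` force the
coefficients of a functional that is constant on the face to be constant on each of these blocks. -/
lemma isFlacet_of_exchanges [M.Finite] (hFK : F ⊆ K) (hK : K ⊆ M.E) {m : ℕ}
    (hKm : ∀ B, M.IsBase B → (B ∩ K).ncard = m)
    (hflat : ∀ z ∈ M.E, z ∉ F → ∃ B ∈ tightBases M F, z ∈ B)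
    (hex : ∀ i ∈ M.E, ∀ j ∈ M.E, i ≠ j → (i ∈ F ↔ j ∈ F) → (i ∈ K ↔ j ∈ K) →
      ∃ B ∈ tightBases M F, Exch M B i j)
    (hnt : ∃ B, M.IsBase B ∧ (B ∩ F).ncard ≠ rk M F) : IsFlacet M F := by
  classical
  have hFE := hFK.trans hK
  have hF := M.set_finite F hFE
  have hKf := M.set_finite K hK
  have hEf := M.ground_finite
  obtain ⟨B₁, hB₁, hB₁F⟩ := hnt
  refine ⟨?_, ⟨isExposed_rankHyperplane_inter hF, ⟨inter_subset_right, ?_⟩, ?_⟩, ?_⟩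
  · rw [Matroid.isFlat_iff_closure_eq]
    refine Subset.antisymm (fun z hz ↦ ?_) (M.subset_closure F hFE)
    by_contra hzF
    obtain ⟨B, hB, hzB⟩ := hflat z (M.mem_ground_of_mem_closure hz) hzF
    have h1 := M.closure_subset_closure_of_subset_closure (subset_closure_of_rk hB.1 hFE hB.2) hz
    refine hB.1.indep.notMem_closure_sdiff_of_mem hzB (M.closure_subset_closure ?_ h1)
    exact fun w hw ↦ ⟨hw.1, fun e ↦ hzF (e ▸ hw.2)⟩
  · intro h
    exact hB₁F ((indicator_mem_rankHyperplane hF B₁).1 (h (indicator_mem_basePolytope hB₁)).1)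
  · intro G hG hFG
    rcases (isExposed_convexHull_iff _ G).1 hG with rfl | ⟨l, c, hl, rfl⟩
    · exact absurd hFG.1 fun h ↦ hFG.2 (empty_subset _)
    have htight : ∀ B ∈ tightBases M F, l (B.indicator 1) = c := by
      intro B hB
      have h1 := hFG.1 ⟨(indicator_mem_rankHyperplane hF B).2 hB.2, indicator_mem_basePolytope hB.1⟩
      have h2 := convexHull_inter_level _ l.toLinearMap c hl
      exact (h2.symm.subset h1).2
    have hw : ∀ i ∈ M.E, ∀ j ∈ M.E, (i ∈ F ↔ j ∈ F) → (i ∈ K ↔ j ∈ K) →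
        l (Pi.single i 1) = l (Pi.single j 1) := by
      intro i hi j hj hij hij'
      rcases eq_or_ne i j with rfl | hne
      · rfl
      obtain ⟨B, hB, hexch⟩ := hex i hi j hj hne hij hij'
      have hB' : insert j (B \ {i}) ∈ tightBases M F :=
        ⟨hexch.2.2, by rw [hexch.ncard_inter hB.1 F hij, hB.2]⟩
      have e : B.indicator (1 : α → ℝ) + Pi.single j 1 =
          (insert j (B \ {i})).indicator 1 + Pi.single i 1 := by
        ext k
        by_cases hki : k = i
        · subst hki; simp [hexch.1, hne]
        · by_cases hkj : k = j
          · subst hkj; simp [hexch.2.1, hne.symm]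
          · by_cases hkB : k ∈ B <;> simp [hki, hkj, hkB]
      have e' := congrArg l e
      rw [map_add, map_add, htight B hB, htight _ hB'] at e'
      linarith
    have hblock : ∀ s : Set α, s ⊆ M.E → (∀ i ∈ s, ∀ j ∈ s, (i ∈ F ↔ j ∈ F) ∧ (i ∈ K ↔ j ∈ K)) →
        ∃ a, ∀ i ∈ s, l (Pi.single i 1) = a := by
      intro s hs h
      rcases s.eq_empty_or_nonempty with rfl | ⟨i, hi⟩
      · exact ⟨0, by simp⟩
      · exact ⟨_, fun j hj ↦ hw j (hs hj) i (hs hi) (h j hj i hi).1 (h j hj i hi).2⟩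
    obtain ⟨a, ha⟩ := hblock F hFE fun i hi j hj ↦ by simp [hi, hj, hFK hi, hFK hj]
    obtain ⟨b, hb⟩ := hblock (K \ F) (sdiff_subset.trans hK) fun i hi j hj ↦ by
      simp [hi.1, hj.1, hi.2, hj.2]
    obtain ⟨d, hd⟩ := hblock (M.E \ K) sdiff_subset fun i hi j hj ↦ by
      have hiF : i ∉ F := fun h ↦ hi.2 (hFK h)
      have hjF : j ∉ F := fun h ↦ hj.2 (hFK h)
      simp [hi.2, hj.2, hiF, hjF]
    have hval : ∀ B, M.IsBase B → l (B.indicator 1) =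
        a * (B ∩ F).ncard + b * (m - (B ∩ F).ncard) + d * (rk M M.E - m) := by
      intro B hB
      rw [map_indicator_eq l (a • coordSum hF.toFinset +
        b • (coordSum hKf.toFinset - coordSum hF.toFinset) +
        d • (coordSum hEf.toFinset - coordSum hKf.toFinset)) hB.finite]
      · simp only [add_apply, smul_apply, sub_apply, coordSum_apply, sum_indicator_one,
          Finite.coe_toFinset, smul_eq_mul, hKm B hB, base_inter_ncard_ground hB]
      · intro i hi
        have hiE := hB.subset_ground hi
        simp only [add_apply, smul_apply, sub_apply, coordSum_apply, smul_eq_mul,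
          Finset.sum_pi_single', Finite.mem_toFinset, hiE, if_true]
        by_cases hiF : i ∈ F
        · simp [hiF, hFK hiF, ha i hiF]
        · by_cases hiK : i ∈ K
          · simp [hiF, hiK, hb i ⟨hiK, hiF⟩]
          · simp [hiF, hiK, hd i ⟨hiE, hiK⟩]
    obtain ⟨B₀, hB₀, hB₀F⟩ := exists_base_rk M F
    have hc := htight B₀ ⟨hB₀, hB₀F⟩
    rw [hval B₀ hB₀, hB₀F] at hc
    have hab : a = b := by
      by_contra hab
      refine hFG.2 ?_
      rw [(rankHyperplane_inter_basePolytope hF).2]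
      refine convexHull_mono ?_
      rintro _ ⟨⟨B, hB, rfl⟩, hBc⟩
      refine ⟨⟨B, hB, rfl⟩, ?_⟩
      rw [coordSum_apply, ← mem_rankHyperplane, indicator_mem_rankHyperplane hF]
      change l (B.indicator 1) = c at hBc
      rw [hval B hB] at hBc
      have h0 : (a - b) * (((B ∩ F).ncard : ℝ) - rk M F) = 0 := by linear_combination hBc - hc
      rcases mul_eq_zero.1 h0 with h0 | h0
      · exact absurd (sub_eq_zero.1 h0) hab
      · exact_mod_cast sub_eq_zero.1 h0
    rw [basePolytope]
    congr 1
    ext v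
    refine ⟨fun h ↦ h.1, ?_⟩
    rintro ⟨B, hB, rfl⟩
    refine ⟨⟨B, hB, rfl⟩, ?_⟩
    change l (B.indicator 1) = c
    rw [hval B hB]
    subst hab
    linear_combination hc
  · intro G hGf hGF hsub
    by_contra hne
    have hG := M.set_finite G hGf.subset_ground
    have htight : ∀ B ∈ tightBases M F, (B ∩ G).ncard = rk M G := fun B hB ↦
      (tightBases_subset_of_face_subset hF hG (hGF.symm.subset.trans inter_subset_left) hB).2
    obtain ⟨j, hjF, hjG⟩ : ∃ j ∈ F, j ∉ G := by
      by_contra! h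
      exact hne (hsub.antisymm h)
    rcases G.eq_empty_or_nonempty with rfl | ⟨i, hi⟩
    · exact hB₁F (tightBases_subset_of_face_subset hG hF (hGF.subset.trans inter_subset_left)
        (show B₁ ∈ tightBases M ∅ from ⟨hB₁, by simp⟩)).2
    · have hij : i ≠ j := fun e ↦ hjG (e ▸ hi)
      obtain ⟨B, hB, hexch⟩ := hex i (hFE (hsub hi)) j (hFE hjF) hij (by simp [hsub hi, hjF])
        (by simp [hFK (hsub hi), hFK hjF])
      have hB' : insert j (B \ {i}) ∈ tightBases M F :=
        ⟨hexch.2.2, by rw [hexch.ncard_inter hB.1 F (by simp [hsub hi, hjF]), hB.2]⟩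
      have h1 := htight B hB
      have h2 := htight _ hB'
      rw [insert_inter_of_notMem hjG, ← inter_sdiff_right_comm] at h2
      have := ncard_sdiff_singleton_add_one (show i ∈ B ∩ G from ⟨hexch.1, hi⟩)
        (hB.1.finite.inter_of_left G)
      omega

lemma IsFlacet.isSplitFlacet [M.Finite] (h : IsFlacet M F) (h0 : 0 < rk M F)
    (h1 : rk M F < F.ncard) (h2 : rk M F < rk M M.E)
    (h3 : rk M M.E + F.ncard < rk M F + M.E.ncard) : IsSplitFlacet M F := by
  refine ⟨h, ?_⟩
  have hF := M.set_finite F h.1.subset_ground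
  have hE := M.ground_finite
  have hsub : hF.toFinset ⊆ hE.toFinset := Finite.toFinset_subset_toFinset.2 h.1.subset_ground
  rw [ncard_eq_toFinset_card F hF] at h1 h3
  rw [ncard_eq_toFinset_card M.E hE] at h3
  have e1 : matroidHypersimplex M = hypersimplex (hE.toFinset : Set α) (rk M M.E) := by
    rw [matroidHypersimplex, hE.coe_toFinset, rk, M.eRk_ground]
  have e2 : rankHyperplane M F ∩ matroidHypersimplex M =
      slab hE.toFinset hF.toFinset (rk M M.E) (rk M F) (rk M F) := by
    rw [e1, hypersimplex_eq_slab hsub]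
    ext x
    rw [mem_inter_iff, mem_rankHyperplane hF]
    constructor
    · rintro ⟨hx, g1, g2, g3, g4, g5⟩
      exact ⟨g1, g2, g3, hx.symm.le, hx.le⟩
    · rintro ⟨g1, g2, g3, g4, g5⟩
      refine ⟨le_antisymm g5 g4, g1, g2, g3, le_trans (by simp) g4, g5.trans ?_⟩
      exact_mod_cast h2.le
  rw [e2, e1]
  exact isSplitHyperplane_slab hsub h0 h1 h2 h3

end BasePolytope

/-! ### Matroids given by a list of bases -/

section Presentation

variable {α β : Type*} {M : Matroid α} {N : Matroid β}

/-- Isomorphism with a matroid on a full type, expressed by an enumeration of the ground set. -/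
lemma isIsomorphic_iff (hN : N.E = univ) : IsIsomorphic M N ↔
    ∃ g : β → α, g.Injective ∧ M.E = range g ∧ ∀ T : Set β, M.IsBase (g '' T) ↔ N.IsBase T := by
  constructor
  · rintro ⟨e, he⟩
    have hmem : ∀ b, b ∈ N.E := fun b ↦ hN ▸ mem_univ b
    let g : β → α := fun b ↦ (e.symm ⟨b, hmem b⟩ : α)
    have hg : g.Injective := fun b b' h ↦ by simpa [g, Subtype.coe_inj] using h
    have hrange : M.E = range g := by
      ext a
      constructor
      · intro ha
        exact ⟨e ⟨a, ha⟩, by simp [g]⟩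
      · rintro ⟨b, rfl⟩
        exact (e.symm ⟨b, hmem b⟩).2
    have hind : ∀ I : Set β, N.Indep I ↔ M.Indep (g '' I) := by
      intro I
      rw [← he, Matroid.mapSetEquiv_indep_iff, and_iff_left (hN ▸ subset_univ I)]
      suffices h : (Subtype.val '' (e.symm '' (Subtype.val ⁻¹' I)) : Set α) = g '' I by rw [h]
      ext a
      simp only [mem_image, g]
      constructor
      · rintro ⟨_, ⟨b, hb, rfl⟩, rfl⟩
        exact ⟨b, hb, rfl⟩
      · rintro ⟨b, hb, rfl⟩
        exact ⟨_, ⟨⟨b, hmem b⟩, hb, rfl⟩, rfl⟩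
    have hM : M = N.map g hg.injOn := by
      refine Matroid.ext_indep (by rw [Matroid.map_ground, hN, image_univ, hrange]) fun I hI ↦ ?_
      rw [Matroid.map_indep_iff]
      constructor
      · intro h
        obtain ⟨J, rfl⟩ := subset_range_iff_exists_image_eq.1 (hI.trans hrange.subset)
        exact ⟨J, (hind J).2 h, rfl⟩
      · rintro ⟨J, hJ, rfl⟩
        exact (hind J).1 hJ
    refine ⟨g, hg, hrange, fun T ↦ ?_⟩
    rw [hM, Matroid.map_isBase_iff]
    constructor
    · rintro ⟨J, hJ, h⟩
      rwa [hg.image_injective h]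
    · exact fun h ↦ ⟨T, h, rfl⟩
  · rintro ⟨g, hg, hrange, hbase⟩
    have hM : M = N.map g hg.injOn := by
      refine Matroid.ext_isBase (by rw [Matroid.map_ground, hN, image_univ, hrange]) fun I hI ↦ ?_
      obtain ⟨J, rfl⟩ := subset_range_iff_exists_image_eq.1 (hI.trans hrange.subset)
      rw [hbase, Matroid.map_isBase_iff]
      constructor
      · exact fun h ↦ ⟨J, h, rfl⟩
      · rintro ⟨J', hJ', h⟩
        rwa [hg.image_injective h]
    let e : M.E ≃ N.E := ((Equiv.setCongr hrange).trans (Equiv.ofInjective g hg).symm).trans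
      ((Equiv.Set.univ β).symm.trans (Equiv.setCongr hN.symm))
    have hes : ∀ b : N.E, (e.symm b : α) = g b := fun b ↦ rfl
    refine ⟨e, Matroid.ext_indep rfl fun I hI ↦ ?_⟩
    rw [Matroid.mapSetEquiv_indep_iff, and_iff_left (show I ⊆ N.E from hI)]
    have h : (Subtype.val '' (e.symm '' (Subtype.val ⁻¹' I)) : Set α) = g '' I := by
      ext a
      simp only [mem_image]
      constructor
      · rintro ⟨_, ⟨b, hb, rfl⟩, rfl⟩
        exact ⟨b, hb, (hes b).symm⟩
      · rintro ⟨b, hb, rfl⟩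
        exact ⟨_, ⟨⟨b, hI hb⟩, hb, rfl⟩, hes _⟩
    rw [h, hM, Matroid.map_indep_iff]
    constructor
    · rintro ⟨J, hJ, h⟩
      rwa [hg.image_injective h]
    · exact fun h ↦ ⟨I, h, rfl⟩

/-- The ground set of `M` is enumerated by `g`, and the bases of `M` are the images of the members
of `𝓑`. -/
structure Presents (M : Matroid α) (g : β → α) (𝓑 : Finset (Finset β)) : Prop where
  injective : g.Injective
  ground : M.E = range g
  isBase : ∀ T : Finset β, M.IsBase (g '' T) ↔ T ∈ 𝓑

variable {g : β → α} {𝓑 : Finset (Finset β)}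

lemma isIsomorphic_ofBases_iff {n : ℕ} {𝓑 : Finset (Finset (Fin n))} {hne} {hex} :
    IsIsomorphic M (ofBases 𝓑 hne hex) ↔ ∃ g, Presents M g 𝓑 := by
  rw [isIsomorphic_iff rfl]
  refine exists_congr fun g ↦ ?_
  have hb : ∀ T : Set (Fin n), (ofBases 𝓑 hne hex).IsBase T ↔ ∃ A ∈ 𝓑, (A : Set (Fin n)) = T :=
    fun T ↦ Iff.rfl
  constructor
  · rintro ⟨h1, h2, h3⟩
    refine ⟨h1, h2, fun T ↦ ?_⟩
    rw [h3, hb]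
    simp
  · rintro ⟨h1, h2, h3⟩
    refine ⟨h1, h2, fun T ↦ ?_⟩
    rw [hb]
    constructor
    · intro h
      refine ⟨(Set.toFinite T).toFinset, ?_, by simp⟩
      rw [← h3]
      simpa using h
    · rintro ⟨A, hA, rfl⟩
      exact (h3 A).2 hA

lemma Presents.exists_finset [Finite β] (h : Presents M g 𝓑) {B : Set α} (hB : M.IsBase B) :
    ∃ T ∈ 𝓑, g '' T = B := by
  obtain ⟨J, rfl⟩ := subset_range_iff_exists_image_eq.1 (hB.subset_ground.trans h.ground.subset)
  refine ⟨(Set.toFinite J).toFinset, ?_, by simp⟩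
  rw [← h.isBase]
  simpa using hB

lemma Presents.finite [Finite β] (h : Presents M g 𝓑) : M.Finite :=
  ⟨h.ground ▸ finite_range g⟩

lemma Presents.ncard_ground [Fintype β] (h : Presents M g 𝓑) : M.E.ncard = Fintype.card β := by
  rw [h.ground, ← image_univ, ncard_image_of_injective _ h.injective, ncard_univ,
    Nat.card_eq_fintype_card]

lemma Presents.ncard_inter [DecidableEq β] (h : Presents M g 𝓑) (T A : Finset β) :
    (g '' T ∩ g '' A).ncard = (T ∩ A).card := by
  rw [← image_inter h.injective, ncard_image_of_injective _ h.injective, ← Finset.coe_inter,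
    ncard_coe_finset]

lemma Presents.exch [DecidableEq β] (h : Presents M g 𝓑) {T : Finset β} {i j : β} (hi : i ∈ T)
    (hj : j ∉ T) (hT : insert j (T.erase i) ∈ 𝓑) : Exch M (g '' T) (g i) (g j) := by
  refine ⟨⟨i, hi, rfl⟩, ?_, ?_⟩
  · rintro ⟨k, hk, e⟩
    exact hj (h.injective e ▸ hk)
  · have := (h.isBase _).2 hT
    rw [Finset.coe_insert, Finset.coe_erase, image_insert_eq, image_sdiff h.injective,
      image_singleton] at this
    exact this

/-- Conditions on a list of bases of rank `r` that make `A` a split flacet (`K` is a separator)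
whose hyperplane passes through the centre of the cube. -/
def IsCentralFlacet [Fintype β] [DecidableEq β] (𝓑 : Finset (Finset β)) (r : ℕ)
    (A K : Finset β) (k m : ℕ) : Prop :=
  A ⊆ K ∧ A.card = 2 * k ∧ 0 < k ∧ k < r ∧ r + k < Fintype.card β ∧
  (∀ T ∈ 𝓑, (T ∩ A).card ≤ k ∧ (T ∩ K).card = m ∧ T.card = r) ∧ (∃ T ∈ 𝓑, (T ∩ A).card ≠ k) ∧
  (∀ z ∉ A, ∃ T ∈ 𝓑, (T ∩ A).card = k ∧ z ∈ T) ∧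
  ∀ i j, i ≠ j → (i ∈ A ↔ j ∈ A) → (i ∈ K ↔ j ∈ K) →
    ∃ T ∈ 𝓑, (T ∩ A).card = k ∧ i ∈ T ∧ j ∉ T ∧ insert j (T.erase i) ∈ 𝓑

set_option synthInstance.maxSize 1000 in
set_option synthInstance.maxHeartbeats 200000 in
instance [Fintype β] [DecidableEq β] (𝓑 : Finset (Finset β)) (r : ℕ) (A K : Finset β) (k m : ℕ) :
    Decidable (IsCentralFlacet 𝓑 r A K k m) := by
  unfold IsCentralFlacet
  infer_instance

lemma Presents.isSplitFlacet [Fintype β] [DecidableEq β] (h : Presents M g 𝓑) {r : ℕ}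
    {A K : Finset β} {k m : ℕ} (hA : IsCentralFlacet 𝓑 r A K k m) :
    IsSplitFlacet M (g '' A) ∧ rk M (g '' A) = k := by
  have := h.finite
  obtain ⟨hAK, hA2, hk, hkr, hrn, hle, ⟨T₁, hT₁, hT₁A⟩, hflat, hex⟩ := hA
  have hbase : ∀ T, T ∈ 𝓑 → M.IsBase (g '' T) := fun T hT ↦ (h.isBase T).2 hT
  have hT₂ : ∃ T ∈ 𝓑, (T ∩ A).card = k := by
    have : ∃ z, z ∉ A := by
      by_contra! hall
      have : A.card = Fintype.card β := Finset.card_eq_iff_eq_univ A |>.2 (by ext; simp [hall])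
      omega
    obtain ⟨z, hz⟩ := this
    obtain ⟨T, hT, hTA, -⟩ := hflat z hz
    exact ⟨T, hT, hTA⟩
  obtain ⟨T₂, hT₂, hT₂A⟩ := hT₂
  have hrk : rk M (g '' A) = k := by
    apply le_antisymm
    · obtain ⟨B, hB, hBA⟩ := exists_base_rk M (g '' A)
      obtain ⟨T, hT, rfl⟩ := h.exists_finset hB
      rw [← hBA, h.ncard_inter]
      exact (hle T hT).1
    · rw [← hT₂A, ← h.ncard_inter]
      exact base_inter_ncard_le (hbase _ hT₂) _
  have htight : ∀ T ∈ 𝓑, (T ∩ A).card = k → g '' T ∈ tightBases M (g '' A) := fun T hT hTA ↦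
    ⟨hbase T hT, by rw [h.ncard_inter, hrk, hTA]⟩
  have hr : rk M M.E = r := by
    rw [← base_ncard (hbase _ hT₁), ncard_image_of_injective _ h.injective, ncard_coe_finset]
    exact (hle _ hT₁).2.2
  have hcard : (g '' (A : Set β)).ncard = 2 * k := by
    rw [ncard_image_of_injective _ h.injective, ncard_coe_finset, hA2]
  refine ⟨IsFlacet.isSplitFlacet ?_ (by omega) (by omega) (by omega) ?_, hrk⟩
  · refine isFlacet_of_exchanges (K := g '' K) (m := m)
      (image_mono (by exact_mod_cast hAK)) ?_ ?_ ?_ ?_ ?_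
    · rw [h.ground]; exact image_subset_range _ _
    · intro B hB
      obtain ⟨T, hT, rfl⟩ := h.exists_finset hB
      rw [h.ncard_inter]
      exact (hle T hT).2.1
    · intro z hz hzA
      rw [h.ground] at hz
      obtain ⟨z, rfl⟩ := hz
      obtain ⟨T, hT, hTA, hzT⟩ := hflat z (fun hz ↦ hzA ⟨z, hz, rfl⟩)
      exact ⟨_, htight T hT hTA, ⟨z, hzT, rfl⟩⟩
    · intro i hi j hj hij hijA hijK
      rw [h.ground] at hi hj
      obtain ⟨i, rfl⟩ := hi
      obtain ⟨j, rfl⟩ := hj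
      simp only [h.injective.mem_set_image, Finset.mem_coe] at hijA hijK
      obtain ⟨T, hT, hTA, hiT, hjT, hT'⟩ := hex i j (fun e ↦ hij (e ▸ rfl)) hijA hijK
      exact ⟨_, htight T hT hTA, h.exch hiT hjT hT'⟩
    · exact ⟨_, hbase _ hT₁, by rwa [h.ncard_inter, hrk]⟩
  · rw [hr, hrk, hcard, h.ncard_ground]
    omega

/-- Two split flacets whose hyperplanes both pass through the centre of the cube. -/
lemma Presents.not_isSplitMatroid [Fintype β] [DecidableEq β] (h : Presents M g 𝓑) {r : ℕ}
    {A₁ K₁ A₂ K₂ : Finset β} {k₁ m₁ k₂ m₂ : ℕ} (h₁ : IsCentralFlacet 𝓑 r A₁ K₁ k₁ m₁)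
    (h₂ : IsCentralFlacet 𝓑 r A₂ K₂ k₂ m₂) (hne : A₁ ≠ A₂) (hc : ∃ T ∈ 𝓑, Tᶜ ∈ 𝓑) :
    ¬ IsSplitMatroid M := by
  intro hM
  obtain ⟨T, hT, hT'⟩ := hc
  have hB := (h.isBase T).2 hT
  have hB' : M.IsBase (M.E \ g '' T) := by
    have := (h.isBase _).2 hT'
    rwa [Finset.coe_compl, image_compl_eq_range_sdiff_image h.injective, ← h.ground] at this
  have hmem : ∀ {A K : Finset β} {k m : ℕ}, IsCentralFlacet 𝓑 r A K k m →
      M.E.indicator (fun _ ↦ (1 / 2 : ℝ)) ∈ rankHyperplane M (g '' A) := by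
    intro A K k m hA
    rw [mem_rankHyperplane (A.finite_toSet.image g), (h.isSplitFlacet hA).2]
    rw [Finset.sum_congr rfl (g := fun _ ↦ (1 / 2 : ℝ)) (fun i hi ↦ ?_), Finset.sum_const,
      ← ncard_eq_toFinset_card _ (A.finite_toSet.image g), ncard_image_of_injective _ h.injective,
      ncard_coe_finset, hA.2.1]
    · simp only [nsmul_eq_mul]
      push_cast
      ring
    · rw [Finite.mem_toFinset] at hi
      rw [indicator_of_mem]
      rw [h.ground]
      exact image_subset_range _ _ hi
  exact hM _ _ (h.isSplitFlacet h₁).1 (h.isSplitFlacet h₂).1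
    (fun e ↦ hne (by exact_mod_cast h.injective.image_injective e)) _ ⟨hmem h₁, hmem h₂⟩
    (center_mem_relInterior hB hB')

/-! ### The excluded minors are not split -/

/-- The bases of `S₀`. -/
def basesS₀ : Finset (Finset (Fin 4 ⊕ Fin 4)) :=
  (Finset.powersetCard 4 Finset.univ).filter fun B ↦
    (B ∩ {.inl 0, .inl 1, .inl 2, .inl 3}).card = 2 ∧
    ¬ {.inl 2, .inl 3} ⊆ B ∧ ¬ {.inr 2, .inr 3} ⊆ B

/-- The bases of `S₁`. -/
def basesS₁ : Finset (Finset (Fin 6)) :=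
  (Finset.powersetCard 3 Finset.univ).filter fun B ↦ ¬ {0, 1} ⊆ B ∧ ¬ {4, 5} ⊆ B

/-- The bases of `S₂`. -/
def basesS₂ : Finset (Finset (Fin 6)) :=
  (Finset.powersetCard 3 Finset.univ).filter fun B ↦
    ¬ {2, 3} ⊆ B ∧ ¬ B ⊆ {2, 3, 0, 1} ∧ ¬ B ⊆ {2, 3, 4, 5}

/-- The bases of `S₃`. -/
def basesS₃ : Finset (Finset (Fin 6)) :=
  (Finset.powersetCard 3 Finset.univ).filter fun B ↦
    ¬ {4, 5} ⊆ B ∧ ¬ B ⊆ {0, 1, 4, 5} ∧ ¬ B ⊆ {0, 2, 3}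

/-- The bases of `S₄`. -/
def basesS₄ : Finset (Finset (Fin 6)) :=
  (Finset.powersetCard 3 Finset.univ).filter fun B ↦ ¬ {4, 5} ⊆ B ∧ ¬ B ⊆ {0, 1, 4, 5}

lemma isIsomorphic_S₁ : IsIsomorphic M S₁ ↔ ∃ g, Presents M g basesS₁ := isIsomorphic_ofBases_iff
lemma isIsomorphic_S₂ : IsIsomorphic M S₂ ↔ ∃ g, Presents M g basesS₂ := isIsomorphic_ofBases_iff
lemma isIsomorphic_S₃ : IsIsomorphic M S₃ ↔ ∃ g, Presents M g basesS₃ := isIsomorphic_ofBases_iff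
lemma isIsomorphic_S₄ : IsIsomorphic M S₄ ↔ ∃ g, Presents M g basesS₄ := isIsomorphic_ofBases_iff

/-- The bases of `MW₂`. -/
def basesMW₂ : Finset (Finset (Fin 4)) :=
  (Finset.powersetCard 2 Finset.univ).filter fun B ↦ ¬ {2, 3} ⊆ B

lemma mem_basesS₀_iff : ∀ T : Finset (Fin 4 ⊕ Fin 4),
    T ∈ basesS₀ ↔ T.toLeft ∈ basesMW₂ ∧ T.toRight ∈ basesMW₂ := by
  decide +kernel

lemma isBase_S₀_iff (T : Finset (Fin 4 ⊕ Fin 4)) :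
    S₀.IsBase (T : Set (Fin 4 ⊕ Fin 4)) ↔ T ∈ basesS₀ := by
  have h4 : ∀ A : Finset (Fin 4), MW₂.IsBase (A : Set (Fin 4)) ↔ A ∈ basesMW₂ := by
    intro A
    constructor
    · rintro ⟨A', hA', h⟩
      rwa [← Finset.coe_injective h]
    · exact fun h ↦ ⟨A, h, rfl⟩
  have hl : Sum.inl ⁻¹' (T : Set (Fin 4 ⊕ Fin 4)) = (T.toLeft : Set (Fin 4)) := by ext; simp
  have hr : Sum.inr ⁻¹' (T : Set (Fin 4 ⊕ Fin 4)) = (T.toRight : Set (Fin 4)) := by ext; simp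
  rw [S₀, Matroid.sum_isBase_iff, hl, hr, h4, h4, mem_basesS₀_iff]

lemma isIsomorphic_S₀ : IsIsomorphic M S₀ ↔ ∃ g, Presents M g basesS₀ := by
  rw [isIsomorphic_iff (by simp [S₀, MW₂, ofBases])]
  refine exists_congr fun g ↦ ⟨fun ⟨h1, h2, h3⟩ ↦ ⟨h1, h2, fun T ↦ ?_⟩,
    fun ⟨h1, h2, h3⟩ ↦ ⟨h1, h2, fun T ↦ ?_⟩⟩
  · rw [h3, isBase_S₀_iff]
  · have := h3 (Set.toFinite T).toFinset
    rw [← isBase_S₀_iff] at this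
    simpa using this

lemma not_isSplitMatroid_of_isIsomorphic (h : IsIsomorphic M S₀ ∨ IsIsomorphic M S₁ ∨
    IsIsomorphic M S₂ ∨ IsIsomorphic M S₃ ∨ IsIsomorphic M S₄) : ¬ IsSplitMatroid M := by
  rcases h with h | h | h | h | h
  · obtain ⟨g, h⟩ := isIsomorphic_S₀.1 h
    refine h.not_isSplitMatroid (r := 4) (A₁ := {.inl 2, .inl 3})
      (K₁ := {.inl 0, .inl 1, .inl 2, .inl 3})
      (k₁ := 1) (m₁ := 2) (A₂ := {.inr 2, .inr 3}) (K₂ := {.inr 0, .inr 1, .inr 2, .inr 3})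
      (k₂ := 1) (m₂ := 2) ?_ ?_ ?_ ?_
    all_goals decide +kernel
  · obtain ⟨g, h⟩ := isIsomorphic_S₁.1 h
    refine h.not_isSplitMatroid (r := 3) (A₁ := {0, 1}) (K₁ := Finset.univ)
      (k₁ := 1) (m₁ := 3) (A₂ := {4, 5}) (K₂ := Finset.univ) (k₂ := 1) (m₂ := 3) ?_ ?_ ?_ ?_
    all_goals decide +kernel
  · obtain ⟨g, h⟩ := isIsomorphic_S₂.1 h
    refine h.not_isSplitMatroid (r := 3) (A₁ := {0, 1, 2, 3}) (K₁ := Finset.univ)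
      (k₁ := 2) (m₁ := 3) (A₂ := {2, 3, 4, 5}) (K₂ := Finset.univ) (k₂ := 2) (m₂ := 3) ?_ ?_ ?_ ?_
    all_goals decide +kernel
  · obtain ⟨g, h⟩ := isIsomorphic_S₃.1 h
    refine h.not_isSplitMatroid (r := 3) (A₁ := {4, 5}) (K₁ := Finset.univ)
      (k₁ := 1) (m₁ := 3) (A₂ := {0, 1, 4, 5}) (K₂ := Finset.univ) (k₂ := 2) (m₂ := 3) ?_ ?_ ?_ ?_
    all_goals decide +kernel
  · obtain ⟨g, h⟩ := isIsomorphic_S₄.1 h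
    refine h.not_isSplitMatroid (r := 3) (A₁ := {4, 5}) (K₁ := Finset.univ)
      (k₁ := 1) (m₁ := 3) (A₂ := {0, 1, 4, 5}) (K₂ := Finset.univ) (k₂ := 2) (m₂ := 3) ?_ ?_ ?_ ?_
    all_goals decide +kernel

end Presentation

/-! ### Six-element minors -/

section SixElements

/-- Relabel the members of a family of subsets of a six-element set. -/
lemma bases_eq_of_forall {p : Finset (Fin 6) → Prop} (hcard : ∀ T, p T → T.card = 3)
    (𝓑 𝓝 : Finset (Finset (Fin 6))) (h : 𝓑 ∪ 𝓝 = Finset.powersetCard 3 Finset.univ)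
    (h𝓑 : ∀ T ∈ 𝓑, p T) (h𝓝 : ∀ T ∈ 𝓝, ¬ p T) (T : Finset (Fin 6)) : p T ↔ T ∈ 𝓑 := by
  refine ⟨fun hT ↦ ?_, h𝓑 T⟩
  have : T ∈ 𝓑 ∪ 𝓝 := by
    rw [h, Finset.mem_powersetCard]
    exact ⟨Finset.subset_univ _, hcard T hT⟩
  exact (Finset.mem_union.1 this).resolve_right fun h' ↦ h𝓝 T h' hT

/-- The rank-3 matroids on `{0, …, 5}` in which `{0, 2, 4}` is a base with fundamental graph
`0 - 1`, `2 - 3 - 4 - 5`, together with an edge from `0` to `3` or `5`: by base exchange, each of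
them is `S₁`, `S₃` or `S₄` up to a relabelling. -/
lemma six_element_classification {p : Finset (Fin 6) → Prop} (hcard : ∀ T, p T → T.card = 3)
    (hex : ∀ A B, p A → p B → ∀ a ∈ A \ B, ∃ b ∈ B \ A, p (insert b (A.erase a)))
    (h024 : p {0, 2, 4}) (h124 : p {1, 2, 4}) (h014 : ¬ p {0, 1, 4}) (h012 : ¬ p {0, 1, 2})
    (h034 : p {0, 3, 4}) (h023 : p {0, 2, 3}) (h025 : p {0, 2, 5}) (h045 : ¬ p {0, 4, 5})
    (h : p {2, 3, 4} ∨ p {2, 4, 5}) : ∃ τ : Equiv.Perm (Fin 6),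
      (∀ T : Finset (Fin 6), p (T.image τ) ↔ T ∈ basesS₁) ∨
      (∀ T : Finset (Fin 6), p (T.image τ) ↔ T ∈ basesS₃) ∨
      (∀ T : Finset (Fin 6), p (T.image τ) ↔ T ∈ basesS₄) := by
  have step : ∀ {A B : Finset (Fin 6)}, p A → p B → ∀ a C D, a ∈ A \ B →
      (∀ b ∈ B \ A, insert b (A.erase a) = C ∨ insert b (A.erase a) = D) → p C ∨ p D := by
    intro A B hA hB a C D ha hb
    obtain ⟨b, hb', h⟩ := hex A B hA hB a ha
    rcases hb b hb' with e | e
    · exact Or.inl (e ▸ h)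
    · exact Or.inr (e ▸ h)
  have h013 : ¬ p {0, 1, 3} := fun h' ↦
    (step h' h024 3 {0, 1, 2} {0, 1, 4} (by decide) (by decide)).elim h012 h014
  have h015 : ¬ p {0, 1, 5} := fun h' ↦
    (step h' h024 5 {0, 1, 2} {0, 1, 4} (by decide) (by decide)).elim h012 h014
  have h035 : p {0, 3, 5} :=
    (step h025 h034 2 {0, 3, 5} {0, 4, 5} (by decide) (by decide)).resolve_right h045
  have h123 : p {1, 2, 3} :=
    (step h124 h023 4 {1, 2, 3} {0, 1, 2} (by decide) (by decide)).resolve_right h012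
  have h134 : p {1, 3, 4} :=
    (step h124 h034 2 {1, 3, 4} {0, 1, 4} (by decide) (by decide)).resolve_right h014
  have h125 : p {1, 2, 5} :=
    (step h124 h025 4 {1, 2, 5} {0, 1, 2} (by decide) (by decide)).resolve_right h012
  have h135 : p {1, 3, 5} :=
    (step h125 h035 2 {1, 3, 5} {0, 1, 5} (by decide) (by decide)).resolve_right h015
  have h145 : ¬ p {1, 4, 5} := fun h' ↦
    (step h024 h' 2 {0, 1, 4} {0, 4, 5} (by decide) (by decide)).elim h014 h045
  by_cases h245 : p {2, 4, 5}
  · have h345 : p {3, 4, 5} :=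
      (step h245 h034 2 {3, 4, 5} {0, 4, 5} (by decide) (by decide)).resolve_right h045
    have h23 : p {2, 3, 4} ∨ p {2, 3, 5} :=
      step h023 h245 0 {2, 3, 4} {2, 3, 5} (by decide) (by decide)
    by_cases h234 : p {2, 3, 4}
    · by_cases h235 : p {2, 3, 5}
      · have := bases_eq_of_forall hcard
          {{0, 2, 3}, {0, 2, 4}, {0, 2, 5}, {0, 3, 4}, {0, 3, 5}, {1, 2, 3}, {1, 2, 4}, {1, 2, 5},
            {1, 3, 4}, {1, 3, 5}, {2, 3, 4}, {2, 3, 5}, {2, 4, 5}, {3, 4, 5}}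
          {{0, 1, 2}, {0, 1, 3}, {0, 1, 4}, {0, 1, 5}, {0, 4, 5}, {1, 4, 5}} (by decide +kernel)
          (by simp [*]) (by simp [*])
        refine ⟨⟨![4, 5, 2, 3, 0, 1], ![4, 5, 2, 3, 0, 1], by decide, by decide⟩,
          Or.inr (Or.inr fun T ↦ ?_)⟩
        rw [this]
        clear * -
        revert T
        decide +kernel
      · have := bases_eq_of_forall hcard
          {{0, 2, 3}, {0, 2, 4}, {0, 2, 5}, {0, 3, 4}, {0, 3, 5}, {1, 2, 3}, {1, 2, 4}, {1, 2, 5},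
            {1, 3, 4}, {1, 3, 5}, {2, 3, 4}, {2, 4, 5}, {3, 4, 5}}
          {{0, 1, 2}, {0, 1, 3}, {0, 1, 4}, {0, 1, 5}, {0, 4, 5}, {1, 4, 5}, {2, 3, 5}}
          (by decide +kernel) (by simp [*]) (by simp [*])
        refine ⟨⟨![5, 4, 2, 3, 0, 1], ![4, 5, 2, 3, 1, 0], by decide, by decide⟩,
          Or.inr (Or.inl fun T ↦ ?_)⟩
        rw [this]
        clear * -
        revert T
        decide +kernel
    · have h235 := h23.resolve_left h234
      have := bases_eq_of_forall hcard
          {{0, 2, 3}, {0, 2, 4}, {0, 2, 5}, {0, 3, 4}, {0, 3, 5}, {1, 2, 3}, {1, 2, 4}, {1, 2, 5},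
            {1, 3, 4}, {1, 3, 5}, {2, 3, 5}, {2, 4, 5}, {3, 4, 5}}
          {{0, 1, 2}, {0, 1, 3}, {0, 1, 4}, {0, 1, 5}, {0, 4, 5}, {1, 4, 5}, {2, 3, 4}}
          (by decide +kernel) (by simp [*]) (by simp [*])
      refine ⟨⟨![4, 5, 2, 3, 0, 1], ![4, 5, 2, 3, 0, 1], by decide, by decide⟩,
        Or.inr (Or.inl fun T ↦ ?_)⟩
      rw [this]
      clear * -
      revert T
      decide +kernel
  · have h234 := h.resolve_right h245
    have h345 : ¬ p {3, 4, 5} := fun h' ↦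
      (step h' h024 3 {0, 4, 5} {2, 4, 5} (by decide) (by decide)).elim h045 h245
    have h235 : p {2, 3, 5} :=
      (step h025 h234 0 {2, 3, 5} {2, 4, 5} (by decide) (by decide)).resolve_right h245
    have := bases_eq_of_forall hcard
      {{0, 2, 3}, {0, 2, 4}, {0, 2, 5}, {0, 3, 4}, {0, 3, 5}, {1, 2, 3}, {1, 2, 4}, {1, 2, 5},
        {1, 3, 4}, {1, 3, 5}, {2, 3, 4}, {2, 3, 5}}
      {{0, 1, 2}, {0, 1, 3}, {0, 1, 4}, {0, 1, 5}, {0, 4, 5}, {1, 4, 5}, {2, 4, 5}, {3, 4, 5}}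
      (by decide +kernel) (by simp [*]) (by simp [*])
    refine ⟨Equiv.refl _, Or.inl fun T ↦ ?_⟩
    rw [this]
    clear * -
    revert T
    decide +kernel

end SixElements

section Minors

open scoped Matroid

variable {α β : Type*} {M N : Matroid α} {B I J P Q : Set α} {g : β → α} {𝓑 : Finset (Finset β)}

/-- Contracting part of a base `B` and deleting part of its complement leaves the matroid whose
bases are read off from those of `M` that contain the contracted part. -/
lemma exists_isMinor_isBase_iff (hB : M.IsBase B) (hI : I ⊆ B) (hJ : J ⊆ M.E \ B) :
    ∃ N, N ≤m M ∧ N.E = I ∪ J ∧ ∀ T ⊆ I ∪ J, N.IsBase T ↔ M.IsBase (T ∪ (B \ I)) := by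
  have hC : M.Indep (B \ I) := hB.indep.subset sdiff_subset
  have hdisj : ∀ T ⊆ I ∪ J, Disjoint T (B \ I) := by
    intro T hT
    rw [disjoint_left]
    rintro x hx ⟨hxB, hxI⟩
    rcases hT hx with h | h
    · exact hxI h
    · exact (hJ h).2 hxB
  have hIJ : I ∪ J ⊆ M.E := union_subset (hI.trans hB.subset_ground) (hJ.trans sdiff_subset)
  have hco : (M ／ (B \ I)).Coindep ((M.E \ (B \ I)) \ (I ∪ J)) := by
    rw [Matroid.coindep_iff_exists (by rw [Matroid.contract_ground]; exact sdiff_subset)]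
    refine ⟨I, hC.contract_isBase_iff.2 ⟨?_, hdisj I subset_union_left⟩, ?_⟩
    · rwa [union_sdiff_cancel hI]
    · rw [Matroid.contract_ground]
      intro x hx
      exact ⟨⟨hIJ (Or.inl hx), fun h ↦ h.2 hx⟩, fun h ↦ h.2 (Or.inl hx)⟩
  refine ⟨M ／ (B \ I) ＼ ((M.E \ (B \ I)) \ (I ∪ J)), M.contract_delete_isMinor _ _, ?_, ?_⟩
  · rw [Matroid.delete_ground, Matroid.contract_ground, sdiff_sdiff_cancel_left]
    exact subset_sdiff.2 ⟨hIJ, hdisj _ Subset.rfl⟩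
  · intro T hT
    rw [hco.delete_isBase_iff, hC.contract_isBase_iff, and_iff_left (hdisj T hT), and_iff_left]
    exact disjoint_sdiff_right.mono_left hT

lemma Presents.comp_equiv [DecidableEq β] {γ : Type*} [DecidableEq γ] {𝓑 : Finset (Finset γ)}
    (hg : g.Injective) (hE : N.E = range g) (τ : γ ≃ β)
    (h : ∀ T : Finset γ, N.IsBase (g '' (T.image τ : Finset β)) ↔ T ∈ 𝓑) :
    Presents N (g ∘ τ) 𝓑 := by
  refine ⟨hg.comp τ.injective, by rw [hE, τ.surjective.range_comp], fun T ↦ ?_⟩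
  rw [← h, Finset.coe_image, image_comp]

lemma card_eq_of_isBase_image (hg : g.Injective) {T T' : Finset β} (h : N.IsBase (g '' T))
    (h' : N.IsBase (g '' T')) : T.card = T'.card := by
  have := h.encard_eq_encard_of_isBase h'
  rw [hg.encard_image, hg.encard_image, encard_coe_eq_coe_finsetCard,
    encard_coe_eq_coe_finsetCard] at this
  exact_mod_cast this

lemma exists_exchange_image [DecidableEq β] (hg : g.Injective) {A B : Finset β}
    (hA : N.IsBase (g '' A)) (hB : N.IsBase (g '' B)) {a : β} (ha : a ∈ A \ B) :
    ∃ b ∈ B \ A, N.IsBase (g '' (insert b (A.erase a) : Finset β)) := by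
  obtain ⟨_, ⟨⟨b, hb, rfl⟩, hbA⟩, h⟩ := hA.exchange hB (e := g a) (by
    rw [← image_sdiff hg]
    exact ⟨a, by simpa using ha, rfl⟩)
  refine ⟨b, ?_, ?_⟩
  · rw [Finset.mem_sdiff]
    exact ⟨hb, fun h ↦ hbA ⟨b, h, rfl⟩⟩
  · rwa [Finset.coe_insert, Finset.coe_erase, image_insert_eq, image_sdiff hg, image_singleton]

/-- The minor on the enumerated elements `g '' univ` that is obtained by contracting the other
elements of a base `B` and deleting the other elements outside `B`; the part of the fundamental
graph of `B` on these elements is the fundamental graph of the base `g '' T₀` of the minor. -/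
lemma exists_isMinor_enum [DecidableEq β] (hB : M.IsBase B) (hg : g.Injective) (T₀ : Finset β)
    (h₀ : ∀ i ∈ T₀, g i ∈ B) (h₁ : ∀ j ∉ T₀, g j ∈ M.E \ B) :
    ∃ N, N ≤m M ∧ N.E = range g ∧
      (∀ T : Finset β, N.IsBase (g '' T) ↔ M.IsBase (g '' T ∪ (B \ g '' T₀))) ∧
      N.IsBase (g '' T₀) ∧ ∀ i ∈ T₀, ∀ j ∉ T₀, ∀ T, T = insert j (T₀.erase i) →
        (N.IsBase (g '' T) ↔ Exch M B (g i) (g j)) := by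
  have hsub : g '' T₀ ⊆ B := by
    rintro _ ⟨i, hi, rfl⟩
    exact h₀ i hi
  have hE : g '' T₀ ∪ g '' (T₀ : Set β)ᶜ = range g := by
    rw [← image_union, union_compl_self, image_univ]
  obtain ⟨N, hN, hNE, hNB⟩ := exists_isMinor_isBase_iff (I := g '' T₀) (J := g '' (T₀ : Set β)ᶜ) hB
    hsub (by rintro _ ⟨j, hj, rfl⟩; exact h₁ j hj)
  rw [hE] at hNE hNB
  have hNB' := fun T : Finset β ↦ hNB (g '' T) (image_subset_range _ _)
  refine ⟨N, hN, hNE, hNB', ?_, ?_⟩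
  · rw [hNB', union_sdiff_cancel hsub]
    exact hB
  · rintro i hi j hj _ rfl
    have : g '' (insert j (T₀.erase i) : Finset β) ∪ (B \ g '' T₀) = insert (g j) (B \ {g i}) := by
      rw [Finset.coe_insert, Finset.coe_erase, image_insert_eq, image_sdiff hg, image_singleton,
        insert_union]
      congr 1
      ext x
      simp only [mem_union, mem_sdiff, mem_singleton_iff]
      constructor
      · rintro (⟨hx, hxi⟩ | ⟨hx, hx'⟩)
        · exact ⟨hsub hx, hxi⟩
        · exact ⟨hx, fun h ↦ hx' (h ▸ mem_image_of_mem g hi)⟩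
      · rintro ⟨hx, hxi⟩
        by_cases h : x ∈ g '' T₀
        · exact Or.inl ⟨h, hxi⟩
        · exact Or.inr ⟨hx, h⟩
    rw [hNB', this]
    exact ⟨fun h ↦ ⟨h₀ i hi, (h₁ j hj).2, h⟩, fun h ↦ h.2.2⟩

/-- The pattern in the fundamental graph of a base that produces one of `S₁`, `S₃`, `S₄`. -/
lemma exists_isMinor_of_fundamental_graph (hB : M.IsBase B) {e f a₀ a₁ a₂ a₃ : α}
    (hef : Exch M B e f) (h0f : ¬ Exch M B a₀ f) (h2f : ¬ Exch M B a₂ f) (he0 : e ≠ a₀)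
    (he2 : e ≠ a₂) (hf1 : f ≠ a₁) (hf3 : f ≠ a₃)
    (h01 : Exch M B a₀ a₁) (h21 : Exch M B a₂ a₁) (h23 : Exch M B a₂ a₃)
    (h03 : ¬ Exch M B a₀ a₃) (h : Exch M B e a₁ ∨ Exch M B e a₃) :
    ∃ N, N ≤m M ∧ ∃ g : Fin 6 → α, Presents N g basesS₁ ∨ Presents N g basesS₃ ∨
      Presents N g basesS₄ := by
  have h02 : a₀ ≠ a₂ := fun e ↦ h03 (e ▸ h23)
  have h13 : a₁ ≠ a₃ := fun e ↦ h03 (e ▸ h01)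
  have hBf : ∀ x ∈ B, ∀ y ∉ B, x ≠ y := fun x hx y hy e ↦ hy (e ▸ hx)
  let g : Fin 6 → α := ![e, f, a₀, a₁, a₂, a₃]
  have hg : g.Injective := by
    have c1 := hBf e hef.1
    have c2 := hBf a₀ h01.1
    have c3 := hBf a₂ h21.1
    have d1 := hef.2.1
    have d2 := h01.2.1
    have d3 := h23.2.1
    intro i j hij
    fin_cases i <;> fin_cases j <;> first | rfl | (exfalso; simp [g] at hij; grind)
  obtain ⟨N, hN, hE, -, hI0, hexch⟩ := exists_isMinor_enum hB hg {0, 2, 4}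
    (by
      intro i hi
      fin_cases i <;> simp [g] at hi ⊢
      exacts [hef.1, h01.1, h21.1])
    (by
      intro i hi
      fin_cases i <;> simp [g] at hi ⊢
      exacts [⟨hef.mem_ground, hef.2.1⟩, ⟨h01.mem_ground, h01.2.1⟩, ⟨h23.mem_ground, h23.2.1⟩])
  refine ⟨N, hN, ?_⟩
  obtain ⟨τ, hτ⟩ := six_element_classification (p := fun T ↦ N.IsBase (g '' T))
    (fun T hT ↦ card_eq_of_isBase_image hg hT hI0)
    (fun A B hA hB a ha ↦ exists_exchange_image hg hA hB ha) hI0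
    ((hexch 0 (by decide) 1 (by decide) _ (by decide)).2 hef)
    (fun h' ↦ h0f ((hexch 2 (by decide) 1 (by decide) _ (by decide)).1 h'))
    (fun h' ↦ h2f ((hexch 4 (by decide) 1 (by decide) _ (by decide)).1 h'))
    ((hexch 2 (by decide) 3 (by decide) _ (by decide)).2 h01)
    ((hexch 4 (by decide) 3 (by decide) _ (by decide)).2 h21)
    ((hexch 4 (by decide) 5 (by decide) _ (by decide)).2 h23)
    (fun h' ↦ h03 ((hexch 2 (by decide) 5 (by decide) _ (by decide)).1 h'))
    (h.imp (hexch 0 (by decide) 3 (by decide) _ (by decide)).2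
      (hexch 0 (by decide) 5 (by decide) _ (by decide)).2)
  exact ⟨g ∘ τ, hτ.imp (Presents.comp_equiv hg hE τ)
    (Or.imp (Presents.comp_equiv hg hE τ) (Presents.comp_equiv hg hE τ))⟩

/-! ### Induced paths in fundamental graphs -/

/-- In a connected bipartite graph, a vertex `v` that is not joined to the whole other side is the
end of an induced path with four vertices. -/
lemma exists_induced_path {R : α → α → Prop} (hPQ : Disjoint P Q)
    (hc : ∀ A ⊆ P ∪ Q, A.Nonempty → A ≠ P ∪ Q → ∃ x ∈ P, ∃ y ∈ Q, R x y ∧ ¬ (x ∈ A ↔ y ∈ A))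
    {u v : α} (hu : u ∈ P) (hv : v ∈ Q) (huv : ¬ R u v) :
    ∃ a₀ ∈ P, ∃ a₁ ∈ Q, ∃ a₂ ∈ P, R a₀ a₁ ∧ R a₂ a₁ ∧ R a₂ v ∧ ¬ R a₀ v := by
  have hPQ' : ∀ x ∈ P, x ∉ Q := fun x hx hx' ↦ disjoint_left.1 hPQ hx hx'
  -- `A` consists of the vertices at distance at most two from `v`
  let A : Set α := {x | x ∈ P ∧ R x v} ∪ {y | y ∈ Q ∧ (y = v ∨ ∃ x ∈ P, R x v ∧ R x y)}
  obtain ⟨x, hx, y, hy, hxy, hA⟩ := hc A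
    (union_subset (fun x hx ↦ Or.inl hx.1) (fun x hx ↦ Or.inr hx.1))
    ⟨v, Or.inr ⟨hv, Or.inl rfl⟩⟩ (by
      intro h
      rcases h.symm.subset (Or.inl hu) with h' | h'
      · exact huv h'.2
      · exact hPQ' u hu h'.1)
  have hxA : x ∈ A ↔ R x v :=
    ⟨fun h ↦ h.elim (fun h ↦ h.2) (fun h ↦ absurd h.1 (hPQ' x hx)), fun h ↦ Or.inl ⟨hx, h⟩⟩
  have hyA : y ∈ A ↔ (y = v ∨ ∃ x ∈ P, R x v ∧ R x y) :=
    ⟨fun h ↦ h.elim (fun h ↦ absurd hy (hPQ' y h.1)) (fun h ↦ h.2), fun h ↦ Or.inr ⟨hy, h⟩⟩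
  rw [hxA, hyA] at hA
  by_cases hxv : R x v
  · exact absurd (iff_of_true hxv (Or.inr ⟨x, hx, hxv, hxy⟩)) hA
  · obtain rfl | ⟨z, hz, hzv, hzy⟩ : y = v ∨ ∃ x ∈ P, R x v ∧ R x y := by
      by_contra h
      exact hA (iff_of_false hxv h)
    · exact absurd hxy hxv
    · exact ⟨x, hx, y, hy, z, hz, hxy, hzy, hzv, hxv⟩

/-- In a connected bipartite graph that is not complete bipartite, every vertex `b` lies on an
induced path with four vertices. -/
lemma exists_induced_path_through {R : α → α → Prop} (hPQ : Disjoint P Q)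
    (hc : ∀ A ⊆ P ∪ Q, A.Nonempty → A ≠ P ∪ Q → ∃ x ∈ P, ∃ y ∈ Q, R x y ∧ ¬ (x ∈ A ↔ y ∈ A))
    {u v b : α} (hu : u ∈ P) (hv : v ∈ Q) (huv : ¬ R u v) (hb : b ∈ Q) :
    ∃ a₀ ∈ P, ∃ a₁ ∈ Q, ∃ a₂ ∈ P, ∃ a₃ ∈ Q, R a₀ a₁ ∧ R a₂ a₁ ∧ R a₂ a₃ ∧ ¬ R a₀ a₃ ∧
      (a₁ = b ∨ a₃ = b) := by
  by_cases h : ∃ w ∈ P, ¬ R w b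
  · obtain ⟨w, hw, hwb⟩ := h
    obtain ⟨a₀, h0, a₁, h1, a₂, h2, p⟩ := exists_induced_path hPQ hc hw hb hwb
    exact ⟨a₀, h0, a₁, h1, a₂, h2, b, hb, p.1, p.2.1, p.2.2.1, p.2.2.2, Or.inr rfl⟩
  · push Not at h
    obtain ⟨a₀, h0, a₁, h1, a₂, h2, p⟩ := exists_induced_path hPQ hc hu hv huv
    exact ⟨a₀, h0, b, hb, a₂, h2, v, hv, h _ h0, h _ h2, p.2.2.1, p.2.2.2, Or.inl rfl⟩

/-- An edge `e - f` and a connected, not complete bipartite part `P ∪ Q` of a fundamental graph,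
such that `e` has a neighbour in `Q` and `f` has none in `P`. -/
lemma exists_isMinor_of_exch (hB : M.IsBase B) (hP : P ⊆ B) (hQ : Disjoint Q B)
    (hc : ∀ A ⊆ P ∪ Q, A.Nonempty → A ≠ P ∪ Q →
      ∃ x ∈ P, ∃ y ∈ Q, Exch M B x y ∧ ¬ (x ∈ A ↔ y ∈ A))
    {u v : α} (hu : u ∈ P) (hv : v ∈ Q) (huv : ¬ Exch M B u v) {e f b : α} (hef : Exch M B e f)
    (he : e ∉ P) (hf : f ∉ Q) (hfP : ∀ x ∈ P, ¬ Exch M B x f) (hb : b ∈ Q) (heb : Exch M B e b) :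
    ∃ N, N ≤m M ∧ ∃ g : Fin 6 → α, Presents N g basesS₁ ∨ Presents N g basesS₃ ∨
      Presents N g basesS₄ := by
  obtain ⟨a₀, h0, a₁, h1, a₂, h2, a₃, h3, h01, h21, h23, h03, h⟩ :=
    exists_induced_path_through (hQ.symm.mono_left hP) hc hu hv huv hb
  refine exists_isMinor_of_fundamental_graph hB hef (hfP _ h0) (hfP _ h2) ?_ ?_ ?_ ?_ h01 h21 h23
    h03
    (by
      rcases h with h | h
      · left; rw [h]; exact heb
      · right; rw [h]; exact heb)
  · exact fun h ↦ he (h ▸ h0)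
  · exact fun h ↦ he (h ▸ h2)
  · exact fun h ↦ hf (h ▸ h1)
  · exact fun h ↦ hf (h ▸ h3)

end Minors

/-! ### Uniform minors -/

section Uniform

variable {α : Type*} {M : Matroid α} {A B G G₁ G₂ K S X Y Z : Set α}

/-- The minor obtained by contracting `Z` and restricting to `S` is uniform: every subset of `S` is
independent or spanning in it. -/
def UniformOn (M : Matroid α) (Z S : Set α) : Prop :=
  ∀ A ⊆ S, rk M Z + A.ncard ≤ rk M (Z ∪ A) ∨ rk M (Z ∪ S) ≤ rk M (Z ∪ A)

variable [M.Finite]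

/-- The fundamental graph of a suitable base of a minor that is not uniform is not complete
bipartite. -/
lemma exists_not_exch_of_not_uniformOn (h : ¬ UniformOn M Z S) (hZS : Disjoint Z S)
    (hZ : Z ⊆ M.E) (hS : S ⊆ M.E) :
    ∃ B, M.IsBase B ∧ (B ∩ Z).ncard = rk M Z ∧ (B ∩ (Z ∪ S)).ncard = rk M (Z ∪ S) ∧
      ∃ u ∈ B ∩ S, ∃ v ∈ S \ B, ¬ Exch M B u v := by
  simp only [UniformOn, not_forall, not_or, not_le] at h
  obtain ⟨A, hA, h1, h2⟩ := h
  obtain ⟨B, hB, hBZ, hBA, hBS⟩ :=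
    exists_base_rk_rk_rk (M := M) (subset_union_left (s := Z) (t := A))
    (union_subset_union_right Z hA)
  have hcard : ∀ T ⊆ S, (B ∩ (Z ∪ T)).ncard = (B ∩ Z).ncard + (B ∩ T).ncard := by
    intro T hT
    rw [inter_union_distrib_left, ncard_union_eq _ (hB.finite.inter_of_left _)
      (hB.finite.inter_of_left _)]
    exact (hZS.mono_right hT).mono inter_subset_right inter_subset_right
  have hcA := hcard A hA
  have hcS := hcard S Subset.rfl
  obtain ⟨v, hvA, hvB⟩ : ∃ v ∈ A, v ∉ B := by
    by_contra! hall
    rw [inter_eq_right.2 hall] at hcA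
    omega
  obtain ⟨u, ⟨huB, huS⟩, huA⟩ : ∃ u ∈ B ∩ S, u ∉ A := by
    by_contra! hall
    have := ncard_le_ncard (show B ∩ S ⊆ B ∩ A from fun u hu ↦ ⟨hu.1, hall u hu⟩)
      (hB.finite.inter_of_left A)
    omega
  refine ⟨B, hB, hBZ, hBS, u, ⟨huB, huS⟩, v, ⟨hA hvA, hvB⟩, fun hex ↦ ?_⟩
  rcases (hex.mem_of_mem_closure inter_subset_left (subset_closure_of_rk hB
    (union_subset hZ (hA.trans hS)) hBA (Or.inr hvA))).2 with hu | hu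
  · exact disjoint_left.1 hZS hu huS
  · exact huA hu

end Uniform

/-! ### Flacets inside a component -/

section Piece

variable {α : Type*} {M : Matroid α} {A B F G G₁ G₂ K K₁ K₂ : Set α} {x : α → ℝ}

/-- `K` is a connected component of `M`, `G` is a proper nonempty flat of the restriction `M | K`,
and both the restriction of `M` to `G` and the contraction `(M | K) / G` are connected. -/
structure IsConnectedFlat (M : Matroid α) (K G : Set α) : Prop where
  subset_ground : K ⊆ M.E
  isSeparator : IsSeparator M K
  connectedOn : ConnectedOn M ∅ K
  subset : G ⊆ K
  nonempty : G.Nonempty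
  ne : G ≠ K
  closure_inter : M.closure G ∩ K = G
  connectedOn_flat : ConnectedOn M ∅ G
  connectedOn_contract : ConnectedOn M G (K \ G)

variable [M.Finite]

/-- In a connected matroid, every proper nonempty set meets some base in fewer elements than its
rank. -/
lemma ConnectedOn.exists_base_not_tight (hc : ConnectedOn M ∅ K) (hK : K ⊆ M.E) (hA : A ⊆ K)
    (hne : A.Nonempty) (hAK : A ≠ K) : ∃ B, M.IsBase B ∧ (B ∩ A).ncard ≠ rk M A := by
  by_contra! hcon
  have hsep := isSeparator_of_ncard hcon
  have h := hsep.rk_eq_add (hA.trans hK) K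
  have := hc A hA hne hAK
  rw [inter_eq_right.2 hA] at h
  simp only [empty_union, rk_empty] at this
  omega

/-- A flacet is spanned by a connected flat of one of the components; the rest of the flacet meets
all bases in the same number of elements. -/
lemma IsFlacet.exists_isConnectedFlat (hF : IsFlacet M F) :
    ∃ K G, IsConnectedFlat M K G ∧ F = M.closure G ∧ rk M F = rk M G + rk M (F \ G) ∧
      ∀ B, M.IsBase B → (B ∩ (F \ G)).ncard = rk M (F \ G) := by
  obtain ⟨⟨B₀, hB₀, hB₀F⟩, hmax, hmin⟩ := hF.combinatorial
  have hFE := hF.1.subset_ground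
  -- a minimal separator in which `F` is not tight is a connected component
  obtain ⟨K, ⟨hKE, hKs, B₁, hB₁, hB₁K⟩, hKmin⟩ : ∃ K, (K ⊆ M.E ∧ IsSeparator M K ∧
      ∃ B, M.IsBase B ∧ (B ∩ (F ∩ K)).ncard ≠ rk M (F ∩ K)) ∧
      ∀ K', (K' ⊆ M.E ∧ IsSeparator M K' ∧
        ∃ B, M.IsBase B ∧ (B ∩ (F ∩ K')).ncard ≠ rk M (F ∩ K')) → K' ⊆ K → K' = K := by
    have hfin : {K | K ⊆ M.E ∧ IsSeparator M K ∧
        ∃ B, M.IsBase B ∧ (B ∩ (F ∩ K)).ncard ≠ rk M (F ∩ K)}.Finite :=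
      M.ground_finite.finite_subsets.subset fun K hK ↦ hK.1
    obtain ⟨K, hK⟩ := hfin.exists_minimal ⟨M.E, Subset.rfl,
      fun B hB x y hxy ↦ by simp [hB.subset_ground hxy.1, hxy.mem_ground], B₀, hB₀,
      by rwa [inter_eq_left.2 hFE]⟩
    exact ⟨K, hK.prop, fun K' hK' h ↦ hK.eq_of_subset hK' h⟩
  have hcount : ∀ B, M.IsBase B → ∀ A X : Set α, (B ∩ X).ncard = (B ∩ (X ∩ A)).ncard +
      (B ∩ (X \ A)).ncard := by
    intro B hB A X
    rw [← inter_assoc, ← inter_sdiff_assoc,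
      ncard_inter_add_ncard_sdiff_eq_ncard _ _ (hB.finite.inter_of_left X)]
  have hconn : ConnectedOn M ∅ K := by
    intro A hA hne hAK hrk
    simp only [empty_union, rk_empty, add_zero] at hrk
    have hsep : IsSeparator M A := by
      apply isSeparator_of_rk
      have h1 := hKs.rk_eq_add hKE M.E
      have h2 := hKs.rk_eq_add hKE (M.E \ A)
      rw [inter_eq_right.2 hKE] at h1
      have e1 : (M.E \ A) ∩ K = K \ A := by
        rw [inter_comm, ← inter_sdiff_assoc, inter_eq_left.2 hKE]
      have e2 : (M.E \ A) \ K = M.E \ K := by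
        rw [Set.sdiff_sdiff, union_eq_right.2 hA]
      rw [e1, e2] at h2
      omega
    have hsep' : IsSeparator M (K \ A) := fun B hB x y hxy ↦ by
      simp [hKs hB x y hxy, hsep hB x y hxy]
    have ht : ∀ K' ⊆ K, K' ≠ K → IsSeparator M K' →
        ∀ B, M.IsBase B → (B ∩ (F ∩ K')).ncard = rk M (F ∩ K') := by
      intro K' h1 h2 h3
      by_contra! hcon
      exact h2 (hKmin K' ⟨h1.trans hKE, h3, hcon⟩ h1)
    have h1 := ht A hA hAK hsep B₁ hB₁
    have h2 := ht (K \ A) sdiff_subset (by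
      intro e
      obtain ⟨a, ha⟩ := hne
      exact (e.symm.subset (hA ha)).2 ha) hsep' B₁ hB₁
    have h3 := hsep.rk_eq_add (hA.trans hKE) (F ∩ K)
    have h4 := hcount B₁ hB₁ A (F ∩ K)
    have e1 : F ∩ K ∩ A = F ∩ A := by rw [inter_assoc, inter_eq_right.2 hA]
    have e2 : (F ∩ K) \ A = F ∩ (K \ A) := inter_sdiff_assoc _ _ _
    rw [e1, e2] at h3 h4
    omega
  have htK := fun B (hB : M.IsBase B) ↦ hKs.ncard_inter hKE hB
  have hnt := fun A hA hne hAK ↦ hconn.exists_base_not_tight (A := A) hKE hA hne hAK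
  have hrkF := hKs.rk_eq_add hKE F
  set G := F ∩ K with hG
  have hGK : G ⊆ K := inter_subset_right
  have hGF : G ⊆ F := inter_subset_left
  have hGE : G ⊆ M.E := hGK.trans hKE
  have hGne : G.Nonempty := by
    by_contra! h
    rw [h] at hB₁K
    simp at hB₁K
  have hGneK : G ≠ K := fun e ↦ hB₁K (e ▸ htK B₁ hB₁)
  have hFG : F \ G = F \ K := by rw [hG, sdiff_self_inter]
  have hsub : tightBases M F ⊆ tightBases M G := by
    rintro B ⟨hB, hBF⟩
    have := hcount B hB K F
    rw [← hG] at this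
    have h1 := base_inter_ncard_le hB G
    have h2 := base_inter_ncard_le hB (F \ K)
    exact ⟨hB, by omega⟩
  have hGF' := hmax G hGE hsub ⟨B₁, hB₁, hB₁K⟩
  have hclF : M.closure G ⊆ F := by
    rw [← hF.1.closure]
    exact M.closure_subset_closure hGF
  -- by minimality, `F` is spanned by any part of `G` whose hyperplane contains the facet
  have hclA : ∀ A ⊆ G, A.Nonempty → tightBases M G ⊆ tightBases M A → F = M.closure A := by
    intro A hA hAne hAt
    have hAcl := M.subset_closure A (hA.trans hGE)
    have hAF : M.closure A ⊆ F := (M.closure_subset_closure hA).trans hclF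
    have hAK : M.closure A ∩ K ⊆ G := fun z hz ↦ ⟨hAF hz.1, hz.2⟩
    refine (hmin _ (M.isFlat_closure A) (hmax _ (M.closure_subset_ground A) ?_ ?_) hAF).symm
    · rw [← hGF']
      refine hAt.trans ?_
      rintro B ⟨hB, hBA⟩
      refine ⟨hB, le_antisymm (base_inter_ncard_le hB _) ?_⟩
      rw [rk_closure, ← hBA]
      exact ncard_le_ncard (inter_subset_inter_right B hAcl) (hB.finite.inter_of_left _)
    · obtain ⟨B, hB, hBn⟩ := hnt (M.closure A ∩ K) inter_subset_right
        (hAne.mono fun a ha ↦ ⟨hAcl ha, hGK (hA ha)⟩)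
        (fun e ↦ hGneK (Subset.antisymm hGK (e ▸ hAK)))
      refine ⟨B, hB, fun h ↦ hBn ?_⟩
      have h1 := hcount B hB K (M.closure A)
      have h2 := base_inter_ncard_le hB (M.closure A ∩ K)
      have h3 := base_inter_ncard_le hB (M.closure A \ K)
      have h4 := hKs.rk_eq_add hKE (M.closure A)
      omega
  have hcl := hclA G Subset.rfl hGne Subset.rfl
  refine ⟨K, G, ⟨hKE, hKs, hconn, hGK, hGne, hGneK, by rw [← hcl], ?_, ?_⟩, hcl, hFG ▸ hrkF, ?_⟩
  · intro A hA hne hAG hrk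
    simp only [empty_union, rk_empty, add_zero] at hrk
    have hsplit : ∀ B ∈ tightBases M G, B ∈ tightBases M A ∧ B ∈ tightBases M (G \ A) := by
      rintro B ⟨hB, hBG⟩
      have h1 := hcount B hB A G
      rw [inter_eq_right.2 hA] at h1
      have h2 := base_inter_ncard_le hB A
      have h3 := base_inter_ncard_le hB (G \ A)
      exact ⟨⟨hB, by omega⟩, ⟨hB, by omega⟩⟩
    have h1 := hclA A hA hne fun B hB ↦ (hsplit B hB).1
    have h2 := hclA (G \ A) sdiff_subset
      (sdiff_nonempty.2 fun h ↦ hAG (Subset.antisymm hA h)) fun B hB ↦ (hsplit B hB).2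
    have h3 : rk M F = rk M A := by rw [h1, rk_closure]
    have h4 : rk M F = rk M (G \ A) := by rw [h2, rk_closure]
    have h5 : rk M F = rk M G := by
      conv_lhs => rw [hcl]
      rw [rk_closure]
    have h6 := base_inter_ncard_le hB₁ G
    omega
  · intro A hA hne hAG hrk
    rw [union_sdiff_cancel hGK] at hrk
    have hAK : A ⊆ K := hA.trans sdiff_subset
    -- the hyperplane of `G ∪ C` defines the same facet, so a base that is tight on `G ∪ C` is tight
    -- on `G` as well
    have hadd : ∀ C ⊆ K \ G, C ≠ K \ G → tightBases M G ⊆ tightBases M (G ∪ C) →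
        rk M G + rk M C ≤ rk M (G ∪ C) := by
      intro C hC hCne hCt
      have hCK : C ⊆ K := hC.trans sdiff_subset
      have hGC : Disjoint G C := disjoint_sdiff_right.mono_right hC
      obtain ⟨B, hB, hBC, hBGC⟩ := exists_base_rk_rk (M := M) (subset_union_right (s := G) (t := C))
      have heq : tightBases M (G ∪ C) = tightBases M F := by
        refine hmax _ (union_subset hGE (hCK.trans hKE)) (hGF' ▸ hCt) ?_
        refine hnt _ (union_subset hGK hCK) (hGne.mono subset_union_left) fun e ↦ hCne ?_
        rw [← e, union_sdiff_left, sdiff_eq_left.2 hGC.symm]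
      have hBG : B ∈ tightBases M G := by
        rw [hGF', ← heq]
        exact ⟨hB, hBGC⟩
      rw [← hBG.2, ← hBC, ← hBGC, inter_union_distrib_left, ncard_union_eq
        (hGC.mono inter_subset_right inter_subset_right) (hB.finite.inter_of_left _)
        (hB.finite.inter_of_left _)]
    have hsplit : ∀ B ∈ tightBases M G, B ∈ tightBases M (G ∪ A) ∧
        B ∈ tightBases M (G ∪ (K \ G) \ A) := by
      rintro B ⟨hB, hBG⟩
      have h1 := hcount B hB (G ∪ A) K
      rw [inter_eq_right.2 (union_subset hGK hAK)] at h1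
      have h4 := hcount B hB G (G ∪ (K \ G) \ A)
      have e1 : (G ∪ (K \ G) \ A) ∩ G = G := by rw [inter_eq_right]; exact subset_union_left
      have e2 : (G ∪ (K \ G) \ A) \ G = K \ (G ∪ A) := by
        rw [union_sdiff_left, Set.sdiff_sdiff, Set.sdiff_sdiff]
        congr 1
        ext; simp; tauto
      rw [e1, e2] at h4
      have h2 := base_inter_ncard_le hB (G ∪ A)
      have h3 := base_inter_ncard_le hB (G ∪ (K \ G) \ A)
      have h5 := htK B hB
      exact ⟨⟨hB, by omega⟩, ⟨hB, by omega⟩⟩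
    have hne' : ((K \ G) \ A).Nonempty := sdiff_nonempty.2 fun h ↦ hAG (Subset.antisymm hA h)
    have h1 := hadd A hA hAG fun B hB ↦ (hsplit B hB).1
    have h2 := hadd ((K \ G) \ A) sdiff_subset (by
      intro e
      obtain ⟨a, ha⟩ := hne
      exact (e.symm.subset (hA ha)).2 ha) fun B hB ↦ (hsplit B hB).2
    have h3 := hconn G hGK hGne hGneK
    simp only [empty_union, rk_empty, add_zero] at h3
    have h4 := rk_union_le (M := M) A ((K \ G) \ A)
    have h5 := rk_union_le (M := M) G (K \ G)
    rw [union_sdiff_cancel hA] at h4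
    rw [union_sdiff_cancel hGK] at h5
    omega
  · intro B hB
    rw [hFG]
    -- otherwise a base that is tight on `G` could be modified outside `K`
    obtain ⟨B', hB', hB'G⟩ := exists_base_rk M G
    have hmix := hKs.isBase_mix hKE hB' hB
    have h1 : (B' ∩ K ∪ B \ K) ∈ tightBases M F := by
      rw [← hGF']
      refine ⟨hmix, ?_⟩
      rw [← hB'G]
      congr 1
      ext z
      constructor
      · rintro ⟨h | h, hz⟩
        · exact ⟨h.1, hz⟩
        · exact absurd hz.2 h.2
      · rintro ⟨h, hz⟩
        exact ⟨Or.inl ⟨h, hz.2⟩, hz⟩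
    have h2 := hcount _ hmix K F
    have h3 := base_inter_ncard_le hmix G
    have h4 := base_inter_ncard_le hmix (F \ K)
    have h5 := h1.2
    have e : (B' ∩ K ∪ B \ K) ∩ (F \ K) = B ∩ (F \ K) := by
      ext z
      simp only [mem_inter_iff, mem_union, mem_sdiff]
      tauto
    rw [e, ← hG] at h2
    rw [e] at h4
    omega

end Piece

/-! ### Two connected flats in the same component -/

section SameComponent

open scoped Matroid

variable {α : Type*} {M : Matroid α} [M.Finite] {A B F G G₁ G₂ K : Set α} {x : α → ℝ}

lemma finsum_mem_pos (hA : A.Finite) (hne : A.Nonempty) (hx : ∀ i ∈ A, 0 < x i ∧ x i < 1) :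
    0 < ∑ᶠ i ∈ A, x i := by
  rw [finsum_mem_eq_finite_toFinset_sum _ hA]
  exact Finset.sum_pos (fun i hi ↦ (hx i (hA.mem_toFinset.1 hi)).1) (by simpa using hne)

lemma finsum_mem_lt_ncard (hA : A.Finite) (hne : A.Nonempty) (hx : ∀ i ∈ A, 0 < x i ∧ x i < 1) :
    ∑ᶠ i ∈ A, x i < A.ncard := by
  rw [finsum_mem_eq_finite_toFinset_sum _ hA, ncard_eq_toFinset_card A hA, ← nsmul_one,
    ← Finset.sum_const]
  exact Finset.sum_lt_sum_of_nonempty (by simpa using hne)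
    fun i hi ↦ (hx i (hA.mem_toFinset.1 hi)).2

lemma finsum_mem_le_ncard (hA : A.Finite) (hx : ∀ i ∈ A, 0 < x i ∧ x i < 1) :
    ∑ᶠ i ∈ A, x i ≤ A.ncard := by
  rcases A.eq_empty_or_nonempty with rfl | hne
  · simp
  · exact (finsum_mem_lt_ncard hA hne hx).le

lemma finsum_mem_nonneg_of_pos (hA : A.Finite) (hx : ∀ i ∈ A, 0 < x i ∧ x i < 1) :
    0 ≤ ∑ᶠ i ∈ A, x i := by
  rcases A.eq_empty_or_nonempty with rfl | hne
  · simp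
  · exact (finsum_mem_pos hA hne hx).le

lemma finsum_mem_eq_add (hB : B.Finite) (h : A ⊆ B) :
    ∑ᶠ i ∈ B, x i = ∑ᶠ i ∈ A, x i + ∑ᶠ i ∈ B \ A, x i := by
  rw [← finsum_mem_union disjoint_sdiff_right (hB.subset h) hB.sdiff, union_sdiff_cancel h]

omit [M.Finite] in
lemma finsum_mem_of_mem_rankHyperplane (h : x ∈ rankHyperplane M A) :
    ∑ᶠ i ∈ A, x i = rk M A := h

omit [M.Finite] in
/-- Fundamental graphs of dual bases agree, with the two sides interchanged. -/
lemma exch_dual_iff (hB : M.IsBase B) {u v : α} :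
    Exch M✶ (M.E \ B) u v ↔ Exch M B v u := by
  constructor
  · rintro ⟨⟨hu, huB⟩, hv, hb⟩
    have hvE := hb.subset_ground (mem_insert _ _)
    have hvB : v ∈ B := by_contra fun h ↦ hv ⟨hvE, h⟩
    refine ⟨hvB, huB, ?_⟩
    have := hb.compl_isBase_of_dual
    convert this using 1
    ext z
    simp only [mem_insert_iff, mem_sdiff, mem_singleton_iff, not_or, not_and, not_not]
    constructor
    · rintro (rfl | ⟨hz, hzv⟩)
      · exact ⟨hu, fun h ↦ huB (h ▸ hvB), fun _ ↦ rfl⟩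
      · exact ⟨hB.subset_ground hz, hzv, fun h ↦ absurd hz h.2⟩
    · rintro ⟨hz, hzv, h⟩
      by_cases hzB : z ∈ B
      · exact Or.inr ⟨hzB, hzv⟩
      · exact Or.inl (h ⟨hz, hzB⟩)
  · intro h
    refine ⟨⟨h.mem_ground, h.2.1⟩, fun h' ↦ h'.2 h.1, ?_⟩
    have := h.2.2.compl_isBase_dual
    convert this using 1
    ext z
    have hv := hB.subset_ground h.1
    simp only [mem_insert_iff, mem_sdiff, mem_singleton_iff, not_or, not_and, not_not]
    constructor
    · rintro (rfl | ⟨hz, hzv⟩)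
      · exact ⟨hv, fun h' ↦ h.2.1 (h' ▸ h.1), fun _ ↦ rfl⟩
      · exact ⟨hz.1, hzv, fun h ↦ absurd h hz.2⟩
    · rintro ⟨hz, hzv, h'⟩
      by_cases hzB : z ∈ B
      · exact Or.inl (h' hzB)
      · exact Or.inr ⟨⟨hz, hzB⟩, hzv⟩

namespace IsConnectedFlat

lemma rk_lt_ncard (h : IsConnectedFlat M K G) (hx : ∀ i ∈ K, 0 < x i ∧ x i < 1)
    (hxG : x ∈ rankHyperplane M G) : rk M G < G.ncard := by
  have := finsum_mem_lt_ncard (M.set_finite G (h.subset.trans h.subset_ground)) h.nonempty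
    fun i hi ↦ hx i (h.subset hi)
  rw [finsum_mem_of_mem_rankHyperplane hxG] at this
  exact_mod_cast this

lemma rk_lt_rk (h : IsConnectedFlat M K G) : rk M G < rk M K := by
  refine lt_of_le_of_ne (rk_mono h.subset) fun e ↦ h.ne (Subset.antisymm h.subset ?_)
  obtain ⟨B, hB, hBG, hBK⟩ := exists_base_rk_rk (M := M) h.subset
  rw [← h.closure_inter]
  refine subset_inter ?_ Subset.rfl
  rw [← e, ← hBG] at hBK
  have := eq_of_subset_of_ncard_le (inter_subset_inter_right B h.subset) hBK.le
    (hB.finite.inter_of_left K)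
  refine (subset_closure_of_rk hB h.subset_ground (by omega)).trans ?_
  rw [← this]
  exact M.closure_subset_closure inter_subset_right

/-- A connected flat inside another one whose restriction is uniform has full rank in it. -/
lemma eq_of_subset (h₁ : IsConnectedFlat M K G₁) (h₂ : IsConnectedFlat M K G₂)
    (hr : rk M G₁ < G₁.ncard) (hu : UniformOn M ∅ G₂) (h : G₁ ⊆ G₂) : G₁ = G₂ := by
  rcases hu G₁ h with hle | hle
  · simp only [rk_empty, empty_union] at hle
    omega
  · simp only [empty_union] at hle
    refine Subset.antisymm h ?_
    obtain ⟨B, hB, hBG, hBK⟩ := exists_base_rk_rk (M := M) h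
    rw [← h₁.closure_inter]
    refine subset_inter ?_ h₂.subset
    have := eq_of_subset_of_ncard_le (inter_subset_inter_right B h) (by omega)
      (hB.finite.inter_of_left G₂)
    refine (subset_closure_of_rk hB (h₂.subset.trans h₂.subset_ground) hBK).trans ?_
    rw [← this]
    exact M.closure_subset_closure inter_subset_right

/-- If the hyperplanes of two connected flats of a component meet inside the open cube, then for one
of them the restriction or the contraction is not uniform. -/
lemma not_uniformOn (h₁ : IsConnectedFlat M K G₁) (h₂ : IsConnectedFlat M K G₂) (hne : G₁ ≠ G₂)
    (hx : ∀ i ∈ K, 0 < x i ∧ x i < 1) (hxK : x ∈ rankHyperplane M K)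
    (hx₁ : x ∈ rankHyperplane M G₁) (hx₂ : x ∈ rankHyperplane M G₂) :
    ¬ (UniformOn M ∅ G₁ ∧ UniformOn M ∅ G₂ ∧ UniformOn M G₁ (K \ G₁)) := by
  rintro ⟨u₁, u₂, w⟩
  have hKf := M.set_finite K h₁.subset_ground
  have hr₁ := h₁.rk_lt_ncard hx hx₁
  have hr₂ := h₂.rk_lt_ncard hx hx₂
  have n₁₂ : (G₁ \ G₂).Nonempty :=
    sdiff_nonempty.2 fun h ↦ hne (h₁.eq_of_subset h₂ hr₁ u₂ h)
  have n₂₁ : (G₂ \ G₁).Nonempty :=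
    sdiff_nonempty.2 fun h ↦ hne (h₂.eq_of_subset h₁ hr₂ u₁ h).symm
  have hU : G₁ ∪ G₂ ⊆ K := union_subset h₁.subset h₂.subset
  have hxs : ∀ A ⊆ K, ∀ i ∈ A, 0 < x i ∧ x i < 1 := fun A hA i hi ↦ hx i (hA hi)
  have hfin : ∀ A ⊆ K, A.Finite := fun A hA ↦ hKf.subset hA
  have s₁ := finsum_mem_of_mem_rankHyperplane hx₁
  have s₂ := finsum_mem_of_mem_rankHyperplane hx₂
  have sK := finsum_mem_of_mem_rankHyperplane hxK
  have hIK : G₁ ∩ G₂ ⊆ K := inter_subset_left.trans h₁.subset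
  have d₁ := finsum_mem_eq_add (x := x) (hfin _ h₁.subset) (inter_subset_left (s := G₁) (t := G₂))
  have d₂ := finsum_mem_eq_add (x := x) (hfin _ h₂.subset) (inter_subset_right (s := G₁) (t := G₂))
  have dU := finsum_mem_eq_add (x := x) (hfin _ hU) (subset_union_left (s := G₁) (t := G₂))
  have dK := finsum_mem_eq_add (x := x) hKf hU
  rw [sdiff_self_inter] at d₁
  rw [inter_comm, sdiff_self_inter, inter_comm] at d₂
  rw [union_sdiff_left] at dU
  have p₁ := finsum_mem_pos (hfin _ (sdiff_subset.trans h₁.subset)) n₁₂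
    (hxs _ (sdiff_subset.trans h₁.subset))
  have p₂ := finsum_mem_lt_ncard (hfin _ (sdiff_subset.trans h₂.subset)) n₂₁
    (hxs _ (sdiff_subset.trans h₂.subset))
  have pK := finsum_mem_nonneg_of_pos (hfin _ (sdiff_subset (t := G₁ ∪ G₂))) (hxs _ sdiff_subset)
  have hsub := rk_submod (M := M) G₁ G₂
  have hsubR : (rk M (G₁ ∩ G₂) : ℝ) + rk M (G₁ ∪ G₂) ≤ rk M G₁ + rk M G₂ := by exact_mod_cast hsub
  have uI := u₁ (G₁ ∩ G₂) inter_subset_left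
  simp only [rk_empty, empty_union, zero_add] at uI
  -- with submodularity, this bounds the rank of `G₁ ∪ G₂` by its coordinate sum
  have hI : ∑ᶠ i ∈ G₁ ∩ G₂, x i ≤ rk M (G₁ ∩ G₂) := by
    rcases uI with h | h
    · exact (finsum_mem_le_ncard (hfin _ hIK) (hxs _ hIK)).trans (by exact_mod_cast h)
    · have : (rk M G₁ : ℝ) ≤ rk M (G₁ ∩ G₂) := by exact_mod_cast h
      linarith
  have wU := w (G₂ \ G₁) (sdiff_subset_sdiff_left h₂.subset)
  rw [union_sdiff_self, union_sdiff_cancel h₁.subset] at wU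
  rcases wU with h | h
  · have : (rk M G₁ : ℝ) + (G₂ \ G₁).ncard ≤ rk M (G₁ ∪ G₂) := by exact_mod_cast h
    linarith
  · have hK : (rk M K : ℝ) ≤ rk M (G₁ ∪ G₂) := by exact_mod_cast h
    have hUK : G₁ ∪ G₂ = K := by
      refine Subset.antisymm hU (sdiff_eq_empty.1 ?_)
      by_contra! hne
      have := finsum_mem_pos (hfin _ sdiff_subset) hne (hxs _ sdiff_subset)
      linarith
    rcases uI with h' | h'
    · -- `G₁` and `G₂` are disjoint, so that they separate the component
      have h'' : ((G₁ ∩ G₂).ncard : ℝ) ≤ rk M (G₁ ∩ G₂) := by exact_mod_cast h'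
      have hempty : G₁ ∩ G₂ = ∅ := by
        by_contra! hne
        have := finsum_mem_lt_ncard (hfin _ hIK) hne (hxs _ hIK)
        linarith
      have hc := h₁.connectedOn G₁ h₁.subset h₁.nonempty h₁.ne
      have e : K \ G₁ = G₂ := by
        rw [← hUK, union_sdiff_left, sdiff_eq_left, disjoint_comm, disjoint_iff_inter_eq_empty]
        exact hempty
      rw [e] at hc
      simp only [empty_union, rk_empty, add_zero] at hc
      rw [← hUK] at hc
      have := rk_union_le (M := M) G₁ G₂
      have hsum : (rk M G₁ : ℝ) + rk M G₂ ≤ rk M K := by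
        have h0 : (rk M (G₁ ∩ G₂) : ℝ) = 0 := by rw [hempty, rk_empty, Nat.cast_zero]
        linarith
      rw [← hUK] at hsum
      norm_cast at hsum
      omega
    · have : (rk M G₁ : ℝ) ≤ rk M (G₁ ∩ G₂) := by exact_mod_cast h'
      linarith

/-! ### Six-element minors from a connected flat -/

variable {u v : α}

/-- If `B` spans `G`, then the fundamental circuits of the elements of `G` stay in `G`. -/
lemma not_exch (h : IsConnectedFlat M K G) (hB : M.IsBase B) (hBG : (B ∩ G).ncard = rk M G)
    {y : α} (hu : u ∉ G) (hy : y ∈ G) : ¬ Exch M B u y := fun hex ↦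
  hu (hex.mem_of_mem_closure inter_subset_left
    (subset_closure_of_rk hB (h.subset.trans h.subset_ground) hBG hy)).2

lemma exists_exch (h : IsConnectedFlat M K G) (hB : M.IsBase B) (hA : A ⊆ K) (hne : A.Nonempty)
    (hAK : A ≠ K) : ∃ x ∈ K, ∃ y ∈ K, Exch M B x y ∧ ¬ (x ∈ A ↔ y ∈ A) :=
  h.connectedOn.exists_exch hB (empty_subset _) h.subset_ground (by simp)
    (by rw [empty_union, h.isSeparator.ncard_inter h.subset_ground hB]) hA hne hAK

lemma exists_exch_flat (h : IsConnectedFlat M K G) (hB : M.IsBase B)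
    (hBG : (B ∩ G).ncard = rk M G) (hA : A ⊆ G) (hne : A.Nonempty)
    (hAK : A ≠ G) : ∃ x ∈ G, ∃ y ∈ G, Exch M B x y ∧ ¬ (x ∈ A ↔ y ∈ A) :=
  h.connectedOn_flat.exists_exch hB (empty_subset _) (h.subset.trans h.subset_ground) (by simp)
    (by rw [empty_union, hBG]) hA hne hAK

lemma exists_exch_contract (h : IsConnectedFlat M K G) (hB : M.IsBase B)
    (hBG : (B ∩ G).ncard = rk M G) (hA : A ⊆ K \ G) (hne : A.Nonempty)
    (hAK : A ≠ K \ G) : ∃ x ∈ K \ G, ∃ y ∈ K \ G, Exch M B x y ∧ ¬ (x ∈ A ↔ y ∈ A) := by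
  refine h.connectedOn_contract.exists_exch hB (h.subset.trans h.subset_ground)
    (sdiff_subset.trans h.subset_ground) hBG ?_ hA hne hAK
  rw [union_sdiff_cancel h.subset, h.isSeparator.ncard_inter h.subset_ground hB]

/-- The fundamental graph of a base that spans `G` has an edge leaving `G`; the ends of this edge
have neighbours inside and outside `G`, respectively. -/
lemma exists_path (h : IsConnectedFlat M K G) (hr : rk M G < G.ncard) (hB : M.IsBase B)
    (hBG : (B ∩ G).ncard = rk M G) : ∃ e ∈ G, ∃ b ∈ K \ G, ∃ f ∈ G, ∃ c ∈ K \ G,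
      Exch M B e b ∧ Exch M B e f ∧ Exch M B c b := by
  obtain ⟨e, he, b, hb, heb, hne⟩ := h.exists_exch hB h.subset h.nonempty h.ne
  have hbG : b ∉ G := fun hbG ↦ h.not_exch hB hBG (fun heG ↦ hne (iff_of_true heG hbG)) hbG heb
  have heG : e ∈ G := by
    by_contra heG
    exact hne (iff_of_false heG hbG)
  obtain ⟨e', -, f, hf, hef, hne'⟩ := h.exists_exch_flat hB hBG (singleton_subset_iff.2 heG)
    (singleton_nonempty e) (by
      intro heq
      rw [← heq, inter_eq_right.2 (singleton_subset_iff.2 heb.1)] at hBG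
      rw [← heq] at hr
      omega)
  have hfe : f ≠ e := fun h' ↦ hef.2.1 (h' ▸ heb.1)
  have he' : e' = e := by
    by_contra hee
    exact hne' (iff_of_false hee hfe)
  obtain ⟨c, hc, b', -, hcb, hne''⟩ := h.exists_exch_contract hB hBG
    (singleton_subset_iff.2 (show b ∈ K \ G from ⟨hb, hbG⟩)) (singleton_nonempty b) (by
      intro heq
      have h1 := h.isSeparator.ncard_inter h.subset_ground hB
      rw [← union_sdiff_cancel h.subset, inter_union_distrib_left, ← heq,
        inter_singleton_eq_empty.2 heb.2.1, union_empty, hBG, heq,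
        union_sdiff_cancel h.subset] at h1
      exact h.rk_lt_rk.ne h1)
  have hcb' : c ≠ b := fun h' ↦ heb.2.1 (h' ▸ hcb.1)
  have hb' : b' = b := by
    by_contra hee
    exact hne'' (iff_of_false hcb' hee)
  subst he' hb'
  exact ⟨_, heG, _, ⟨hb, hbG⟩, f, hf, c, hc, heb, hef, hcb⟩

/-- The edge that leaves `G` is attached to the fundamental graph outside `G`, which is not complete
bipartite. -/
lemma exists_isMinor_of_contract (h : IsConnectedFlat M K G) (hr : rk M G < G.ncard)
    (hB : M.IsBase B) (hBG : (B ∩ G).ncard = rk M G) (hu : u ∈ B ∩ (K \ G)) (hv : v ∈ (K \ G) \ B)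
    (huv : ¬ Exch M B u v) : ∃ N, N ≤m M ∧ ∃ g : Fin 6 → α, Presents N g basesS₁ ∨
      Presents N g basesS₃ ∨ Presents N g basesS₄ := by
  obtain ⟨e, he, b, hb, f, hf, -, -, heb, hef, -⟩ := h.exists_path hr hB hBG
  refine exists_isMinor_of_exch (P := B ∩ (K \ G)) (Q := (K \ G) \ B) hB inter_subset_left
    disjoint_sdiff_left ?_ hu hv huv hef (fun h ↦ h.2.2 he) (fun h ↦ h.1.2 hf)
    (fun z hz ↦ h.not_exch hB hBG hz.2.2 hf) ⟨hb, heb.2.1⟩ heb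
  have e : B ∩ (K \ G) ∪ (K \ G) \ B = K \ G := by
    rw [inter_comm, inter_union_sdiff]
  rw [e]
  intro A hA hne hAK
  obtain ⟨z, hz, y, hy, hex, hn⟩ := h.exists_exch_contract hB hBG hA hne hAK
  exact ⟨z, ⟨hex.1, hz⟩, y, ⟨hy, hex.2.1⟩, hex, hn⟩

/-- The dual situation: the edge that leaves `G` is attached to the fundamental graph inside `G`,
which is not complete bipartite. -/
lemma exists_isMinor_dual_of_flat (h : IsConnectedFlat M K G) (hr : rk M G < G.ncard)
    (hB : M.IsBase B) (hBG : (B ∩ G).ncard = rk M G) (hu : u ∈ B ∩ G) (hv : v ∈ G \ B)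
    (huv : ¬ Exch M B u v) : ∃ N, N ≤m M✶ ∧ ∃ g : Fin 6 → α, Presents N g basesS₁ ∨
      Presents N g basesS₃ ∨ Presents N g basesS₄ := by
  obtain ⟨e, he, b, hb, -, -, c, hc, heb, -, hcb⟩ := h.exists_path hr hB hBG
  have hGE := h.subset.trans h.subset_ground
  refine exists_isMinor_of_exch (P := G \ B) (Q := B ∩ G) (u := v) (v := u) (e := b) (f := c)
    (b := e)
    hB.compl_isBase_dual (sdiff_subset_sdiff_left hGE)
    (disjoint_sdiff_right.mono_left inter_subset_left) ?_ hv hu (by rwa [exch_dual_iff hB])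
    (by rwa [exch_dual_iff hB]) (fun h ↦ hb.2 h.1) (fun h ↦ hc.2 h.2)
    (fun z hz ↦ by rw [exch_dual_iff hB]; exact h.not_exch hB hBG hc.2 hz.1) ⟨heb.1, he⟩
    (by rwa [exch_dual_iff hB])
  have e : G \ B ∪ B ∩ G = G := by
    rw [inter_comm, union_comm, inter_union_sdiff]
  rw [e]
  intro A hA hne hAK
  obtain ⟨z, hz, y, hy, hex, hn⟩ := h.exists_exch_flat hB hBG hA hne hAK
  exact ⟨y, ⟨hy, hex.2.1⟩, z, ⟨hex.1, hz⟩, (exch_dual_iff hB).2 hex, fun h ↦ hn h.symm⟩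

end IsConnectedFlat

omit [M.Finite] in
lemma isMinor_dual {N : Matroid α} (h : N ≤m M✶) : N✶ ≤m M := by
  obtain ⟨C, D, rfl⟩ := h
  rw [Matroid.dual_contract_delete, Matroid.dual_dual]
  have h1 : M ＼ C ≤m M := by simpa using M.contract_delete_isMinor ∅ C
  have h2 : M ＼ C ／ D ≤m M ＼ C := by simpa using (M ＼ C).contract_delete_isMinor D ∅
  exact h2.trans h1

lemma Presents.dual {β : Type*} [Fintype β] [DecidableEq β] {N : Matroid α} {g : β → α}
    {𝓑 𝓑' : Finset (Finset β)} (h : Presents N g 𝓑) (τ : Equiv.Perm β)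
    (hτ : ∀ T, (T.image τ)ᶜ ∈ 𝓑 ↔ T ∈ 𝓑') : Presents N✶ (g ∘ τ) 𝓑' := by
  refine Presents.comp_equiv (N := N✶) h.injective h.ground τ fun T ↦ ?_
  rw [← hτ, ← h.isBase, Finset.coe_compl, image_compl_eq_range_sdiff_image h.injective, ← h.ground,
    Matroid.dual_isBase_iff (h.ground ▸ image_subset_range _ _)]

omit [M.Finite] in
/-- The dual of `S₁` is `S₂`, while `S₃` and `S₄` are self-dual. -/
lemma exists_isMinor_of_isMinor_dual (h : ∃ N, N ≤m M✶ ∧ ∃ g : Fin 6 → α, Presents N g basesS₁ ∨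
    Presents N g basesS₃ ∨ Presents N g basesS₄) :
    ∃ N, N ≤m M ∧ ∃ g : Fin 6 → α, Presents N g basesS₂ ∨ Presents N g basesS₃ ∨
      Presents N g basesS₄ := by
  obtain ⟨N, hN, g, h | h | h⟩ := h
  · exact ⟨N✶, isMinor_dual hN, _, Or.inl (h.dual (Equiv.refl _) (by decide +kernel))⟩
  · exact ⟨N✶, isMinor_dual hN, _, Or.inr (Or.inl (h.dual
      ⟨![1, 0, 4, 5, 2, 3], ![1, 0, 4, 5, 2, 3], by decide, by decide⟩ (by decide +kernel)))⟩
  · exact ⟨N✶, isMinor_dual hN, _, Or.inr (Or.inr (h.dual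
      ⟨![0, 1, 4, 5, 2, 3], ![0, 1, 4, 5, 2, 3], by decide, by decide⟩ (by decide +kernel)))⟩

/-- Two connected flats of the same component whose hyperplanes meet inside the open cube: one of
the restrictions and contractions at them is not uniform, and a base whose fundamental graph
witnesses this produces the minor, in `M` for a contraction and in the dual of `M` for a restriction. -/
lemma exists_isMinor_of_same_component (h₁ : IsConnectedFlat M K G₁) (h₂ : IsConnectedFlat M K G₂)
    (hne : G₁ ≠ G₂) (hx : ∀ i ∈ K, 0 < x i ∧ x i < 1) (hxK : x ∈ rankHyperplane M K)
    (hx₁ : x ∈ rankHyperplane M G₁) (hx₂ : x ∈ rankHyperplane M G₂) :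
    ∃ N, N ≤m M ∧ ∃ g : Fin 6 → α, Presents N g basesS₁ ∨ Presents N g basesS₂ ∨
      Presents N g basesS₃ ∨ Presents N g basesS₄ := by
  have hflat : ∀ {G}, IsConnectedFlat M K G → rk M G < G.ncard → ¬ UniformOn M ∅ G →
      ∃ N, N ≤m M ∧ ∃ g : Fin 6 → α, Presents N g basesS₁ ∨ Presents N g basesS₂ ∨
      Presents N g basesS₃ ∨ Presents N g basesS₄ := by
    intro G h hr hu
    obtain ⟨B, hB, -, hBG, u, hu, v, hv, huv⟩ := exists_not_exch_of_not_uniformOn hu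
      (empty_disjoint _) (empty_subset _) (h.subset.trans h.subset_ground)
    rw [empty_union] at hBG
    obtain ⟨N, hN, g, hg⟩ := exists_isMinor_of_isMinor_dual
      (h.exists_isMinor_dual_of_flat hr hB hBG hu hv huv)
    exact ⟨N, hN, g, Or.inr hg⟩
  by_cases u₁ : UniformOn M ∅ G₁
  · by_cases u₂ : UniformOn M ∅ G₂
    · obtain ⟨B, hB, hBG, -, u, hu, v, hv, huv⟩ := exists_not_exch_of_not_uniformOn
        (fun w ↦ h₁.not_uniformOn h₂ hne hx hxK hx₁ hx₂ ⟨u₁, u₂, w⟩) disjoint_sdiff_right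
        (h₁.subset.trans h₁.subset_ground) (sdiff_subset.trans h₁.subset_ground)
      obtain ⟨N, hN, g, hg⟩ := h₁.exists_isMinor_of_contract (h₁.rk_lt_ncard hx hx₁) hB hBG hu hv
        huv
      exact ⟨N, hN, g, hg.imp_right Or.inr⟩
    · exact hflat h₂ (h₂.rk_lt_ncard hx hx₂) u₂
  · exact hflat h₁ (h₁.rk_lt_ncard hx hx₁) u₁

end SameComponent

/-! ### Connected flats in two different components -/

section TwoComponents

open scoped Matroid

variable {α : Type*} {M : Matroid α} {A B G G₁ G₂ K K₁ K₂ : Set α}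

/-- A four-element matroid in which `{0, 2}` is a base whose fundamental graph is the path
`0 - 1 - 2 - 3`. -/
lemma four_element_classification {p : Finset (Fin 4) → Prop} (hcard : ∀ T, p T → T.card = 2)
    (hex : ∀ A B, p A → p B → ∀ a ∈ A \ B, ∃ b ∈ B \ A, p (insert b (A.erase a)))
    (h02 : p {0, 2}) (h12 : p {1, 2}) (h01 : p {0, 1}) (h03 : p {0, 3}) (h23 : ¬ p {2, 3})
    (T : Finset (Fin 4)) : p T ↔ T ∈ basesMW₂ := by
  have h13 : p {1, 3} := by
    obtain ⟨b, hb, h⟩ := hex {0, 3} {1, 2} h03 h12 0 (by decide)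
    have hb' : b = 1 ∨ b = 2 := by
      clear h
      revert b
      decide
    rcases hb' with rfl | rfl
    · exact h
    · exact absurd h h23
  constructor
  · intro h
    rw [basesMW₂, Finset.mem_filter, Finset.mem_powersetCard]
    refine ⟨⟨Finset.subset_univ _, hcard T h⟩, fun hT ↦ h23 ?_⟩
    rwa [Finset.eq_of_subset_of_card_le hT (hcard T h).le]
  · have : ∀ T ∈ basesMW₂, T = {0, 2} ∨ T = {1, 2} ∨ T = {0, 1} ∨ T = {0, 3} ∨ T = {1, 3} := by
      decide +kernel
    intro h
    rcases this T h with rfl | rfl | rfl | rfl | rfl <;> assumption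

variable [M.Finite]

/-- A component that contains a connected flat `G` with `r(G) < |G|` has `M(W₂)` as a minor. -/
lemma IsConnectedFlat.exists_MW₂ (h : IsConnectedFlat M K G) (hr : rk M G < G.ncard)
    (hB : M.IsBase B) (hBG : (B ∩ G).ncard = rk M G) :
    ∃ a : Fin 4 → α, a.Injective ∧ (∀ i, a i ∈ K) ∧ (∀ i, a i ∈ B ↔ i ∈ ({0, 2} : Finset (Fin 4))) ∧
      ∀ T : Finset (Fin 4), M.IsBase (a '' T ∪ (B \ a '' ({0, 2} : Finset (Fin 4)))) ↔
        T ∈ basesMW₂ := by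
  obtain ⟨v, hv, hvB⟩ : ∃ v ∈ G, v ∉ B := by
    by_contra! hall
    rw [inter_eq_right.2 hall] at hBG
    omega
  obtain ⟨u, ⟨huB, huK⟩, huG⟩ : ∃ u ∈ B ∩ K, u ∉ G := by
    by_contra! hall
    have h1 := ncard_le_ncard (show B ∩ K ⊆ B ∩ G from fun u hu ↦ ⟨hu.1, hall u hu⟩)
      (hB.finite.inter_of_left G)
    rw [h.isSeparator.ncard_inter h.subset_ground hB] at h1
    have := h.rk_lt_rk
    omega
  obtain ⟨a₀, h0, a₁, h1, a₂, h2, h01, h21, h2v, h0v⟩ := exists_induced_path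
    (P := B ∩ K) (Q := K \ B)
    (disjoint_sdiff_right.mono_left inter_subset_left) (R := Exch M B) (by
      have e : B ∩ K ∪ K \ B = K := by rw [inter_comm, inter_union_sdiff]
      rw [e]
      intro A hA hne hAK
      obtain ⟨z, hz, y, hy, hex, hn⟩ := h.exists_exch hB hA hne hAK
      exact ⟨z, ⟨hex.1, hz⟩, y, ⟨hy, hex.2.1⟩, hex, hn⟩) ⟨huB, huK⟩ ⟨h.subset hv, hvB⟩
    (h.not_exch hB hBG huG hv)
  have hBf : ∀ x ∈ B, ∀ y ∉ B, x ≠ y := fun x hx y hy e ↦ hy (e ▸ hx)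
  have h02 : a₀ ≠ a₂ := fun e ↦ h0v (e ▸ h2v)
  have h13 : a₁ ≠ v := fun e ↦ h0v (e ▸ h01)
  let a : Fin 4 → α := ![a₀, a₁, a₂, v]
  have ha : a.Injective := by
    have c1 := hBf a₀ h0.1
    have c2 := hBf a₂ h2.1
    have d1 := h1.2
    intro i j hij
    fin_cases i <;> fin_cases j <;> first | rfl | (exfalso; simp [a] at hij; grind)
  have haB : ∀ i, a i ∈ B ↔ i ∈ ({0, 2} : Finset (Fin 4)) := by
    intro i
    fin_cases i <;> simp [a, h0.1, h1.2, h2.1, hvB]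
  have haK : ∀ i, a i ∈ K := by
    intro i
    fin_cases i
    exacts [h0.2, h1.1, h2.2, h.subset hv]
  obtain ⟨N, hN, hE, hNB, hI0, hexch⟩ := exists_isMinor_enum hB ha {0, 2} (fun i hi ↦ (haB i).2 hi)
    (fun i hi ↦ ⟨h.subset_ground (haK i), fun hi' ↦ hi ((haB i).1 hi')⟩)
  refine ⟨a, ha, haK, haB, fun T ↦ ?_⟩
  rw [← hNB]
  exact four_element_classification (p := fun T ↦ N.IsBase (a '' T))
    (fun T hT ↦ card_eq_of_isBase_image ha hT hI0)
    (fun A B hA hB x hx ↦ exists_exchange_image ha hA hB hx) hI0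
    ((hexch 0 (by decide) 1 (by decide) _ (by decide)).2 h01)
    ((hexch 2 (by decide) 1 (by decide) _ (by decide)).2 h21)
    ((hexch 2 (by decide) 3 (by decide) _ (by decide)).2 h2v)
    (fun h' ↦ h0v ((hexch 0 (by decide) 3 (by decide) _ (by decide)).1 h')) T

/-- Changes of a base on the two sides of a separator are independent of each other. -/
lemma IsSeparator.isBase_union_iff (h : IsSeparator M K) (hK : K ⊆ M.E) (hB : M.IsBase B)
    {a a₀ b b₀ : Set α} (ha : a ⊆ K) (ha₀ : a₀ ⊆ K) (hb : ∀ z ∈ b, z ∉ K) (hb₀ : ∀ z ∈ b₀, z ∉ K) :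
    M.IsBase (a ∪ b ∪ (B \ (a₀ ∪ b₀))) ↔ M.IsBase (a ∪ (B \ a₀)) ∧ M.IsBase (b ∪ (B \ b₀)) := by
  constructor
  · intro hX
    constructor
    · convert h.isBase_mix hK hX hB using 1
      ext z
      have h1 := @ha z
      have h2 := @ha₀ z
      have h3 := hb z
      have h4 := hb₀ z
      simp only [mem_union, mem_inter_iff, mem_sdiff]
      tauto
    · convert h.isBase_mix hK hB hX using 1
      ext z
      have h1 := @ha z
      have h2 := @ha₀ z
      have h3 := hb z
      have h4 := hb₀ z
      simp only [mem_union, mem_inter_iff, mem_sdiff]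
      tauto
  · rintro ⟨hX, hY⟩
    convert h.isBase_mix hK hX hY using 1
    ext z
    have h1 := @ha z
    have h2 := @ha₀ z
    have h3 := hb z
    have h4 := hb₀ z
    simp only [mem_union, mem_inter_iff, mem_sdiff]
    tauto

/-- Two components that contain connected flats `G` with `r(G) < |G|`. -/
lemma exists_isMinor_of_two_components (h₁ : IsConnectedFlat M K₁ G₁) (h₂ : IsConnectedFlat M K₂ G₂)
    (hK : Disjoint K₁ K₂) (hr₁ : rk M G₁ < G₁.ncard) (hr₂ : rk M G₂ < G₂.ncard) :
    ∃ N, N ≤m M ∧ ∃ g, Presents N g basesS₀ := by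
  have hG₂K : Disjoint G₂ K₁ := hK.symm.mono_left h₂.subset
  obtain ⟨B, hB, hBG⟩ := exists_base_rk M (G₁ ∪ G₂)
  have hBG' : (B ∩ G₁).ncard = rk M G₁ ∧ (B ∩ G₂).ncard = rk M G₂ := by
    have h := h₁.isSeparator.rk_eq_add h₁.subset_ground (G₁ ∪ G₂)
    rw [union_inter_distrib_right, inter_eq_left.2 h₁.subset, hG₂K.inter_eq, union_empty,
      union_sdiff_distrib, sdiff_eq_empty.2 h₁.subset, empty_union, sdiff_eq_left.2 hG₂K] at h
    rw [inter_union_distrib_left, ncard_union_eq ((hK.mono h₁.subset h₂.subset).mono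
      inter_subset_right inter_subset_right) (hB.finite.inter_of_left _)
      (hB.finite.inter_of_left _)] at hBG
    have := base_inter_ncard_le hB G₁
    have := base_inter_ncard_le hB G₂
    omega
  obtain ⟨a, ha, haK, haB, hpa⟩ := h₁.exists_MW₂ hr₁ hB hBG'.1
  obtain ⟨b, hb, hbK, hbB, hpb⟩ := h₂.exists_MW₂ hr₂ hB hBG'.2
  let g : Fin 4 ⊕ Fin 4 → α := Sum.elim a b
  have hg : g.Injective := ha.sumElim hb fun i j e ↦ disjoint_left.1 hK (haK i) (e ▸ hbK j)
  obtain ⟨N, hN, hE, hNB, -, -⟩ := exists_isMinor_enum hB hg {.inl 0, .inl 2, .inr 0, .inr 2}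
    (by
      rintro (i | i) hi
      · exact (haB i).2 (by simpa using hi)
      · exact (hbB i).2 (by simpa using hi))
    (by
      rintro (i | i) hi
      · exact ⟨h₁.subset_ground (haK i), fun h ↦ hi (by simpa using (haB i).1 h)⟩
      · exact ⟨h₂.subset_ground (hbK i), fun h ↦ hi (by simpa using (hbB i).1 h)⟩)
  refine ⟨N, hN, g, hg, hE, fun T ↦ ?_⟩
  rw [hNB, mem_basesS₀_iff, ← hpa, ← hpb]
  have hgT : ∀ T : Finset (Fin 4 ⊕ Fin 4), g '' T = a '' T.toLeft ∪ b '' T.toRight := by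
    intro T
    ext z
    simp [g]
  rw [hgT, hgT]
  have e1 : (({.inl 0, .inl 2, .inr 0, .inr 2} : Finset (Fin 4 ⊕ Fin 4))).toLeft = {0, 2} := by
    decide
  have e2 : (({.inl 0, .inl 2, .inr 0, .inr 2} : Finset (Fin 4 ⊕ Fin 4))).toRight = {0, 2} := by
    decide
  rw [e1, e2]
  have haK' : ∀ U : Finset (Fin 4), a '' U ⊆ K₁ := by rintro U _ ⟨i, -, rfl⟩; exact haK i
  have hbK' : ∀ U : Finset (Fin 4), ∀ z ∈ b '' U, z ∉ K₁ := by
    rintro U _ ⟨i, -, rfl⟩ h; exact disjoint_left.1 hK h (hbK i)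
  exact h₁.isSeparator.isBase_union_iff h₁.subset_ground hB (haK' _) (haK' _) (hbK' _) (hbK' _)

end TwoComponents

/-! ### Excluded minors -/

section ExcludedMinors

open scoped Matroid

variable {α : Type*} {M N : Matroid α} {A F G K K₁ K₂ G₁ G₂ : Set α} {x : α → ℝ}

lemma mem_rankHyperplane_of_forall_ncard [M.Finite] (hA : A ⊆ M.E)
    (h : ∀ B, M.IsBase B → (B ∩ A).ncard = rk M A)
    (hx : x ∈ (affineSpan ℝ (basePolytope M) : Set (α → ℝ))) : x ∈ rankHyperplane M A := by
  have hf := M.set_finite A hA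
  rw [mem_rankHyperplane hf, ← coordSum_apply]
  refine eq_of_mem_affineSpan _ (fun B hB ↦ ?_) hx
  rw [coordSum_apply, sum_indicator_one, hf.coe_toFinset, h B hB]

/-- The elements of a component with more than one element are neither loops nor coloops. -/
lemma IsConnectedFlat.mem_Ioo [M.Finite] (h : IsConnectedFlat M K G)
    (hx : x ∈ relInterior ((affineSpan ℝ (basePolytope M) : Set (α → ℝ)) ∩ Icc 0 1)) :
    ∀ i ∈ K, 0 < x i ∧ x i < 1 := by
  intro i hi
  have hne : {i} ≠ K := by
    rintro rfl
    exact h.ne (h.nonempty.subset_singleton_iff.1 h.subset)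
  obtain ⟨B, hB, hBi⟩ := h.connectedOn.exists_base_not_tight h.subset_ground
    (singleton_subset_iff.2 hi) (singleton_nonempty i) hne
  obtain ⟨B', hB', hBi'⟩ := exists_base_rk M {i}
  have h1 := rk_le_ncard (M := M) (finite_singleton i)
  have h2 := base_inter_ncard_le hB {i}
  rw [ncard_singleton] at h1
  refine ⟨pos_of_mem_relInterior hx hB' ?_, lt_one_of_mem_relInterior hx hB ?_⟩
  · by_contra hn
    rw [inter_singleton_eq_empty.2 hn, ncard_empty] at hBi'
    omega
  · intro hn
    rw [inter_eq_right.2 (singleton_subset_iff.2 hn), ncard_singleton] at h2 hBi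
    omega

lemma IsConnectedFlat.eq_or_disjoint [M.Finite] (h₁ : IsConnectedFlat M K₁ G₁)
    (h₂ : IsConnectedFlat M K₂ G₂) : K₁ = K₂ ∨ Disjoint K₁ K₂ := by
  rw [or_iff_not_imp_right, not_disjoint_iff_nonempty_inter]
  intro hne
  have hsep : IsSeparator M (K₁ ∩ K₂) := fun B hB x y hxy ↦ by
    simp [h₁.isSeparator hB x y hxy, h₂.isSeparator hB x y hxy]
  have key : ∀ {K G}, IsConnectedFlat M K G → K₁ ∩ K₂ ⊆ K → K₁ ∩ K₂ = K := by
    intro K G h hK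
    by_contra hn
    obtain ⟨B, hB, hBn⟩ := h.connectedOn.exists_base_not_tight h.subset_ground hK hne hn
    exact hBn (hsep.ncard_inter (hK.trans h.subset_ground) hB)
  rw [← key h₁ inter_subset_left]
  exact key h₂ inter_subset_right

/-- A matroid that is not split has one of `S₀, …, S₄` as a minor. -/
theorem exists_isMinor_of_not_isSplitMatroid [M.Finite] (hM : ¬ IsSplitMatroid M) :
    ∃ N, N ≤m M ∧ (IsIsomorphic N S₀ ∨ IsIsomorphic N S₁ ∨ IsIsomorphic N S₂ ∨
      IsIsomorphic N S₃ ∨ IsIsomorphic N S₄) := by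
  simp only [IsSplitMatroid, not_forall, not_not] at hM
  obtain ⟨F₁, F₂, ⟨hF₁, -⟩, ⟨hF₂, -⟩, hne, x, ⟨hx₁, hx₂⟩, hx⟩ := hM
  have key : ∀ {F}, IsFlacet M F → x ∈ rankHyperplane M F → ∃ K G, IsConnectedFlat M K G ∧
      F = M.closure G ∧ x ∈ rankHyperplane M K ∧ x ∈ rankHyperplane M G := by
    intro F hF hxF
    obtain ⟨K, G, h, hcl, hrk, hB⟩ := hF.exists_isConnectedFlat
    have hFE := hF.1.subset_ground
    have hGF : G ⊆ F := hcl ▸ M.subset_closure G (h.subset.trans h.subset_ground)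
    refine ⟨K, G, h, hcl, mem_rankHyperplane_of_forall_ncard h.subset_ground
      (fun B hB ↦ h.isSeparator.ncard_inter h.subset_ground hB) hx.1.1, ?_⟩
    have h1 := finsum_mem_of_mem_rankHyperplane hxF
    have h2 := finsum_mem_of_mem_rankHyperplane
      (mem_rankHyperplane_of_forall_ncard (sdiff_subset.trans hFE) hB hx.1.1)
    have h3 := finsum_mem_eq_add (x := x) (M.set_finite F hFE) hGF
    rw [h1, h2, hrk, Nat.cast_add] at h3
    exact (add_right_cancel h3).symm
  obtain ⟨K₁, G₁, h₁, hcl₁, hxK, hxG₁⟩ := key hF₁ hx₁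
  obtain ⟨K₂, G₂, h₂, hcl₂, -, hxG₂⟩ := key hF₂ hx₂
  rcases h₁.eq_or_disjoint h₂ with rfl | hd
  · obtain ⟨N, hN, g, h⟩ := exists_isMinor_of_same_component h₁ h₂
      (fun e ↦ hne (by rw [hcl₁, hcl₂, e])) (h₁.mem_Ioo hx) hxK hxG₁ hxG₂
    refine ⟨N, hN, Or.inr ?_⟩
    rw [isIsomorphic_S₁, isIsomorphic_S₂, isIsomorphic_S₃, isIsomorphic_S₄]
    exact h.imp (⟨g, ·⟩) (Or.imp (⟨g, ·⟩) (Or.imp (⟨g, ·⟩) (⟨g, ·⟩)))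
  · obtain ⟨N, hN, g, h⟩ := exists_isMinor_of_two_components h₁ h₂ hd
      (h₁.rk_lt_ncard (h₁.mem_Ioo hx) hxG₁) (h₂.rk_lt_ncard (h₂.mem_Ioo hx) hxG₂)
    exact ⟨N, hN, Or.inl (isIsomorphic_S₀.2 ⟨g, h⟩)⟩

lemma IsSeparator.dual (h : IsSeparator M A) : IsSeparator M✶ A := by
  intro B hB x y hxy
  rw [← sdiff_sdiff_cancel_left hB.subset_ground, Matroid.dual_ground,
    exch_dual_iff hB.compl_isBase_of_dual] at hxy
  exact (h hB.compl_isBase_of_dual y x hxy).symm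

lemma IsSeparator.delete (h : IsSeparator M A) (D : Set α) : IsSeparator (M ＼ D) A := by
  rintro B hB x y ⟨hx, hyB, hb⟩
  rw [Matroid.delete_isBase_iff] at hB hb
  obtain ⟨B', hB', hBB'⟩ := hB.indep.exists_isBase_superset
  have hycl : y ∈ M.closure B := hB.subset_closure (hb.subset (mem_insert _ _))
  have hyB' : y ∉ B' := by
    intro hy
    have hsub : B ⊆ B' \ {y} := subset_sdiff_singleton hBB' hyB
    exact hB'.indep.notMem_closure_sdiff_of_mem hy (M.closure_subset_closure hsub hycl)
  refine h hB' x y (by_contra fun hn ↦ ?_)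
  -- the fundamental circuit of `y` in the extended base lies in `B ∪ {y}`
  have hy : y ∈ M.closure (B \ {x}) := by
    refine mem_closure_of_exch hB' (M.mem_ground_of_mem_closure hycl) hyB' fun z hz ↦ ?_
    refine ⟨hz.mem_of_mem_closure hBB' hycl, ?_⟩
    rintro rfl
    exact hn hz
  refine hb.indep.notMem_closure_sdiff_of_mem (mem_insert _ _) (M.closure_subset_closure ?_ hy)
  exact fun z hz ↦ ⟨Or.inr hz, fun e ↦ hyB (e ▸ hz.1)⟩

lemma IsSeparator.of_isMinor (h : IsSeparator M A) (hN : N ≤m M) : IsSeparator N A := by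
  obtain ⟨C, D, rfl⟩ := hN
  have := (h.dual.delete C).dual
  rw [Matroid.dual_delete_dual] at this
  exact this.delete D

/-- Connectivity of a matroid with given bases can be checked on the index type. -/
lemma Presents.separator_trivial {β : Type*} [Fintype β] [DecidableEq β] {g : β → α}
    {𝓑 : Finset (Finset β)} (h : Presents M g 𝓑)
    (h𝓑 : ∀ A : Finset β, (∀ T ∈ 𝓑, ∀ i ∈ T, ∀ j ∉ T, insert j (T.erase i) ∈ 𝓑 → (i ∈ A ↔ j ∈ A)) →
      A = ∅ ∨ A = Finset.univ) (hA : IsSeparator M A) : Disjoint M.E A ∨ M.E ⊆ A := by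
  classical
  rcases h𝓑 (Finset.univ.filter fun i ↦ g i ∈ A) (fun T hT i hi j hj hex ↦ by
    simpa using hA ((h.isBase T).2 hT) _ _ (h.exch hi hj hex)) with e | e
  · left
    rw [h.ground, disjoint_left]
    rintro _ ⟨i, rfl⟩ hi
    have : i ∈ Finset.univ.filter fun i ↦ g i ∈ A := by simpa using hi
    simp [e] at this
  · right
    rw [h.ground]
    rintro _ ⟨i, rfl⟩
    have : i ∈ Finset.univ.filter fun i ↦ g i ∈ A := by rw [e]; exact Finset.mem_univ i
    simpa using this

/-- The matroids `S₁, …, S₄` are connected. -/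
lemma separator_trivial (h : IsIsomorphic M S₁ ∨ IsIsomorphic M S₂ ∨ IsIsomorphic M S₃ ∨
    IsIsomorphic M S₄) (hA : IsSeparator M A) : M.E.ncard = 6 ∧ (Disjoint M.E A ∨ M.E ⊆ A) := by
  rw [isIsomorphic_S₁, isIsomorphic_S₂, isIsomorphic_S₃, isIsomorphic_S₄] at h
  rcases h with ⟨g, h⟩ | ⟨g, h⟩ | ⟨g, h⟩ | ⟨g, h⟩
  all_goals exact ⟨h.ncard_ground, h.separator_trivial (by decide +kernel) hA⟩

/-- The two copies of `M(W₂)` are separators of `S₀`. -/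
lemma exists_separator_of_isIsomorphic_S₀ (h : IsIsomorphic M S₀) :
    M.E.ncard = 8 ∧ ∃ A ⊆ M.E, IsSeparator M A ∧ A.ncard = 4 := by
  obtain ⟨g, h⟩ := isIsomorphic_S₀.1 h
  have := h.finite
  let A : Finset (Fin 4 ⊕ Fin 4) := {.inl 0, .inl 1, .inl 2, .inl 3}
  refine ⟨h.ncard_ground, g '' A, h.ground ▸ image_subset_range _ _,
    isSeparator_of_ncard (n := 2) ?_, ?_⟩
  · intro B hB
    obtain ⟨T, hT, rfl⟩ := h.exists_finset hB
    rw [h.ncard_inter]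
    exact (Finset.mem_filter.1 hT).2.1
  · rw [ncard_image_of_injective _ h.injective, ncard_coe_finset]
    rfl

end ExcludedMinors

end SplitMatroids

open SplitMatroids in
theorem theorem1 {α : Type*} (M : Matroid α) [M.Finite] :
    SplitMatroids.IsExcludedMinor SplitMatroids.IsSplitMatroid M ↔
      SplitMatroids.IsIsomorphic M SplitMatroids.S₀ ∨
      SplitMatroids.IsIsomorphic M SplitMatroids.S₁ ∨
      SplitMatroids.IsIsomorphic M SplitMatroids.S₂ ∨
      SplitMatroids.IsIsomorphic M SplitMatroids.S₃ ∨
      SplitMatroids.IsIsomorphic M SplitMatroids.S₄ := by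
  constructor
  · rintro ⟨hM, hmin⟩
    obtain ⟨N, hN, h⟩ := exists_isMinor_of_not_isSplitMatroid hM
    by_cases hNM : N = M
    · exact hNM ▸ h
    · exact absurd (hmin N (Matroid.isStrictMinor_iff_isMinor_ne.2 ⟨hN, hNM⟩))
        (not_isSplitMatroid_of_isIsomorphic h)
  · intro h
    refine ⟨not_isSplitMatroid_of_isIsomorphic h, fun N hN ↦ ?_⟩
    by_contra hsplit
    have : N.Finite := ⟨M.ground_finite.subset hN.isMinor.subset⟩
    obtain ⟨N', hN', h'⟩ := exists_isMinor_of_not_isSplitMatroid hsplit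
    have : N'.Finite := ⟨N.ground_finite.subset hN'.subset⟩
    have hlt : N'.E.ncard < M.E.ncard := ncard_lt_ncard
      (hN'.subset.trans_ssubset hN.ssubset) M.ground_finite
    have htriv : IsSeparator M ∅ := fun B hB x y _ ↦ by simp
    have htriv' : IsSeparator N' ∅ := fun B hB x y _ ↦ by simp
    -- by the sizes of the ground sets, `M` is `S₀` and its minor is one of `S₁, …, S₄`; the minor
    -- is connected, so it lies in one of the two copies of `M(W₂)`, which are too small
    rcases h with h | h
    · obtain ⟨hc, A, hAE, hA, hA4⟩ := exists_separator_of_isIsomorphic_S₀ h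
      rcases h' with h' | h'
      · have := (exists_separator_of_isIsomorphic_S₀ h').1
        omega
      · obtain ⟨h6, hd | hs⟩ := separator_trivial h' (hA.of_isMinor (hN'.trans hN.isMinor))
        · have h1 := ncard_union_eq hd N'.ground_finite (M.set_finite A hAE)
          have h2 := ncard_le_ncard (union_subset (hN'.subset.trans hN.isMinor.subset) hAE)
            M.ground_finite
          omega
        · have := ncard_le_ncard hs (M.set_finite A hAE)
          omega
    · have hc := (separator_trivial h htriv).1
      rcases h' with h' | h'
      · have := (exists_separator_of_isIsomorphic_S₀ h').1
        omega
      · have := (separator_trivial h' htriv').1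
        omega
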